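/- **Setting.** Let $n\ge 1$. Consider a complex polynomial $P$ of degree $n$ and the real harmonic polynomial $u=\Re P$ on $\mathbb C=\mathbb R^2$ (imaginary parts are included, as $\Im P=\Re(-iP)$). The zero level set $\{u=0\}$ goes to infinity in exactly $2n$ equally spaced asymptotic directions. Choose one of them as the first and number them $1,\dots,2n$ counterclockwise. The forest of $u$ is the graph whose leaves are these $2n$ directions, whose inner nodes are the critical points of $u$ lying on $\{u=0\}$, and whose edges are the connected components of $\{u=0\}$ minus these critical points, each joining the two nodes or leaves that it reaches. Two forests are identified if there is a graph isomorphism between them that fixes every numbered leaf. Let $\mathfrak F_n$ be the set of all forests so obtained. The multiplicity of a critical point $p$ of $u=\Re P$ is the order of vanishing of $P'$ at $p$ (so multiplicity $m$ means that $m+1$ curves of the level set cross at $p$). A *parenthesised word in $n$ letters* is a word in the letters $1,\dots,n$, each occurring exactly once, in any order, with correctly nested pairs of parentheses inserted. The number of *entries* between a pair of parentheses is the number of letters between them, where every maximal parenthesised group strictly inside is counted as one single letter. The letter $i$ is attributed to the tree that contains the leaf $2i-1$. **Lemma.** There is an injective map (encoding) from $\mathfrak F_n$ to the set of parenthesised words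 in $n$ letters such that: 1. the forest consisting of $n$ disjoint curves joining leaf $2i-1$ to leaf $2i$ ($1\le i\le n$) is encoded by the word $12\cdots n$ without parentheses; 2. for every $u$ as above, $u$ has finitely many critical points on $\{u=0\}$, and their number is the number of pairs of parentheses in the word that encodes the forest of $u$; 3. more precisely, for every such $u$ there is a bijection between the pairs of parentheses of the word and the critical points of $u$ on $\{u=0\}$ such that, if a pair corresponds to the critical point $p$, then the number of entries between the two parentheses is the multiplicity of $p$ plus one, and every letter between them is attributed to the tree that contains $p$. -/

import Mathlib

/-- A parenthesised word over the alphabet `α`: it is empty, or a letter followed by a parenthesised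
word, or a parenthesised word between a pair of parentheses followed by a parenthesised word. -/
inductive ParenString (α : Type) : Type
  | nil : ParenString α
  | letter (a : α) (rest : ParenString α) : ParenString α
  | paren (inner : ParenString α) (rest : ParenString α) : ParenString α

namespace ParenString

/-- The letters of the word, from left to right, with all parentheses erased. -/
def letters {α : Type} : ParenString α → List α
  | nil => []
  | letter a r => a :: letters r
  | paren i r => letters i ++ letters r

/-- The number of entries of the word, where a letter outside all parentheses is an entry, and an
outermost parenthesised group is a single entry (a compound letter). -/
def entries {α : Type} : ParenString α → ℕ
  | nil => 0
  | letter _ r => entries r + 1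
  | paren _ r => entries r + 1

/-- The pairs of parentheses of the word, in the order of the opening parentheses; each pair is
given by the word that stands between its two parentheses. -/
def pairs {α : Type} : ParenString α → List (ParenString α)
  | nil => []
  | letter _ r => pairs r
  | paren i r => i :: (pairs i ++ pairs r)

end ParenString

/-- Parenthesised words in `n` letters: each of the `n` letters occurs exactly once. -/
def ParenWord (n : ℕ) : Type :=
  {w : ParenString (Fin n) // List.Perm w.letters (List.finRange n)}

/-- A real harmonic polynomial of degree `n`, given as `z ↦ Re P(z)` with a complex polynomial `P`
of degree `n` (imaginary parts are included, as `Im P = Re (-iP)`), together with the choice of the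
asymptotic direction `dir` of its zero set that is numbered first. -/
structure HarmonicPoly (n : ℕ) where
  P : Polynomial ℂ
  natDegree_eq : P.natDegree = n
  dir : ℂ
  norm_dir : ‖dir‖ = 1
  re_dir : (P.leadingCoeff * dir ^ n).re = 0

namespace HarmonicPoly

variable {n : ℕ}

/-- The harmonic polynomial as a real function on the plane. -/
def toFun (u : HarmonicPoly n) (z : ℂ) : ℝ := (u.P.eval z).re

/-- The zero level set. -/
def zeroSet (u : HarmonicPoly n) : Set ℂ := {z | u.toFun z = 0}

/-- The critical points lying on the zero level set. -/
def criticalSet (u : HarmonicPoly n) : Set ℂ := {z | z ∈ u.zeroSet ∧ fderiv ℝ u.toFun z = 0}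

/-- The multiplicity of a critical point of `Re P`: the order of vanishing of `P'` there. -/
noncomputable def multiplicity (u : HarmonicPoly n) (z : ℂ) : ℕ :=
  u.P.derivative.rootMultiplicity z

/-- The `2 n` asymptotic directions of the zero level set, numbered counterclockwise. -/
noncomputable def leafDir (u : HarmonicPoly n) (k : Fin (2 * n)) : ℂ :=
  u.dir * Complex.exp ((k : ℕ) * Real.pi / n * Complex.I)

/-- The vertices of the forest: the `2 n` leaves and the inner nodes. -/
abbrev Vertex (u : HarmonicPoly n) : Type := Fin (2 * n) ⊕ u.criticalSet

/-- The edge of the forest through a noncritical point `z` of the zero level set: the connected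
component of `z` in the zero level set minus the critical points. -/
def edge (u : HarmonicPoly n) (z : ℂ) : Set ℂ :=
  connectedComponentIn (u.zeroSet \ u.criticalSet) z

/-- The subset `E` of the plane reaches a vertex: it accumulates at the inner node, or goes to
infinity in the direction of the leaf. -/
def Reaches (u : HarmonicPoly n) (E : Set ℂ) : u.Vertex → Prop
  | Sum.inl k => ∃ s : ℕ → ℂ, (∀ m, s m ∈ E) ∧
      Filter.Tendsto (fun m => ‖s m‖) Filter.atTop Filter.atTop ∧
      Filter.Tendsto (fun m => s m / (‖s m‖ : ℂ)) Filter.atTop (nhds (u.leafDir k))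
  | Sum.inr p => (p : ℂ) ∈ closure E

/-- The forest (chord diagram) of the zero level set, as a graph on leaves and inner nodes: two
distinct vertices are adjacent if some edge of the level set reaches both. -/
def forestGraph (u : HarmonicPoly n) : SimpleGraph u.Vertex where
  Adj x y := x ≠ y ∧ ∃ z ∈ u.zeroSet \ u.criticalSet,
    u.Reaches (u.edge z) x ∧ u.Reaches (u.edge z) y
  symm := ⟨fun _ _ h => ⟨h.1.symm, by
    obtain ⟨_, z, hz, h1, h2⟩ := h
    exact ⟨z, hz, h2, h1⟩⟩⟩
  loopless := ⟨fun _ h => h.1 rfl⟩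

/-- Two harmonic polynomials have the same forest: the graphs are isomorphic by an isomorphism
that keeps each of the `2 n` numbered leaves on the boundary circle. -/
def SameForest (u v : HarmonicPoly n) : Prop :=
  ∃ e : u.forestGraph ≃g v.forestGraph, ∀ k : Fin (2 * n), e (Sum.inl k) = Sum.inl k

/-- The `i`-th of the leaves number 1, 3, 5, … -/
def oddLeaf (u : HarmonicPoly n) (i : Fin n) : u.Vertex :=
  Sum.inl ⟨2 * (i : ℕ), by have := i.isLt; omega⟩

/-- The `i`-th of the leaves number 2, 4, 6, … -/
def evenLeaf (u : HarmonicPoly n) (i : Fin n) : u.Vertex :=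
  Sum.inl ⟨2 * (i : ℕ) + 1, by have := i.isLt; omega⟩

/-- The initial diagram: `n` disjoint curves, joining leaf 1 to leaf 2, leaf 3 to leaf 4, etc. -/
def IsInitial (u : HarmonicPoly n) : Prop :=
  u.criticalSet = ∅ ∧ ∀ i : Fin n, u.forestGraph.Adj (u.oddLeaf i) (u.evenLeaf i)

end HarmonicPoly

/-- Having the same forest is an equivalence relation. -/
def forestSetoid (n : ℕ) : Setoid (HarmonicPoly n) where
  r := HarmonicPoly.SameForest
  iseqv :=
    { refl := fun u => ⟨SimpleGraph.Iso.refl, fun _ => rfl⟩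
      symm := by
        rintro u v ⟨e, he⟩
        refine ⟨e.symm, fun k => ?_⟩
        rw [← he k]
        exact e.symm_apply_apply _
      trans := by
        rintro u v w ⟨e, he⟩ ⟨f, hf⟩
        refine ⟨e.trans f, fun k => ?_⟩
        show f (e (Sum.inl k)) = Sum.inl k
        rw [he, hf] }

/-- The set of forests of harmonic polynomials of degree `n`. -/
def Forest (n : ℕ) : Type := Quotient (forestSetoid n)

/-- The forest of a harmonic polynomial. -/
def HarmonicPoly.forest {n : ℕ} (u : HarmonicPoly n) : Forest n :=
  Quotient.mk (forestSetoid n) u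

/-! On the zero set P = i h, where h = `u.ht` = Im P, and away from critical points h is a local
coordinate; so every edge is parametrised by an interval of heights. At its upper end either h stays
bounded and the edge converges to a critical point, or h tends to infinity and its direction
converges to one of the asymptotic directions (`exists_high`); passing to -u treats the lower end.
Far out in an asymptotic direction P is injective on a convex cone, so each leaf has exactly one
edge. At a critical point of multiplicity m, P - P(p) is the (m + 1)-st power of a local coordinate,
so 2 (m + 1) edges end there.

Two facts of plane topology remain, and continuous logarithms play the part of the Jordan curve
theorem. Disjoint connected sets do not have interlaced directions at infinity
(`not_interlaced_of_disjoint`): the argument of (ζ - z) / (ζ - w) is controlled along one set if z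
and w lie on the other. There are no cycles (`not_connected_off_edge`): by the maximum principle
every point z off the zero set is joined to infinity off the zero set, so ζ - z has a continuous
logarithm on bounded pieces of the zero set, whereas an argument would have to jump by 2π at a
regular point of a cycle. Together these facts make the forest a `ChordDiagram`.

The rest is combinatorics. Starting from leaf 2i - 1, the next leaf of the same tree
counterclockwise has an even number, by noncrossing and parity; this defines a permutation `perm` of
the letters. The paths from these leaves to their next leaves cover every edge exactly once
(`existsUnique_mem_edges`). The block of a node consists of the letters whose paths pass through it;
it has m + 1 elements, half the degree. Noncrossing forces the order in which a path visits its
nodes, so permutation and blocks determine the diagram (`ChordDiagram.exists_iso`).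

The blocks determine the trees, and then only the nesting of the trees is needed to recover the
permutation (`perm_eq`). It is recorded by `code`, a function f with f b ≤ b on the least letters b
of the k trees. There are k! such functions, as many as arrangements of these k letters. The word
starts from such an arrangement as the list of first letters of its outermost entries; each node is
inserted as a group whose entries have the letters of its block as first letters
(`exists_isBlockWord`). The count k + ∑ (|block| - 1) = n makes each letter occur once. Conversely,
the first letters in the groups give back the blocks and the outermost first letters give back the
code, so the encoding is injective. -/

section

/-! ### Edges of the zero set, parametrised by height -/

open Set Filter Topology

namespace HarmonicPoly

variable {n : ℕ}

/-- The conjugate harmonic polynomial, used as a height function along the zero set. -/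
noncomputable def ht (u : HarmonicPoly n) (z : ℂ) : ℝ := (u.P.eval z).im

/-- The noncritical part of the zero set. -/
def regularSet (u : HarmonicPoly n) : Set ℂ := {z | u.toFun z = 0 ∧ u.P.derivative.eval z ≠ 0}

lemma continuous_eval (u : HarmonicPoly n) : Continuous fun z => u.P.eval z := u.P.continuous

lemma continuous_ht (u : HarmonicPoly n) : Continuous u.ht :=
  Complex.continuous_im.comp u.continuous_eval

lemma continuous_toFun (u : HarmonicPoly n) : Continuous u.toFun :=
  Complex.continuous_re.comp u.continuous_eval

lemma isClosed_zeroSet (u : HarmonicPoly n) : IsClosed u.zeroSet :=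
  isClosed_eq u.continuous_toFun continuous_const

lemma eval_of_mem_zeroSet {u : HarmonicPoly n} {z : ℂ} (hz : u.toFun z = 0) :
    u.P.eval z = u.ht z * Complex.I := by
  apply Complex.ext
  · simpa [toFun] using hz
  · simp [ht]

lemma toFun_of_eval {u : HarmonicPoly n} {z : ℂ} {t : ℝ} (h : u.P.eval z = t * Complex.I) :
    u.toFun z = 0 := by simp [toFun, h]

lemma ht_of_eval {u : HarmonicPoly n} {z : ℂ} {t : ℝ} (h : u.P.eval z = t * Complex.I) :
    u.ht z = t := by simp [ht, h]

lemma fderiv_toFun_eq_zero_iff (u : HarmonicPoly n) (z : ℂ) :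
    fderiv ℝ u.toFun z = 0 ↔ u.P.derivative.eval z = 0 := by
  have h1 : HasFDerivAt (fun z => u.P.eval z)
      ((ContinuousLinearMap.toSpanSingleton ℂ (u.P.derivative.eval z)).restrictScalars ℝ) z :=
    (u.P.hasDerivAt z).hasFDerivAt.restrictScalars ℝ
  have h2 : HasFDerivAt u.toFun (Complex.reCLM.comp
      ((ContinuousLinearMap.toSpanSingleton ℂ (u.P.derivative.eval z)).restrictScalars ℝ)) z :=
    (Complex.reCLM.hasFDerivAt (x := u.P.eval z)).comp z h1
  rw [h2.fderiv]
  constructor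
  · intro h
    have e1 := congrArg (fun L => L 1) h
    have e2 := congrArg (fun L => L Complex.I) h
    simp at e1 e2
    exact Complex.ext e1 e2
  · intro h
    ext v; simp [h]

lemma mem_criticalSet_iff {u : HarmonicPoly n} {z : ℂ} :
    z ∈ u.criticalSet ↔ u.toFun z = 0 ∧ u.P.derivative.eval z = 0 := by
  rw [criticalSet, mem_ofPred_eq, fderiv_toFun_eq_zero_iff]; rfl

lemma zeroSet_diff_criticalSet (u : HarmonicPoly n) :
    u.zeroSet \ u.criticalSet = u.regularSet := by
  ext z
  simp only [Set.mem_sdiff, mem_criticalSet_iff, regularSet, zeroSet, mem_ofPred_eq]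
  tauto

lemma regularSet_subset (u : HarmonicPoly n) : u.regularSet ⊆ u.zeroSet := fun _ h => h.1

lemma mem_regularSet_or {u : HarmonicPoly n} {z : ℂ} (hz : z ∈ u.zeroSet) :
    z ∈ u.regularSet ∨ z ∈ u.criticalSet := by
  by_cases h : u.P.derivative.eval z = 0
  · exact Or.inr (mem_criticalSet_iff.2 ⟨hz, h⟩)
  · exact Or.inl ⟨hz, h⟩

lemma not_mem_criticalSet {u : HarmonicPoly n} {z : ℂ} (hz : z ∈ u.regularSet) :
    z ∉ u.criticalSet := fun h => hz.2 (mem_criticalSet_iff.1 h).2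

lemma derivative_ne_zero (hn : 1 ≤ n) (u : HarmonicPoly n) : u.P.derivative ≠ 0 := by
  intro h
  have := Polynomial.derivative_eq_zero.1 h
  rw [u.natDegree_eq] at this
  omega

lemma finite_criticalSet (hn : 1 ≤ n) (u : HarmonicPoly n) : u.criticalSet.Finite := by
  refine (Polynomial.finite_setOfPred_isRoot (u.derivative_ne_zero hn)).subset fun z hz => ?_
  exact (mem_criticalSet_iff.1 hz).2

lemma edge_eq (u : HarmonicPoly n) (z : ℂ) : u.edge z = connectedComponentIn u.regularSet z := by
  rw [edge, zeroSet_diff_criticalSet]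

/-- A lift of an interval of heights to the regular part of the zero set. -/
structure IsLift (u : HarmonicPoly n) (J : Set ℝ) (s : ℝ → ℂ) : Prop where
  continuousOn : ContinuousOn s J
  eval : ∀ t ∈ J, u.P.eval (s t) = t * Complex.I
  deriv : ∀ t ∈ J, u.P.derivative.eval (s t) ≠ 0

lemma IsLift.ht {u : HarmonicPoly n} {J : Set ℝ} {s : ℝ → ℂ} (h : u.IsLift J s) {t : ℝ}
    (ht : t ∈ J) : u.ht (s t) = t := ht_of_eval (h.eval t ht)

lemma IsLift.mem {u : HarmonicPoly n} {J : Set ℝ} {s : ℝ → ℂ} (h : u.IsLift J s) {t : ℝ}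
    (ht : t ∈ J) : s t ∈ u.regularSet := ⟨toFun_of_eval (h.eval t ht), h.deriv t ht⟩

lemma IsLift.mono {u : HarmonicPoly n} {J J' : Set ℝ} {s : ℝ → ℂ} (h : u.IsLift J s)
    (hJ : J' ⊆ J) : u.IsLift J' s :=
  ⟨h.1.mono hJ, fun t ht => h.2 t (hJ ht), fun t ht => h.3 t (hJ ht)⟩

/-- Inverse function theorem for P, with the inverse restricted to the imaginary axis. The last
clause says that near `z` the zero set is nothing but this arc; the derivative serves later to tell
apart the two directions along the edge. -/
lemma exists_local_lift {u : HarmonicPoly n} {z : ℂ} (hz : z ∈ u.regularSet) :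
    ∃ ε > 0, ∃ s : ℝ → ℂ, u.IsLift (Ioo (u.ht z - ε) (u.ht z + ε)) s ∧ s (u.ht z) = z ∧
      HasDerivAt s (Complex.I / u.P.derivative.eval z) (u.ht z) ∧
      ∀ᶠ w in 𝓝 z, w ∈ u.zeroSet → u.ht w ∈ Ioo (u.ht z - ε) (u.ht z + ε) ∧ s (u.ht w) = w := by
  have hs := u.P.hasStrictDerivAt z
  have hP' := hz.2
  set e := (hs.hasStrictFDerivAt_equiv hP').toOpenPartialHomeomorph (fun x => u.P.eval x) with he
  have hcoe : ∀ x, e x = u.P.eval x := fun x => rfl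
  have hze : z ∈ e.source := (hs.hasStrictFDerivAt_equiv hP').mem_toOpenPartialHomeomorph_source
  have hopen : IsOpen {w : ℂ | u.P.derivative.eval w ≠ 0} :=
    isOpen_ne_fun u.P.derivative.continuous continuous_const
  set e' := e.restrOpen _ hopen with he'
  have hze' : z ∈ e'.source := by
    rw [OpenPartialHomeomorph.restrOpen_source]; exact ⟨hze, hP'⟩
  have hcoe' : ∀ x, e' x = u.P.eval x := fun x => rfl
  have hPz : u.P.eval z = u.ht z * Complex.I := eval_of_mem_zeroSet hz.1
  have htgt : u.P.eval z ∈ e'.target := e'.map_source hze'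
  have hcont : Continuous fun t : ℝ => (t : ℂ) * Complex.I := by fun_prop
  have hnhds : {t : ℝ | (t : ℂ) * Complex.I ∈ e'.target} ∈ 𝓝 (u.ht z) := by
    apply hcont.continuousAt.preimage_mem_nhds
    rw [← hPz]
    exact e'.open_target.mem_nhds htgt
  obtain ⟨ε, hε, hball⟩ := Metric.mem_nhds_iff.1 hnhds
  rw [Real.ball_eq_Ioo] at hball
  refine ⟨ε, hε, fun t => e'.symm ((t : ℂ) * Complex.I), ⟨?_, ?_, ?_⟩, ?_, ?_, ?_⟩
  · exact e'.continuousOn_symm.comp hcont.continuousOn fun t ht => hball ht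
  · intro t ht
    rw [← hcoe']
    exact e'.right_inv (hball ht)
  · intro t ht
    have := e'.map_target (hball ht)
    rw [OpenPartialHomeomorph.restrOpen_source] at this
    exact this.2
  · show e'.symm ((u.ht z : ℂ) * Complex.I) = z
    rw [← hPz, ← hcoe']
    exact e'.left_inv hze'
  · have h1 : HasDerivAt e'.symm (u.P.derivative.eval z)⁻¹ ((u.ht z : ℂ) * Complex.I) := by
      rw [← hPz]
      apply e'.hasDerivAt_symm htgt hP'
      rw [← hcoe', e'.left_inv hze']
      exact u.P.hasDerivAt z
    have h2 : HasDerivAt (fun t : ℝ => (t : ℂ) * Complex.I) Complex.I (u.ht z) := by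
      simpa using (Complex.ofRealCLM.hasDerivAt (x := u.ht z)).mul_const Complex.I
    have := h1.comp (u.ht z) h2
    rw [div_eq_inv_mul]
    exact this
  · have h1 : ∀ᶠ w in 𝓝 z, w ∈ e'.source := e'.open_source.mem_nhds hze'
    have h2 : ∀ᶠ w in 𝓝 z, u.ht w ∈ Ioo (u.ht z - ε) (u.ht z + ε) :=
      u.continuous_ht.continuousAt.preimage_mem_nhds
        (Ioo_mem_nhds (by linarith) (by linarith))
    filter_upwards [h1, h2] with w hw1 hw2 hwZ
    refine ⟨hw2, ?_⟩
    rw [← eval_of_mem_zeroSet hwZ, ← hcoe']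
    exact e'.left_inv hw1

/-- Coincidence is an open condition because a local lift is determined by the height,
non-coincidence is open by continuity, and `J` is connected. -/
lemma IsLift.eqOn {u : HarmonicPoly n} {J : Set ℝ} {s₁ s₂ : ℝ → ℂ} (h₁ : u.IsLift J s₁)
    (h₂ : u.IsLift J s₂) (hJ : IsPreconnected J) {t₀ : ℝ} (ht₀ : t₀ ∈ J) (h : s₁ t₀ = s₂ t₀) :
    EqOn s₁ s₂ J := by
  have key : ∀ x ∈ J, ∀ᶠ y in 𝓝[J] x, (s₁ x = s₂ x ↔ s₁ y = s₂ y) := by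
    intro x hx
    by_cases hxx : s₁ x = s₂ x
    · obtain ⟨ε, hε, s, hs, -, -, hU⟩ := exists_local_lift (h₁.mem hx)
      have e1 := (h₁.continuousOn x hx).eventually hU
      have e2 := (h₂.continuousOn x hx).eventually (hxx ▸ hU)
      filter_upwards [e1, e2, self_mem_nhdsWithin] with y hy1 hy2 hyJ
      have a1 := (hy1 (h₁.mem hyJ).1).2
      have a2 := (hy2 (h₂.mem hyJ).1).2
      rw [h₁.ht hyJ] at a1
      rw [h₂.ht hyJ] at a2
      simp [hxx, ← a1, ← a2]
    · have := ((h₁.continuousOn x hx).tendsto.prodMk_nhds (h₂.continuousOn x hx).tendsto).eventually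
        (isOpen_ne_fun continuous_fst continuous_snd |>.mem_nhds hxx)
      filter_upwards [this] with y hy
      simp only [hxx, false_iff]
      exact hy
  intro t ht
  have := hJ.induction₂ (fun x y => s₁ x = s₂ x ↔ s₁ y = s₂ y) key
    (fun x y z _ _ _ h1 h2 => h1.trans h2) (fun x y _ _ h => h.symm) ht₀ ht
  exact this.1 h

lemma IsLift.glue {u : HarmonicPoly n} {J₁ J₂ : Set ℝ} {s₁ s₂ : ℝ → ℂ} (h₁ : u.IsLift J₁ s₁)
    (h₂ : u.IsLift J₂ s₂) (hJ₁ : IsPreconnected J₁) (hJ₂ : IsPreconnected J₂) (o₁ : IsOpen J₁)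
    (o₂ : IsOpen J₂) {t₀ : ℝ} (ht₁ : t₀ ∈ J₁) (ht₂ : t₀ ∈ J₂) (h : s₁ t₀ = s₂ t₀) :
    ∃ s, u.IsLift (J₁ ∪ J₂) s ∧ EqOn s s₁ J₁ ∧ EqOn s s₂ J₂ := by
  classical
  have hpre : IsPreconnected (J₁ ∩ J₂) := by
    rw [isPreconnected_iff_ordConnected] at *
    exact hJ₁.inter hJ₂
  have heq : EqOn s₁ s₂ (J₁ ∩ J₂) :=
    (h₁.mono inter_subset_left).eqOn (h₂.mono inter_subset_right) hpre ⟨ht₁, ht₂⟩ h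
  have E1 : EqOn (J₁.piecewise s₁ s₂) s₁ J₁ := fun t ht => piecewise_eq_of_mem _ _ _ ht
  have E2 : EqOn (J₁.piecewise s₁ s₂) s₂ J₂ := by
    intro t ht
    by_cases h1 : t ∈ J₁
    · rw [E1 h1]; exact heq ⟨h1, ht⟩
    · exact piecewise_eq_of_notMem _ _ _ h1
  refine ⟨J₁.piecewise s₁ s₂, ⟨?_, ?_, ?_⟩, E1, E2⟩
  · exact (h₁.continuousOn.congr E1).union_of_isOpen (h₂.continuousOn.congr E2) o₁ o₂
  · rintro t (ht | ht)
    · rw [E1 ht]; exact h₁.eval t ht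
    · rw [E2 ht]; exact h₂.eval t ht
  · rintro t (ht | ht)
    · rw [E1 ht]; exact h₁.deriv t ht
    · rw [E2 ht]; exact h₂.deriv t ht

/-- Two points of the zero set lie on a common lift of an open interval. -/
def OnLift (u : HarmonicPoly n) (z w : ℂ) : Prop :=
  ∃ J s, u.IsLift J s ∧ IsPreconnected J ∧ IsOpen J ∧ u.ht z ∈ J ∧ u.ht w ∈ J ∧
    s (u.ht z) = z ∧ s (u.ht w) = w

lemma OnLift.symm {u : HarmonicPoly n} {z w : ℂ} (h : u.OnLift z w) : u.OnLift w z := by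
  obtain ⟨J, s, h1, h2, h3, h4, h5, h6, h7⟩ := h
  exact ⟨J, s, h1, h2, h3, h5, h4, h7, h6⟩

lemma OnLift.trans {u : HarmonicPoly n} {z w v : ℂ} (h : u.OnLift z w) (h' : u.OnLift w v) :
    u.OnLift z v := by
  obtain ⟨J, s, h1, h2, h3, h4, h5, h6, h7⟩ := h
  obtain ⟨J', s', h1', h2', h3', h4', h5', h6', h7'⟩ := h'
  obtain ⟨r, hr, e1, e2⟩ := h1.glue h1' h2 h2' h3 h3' h5 h4' (h7.trans h6'.symm)
  exact ⟨J ∪ J', r, hr, h2.union _ h5 h4' h2', h3.union h3', Or.inl h4, Or.inr h5',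
    (e1 h4).trans h6, (e2 h5').trans h7'⟩

lemma eventually_onLift {u : HarmonicPoly n} {z : ℂ} (hz : z ∈ u.regularSet) :
    ∀ᶠ w in 𝓝 z, w ∈ u.zeroSet → u.OnLift z w := by
  obtain ⟨ε, hε, s, hs, hsz, -, hU⟩ := exists_local_lift hz
  filter_upwards [hU] with w hw hwZ
  exact ⟨_, s, hs, isPreconnected_Ioo, isOpen_Ioo, ⟨by linarith, by linarith⟩, (hw hwZ).1, hsz,
    (hw hwZ).2⟩

lemma OnLift.mem_edge {u : HarmonicPoly n} {z w : ℂ} (h : u.OnLift z w) : w ∈ u.edge z := by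
  obtain ⟨J, s, h1, h2, h3, h4, h5, h6, h7⟩ := h
  rw [edge_eq]
  have := (h2.image s h1.continuousOn).subset_connectedComponentIn (F := u.regularSet) (x := z)
    ⟨_, h4, h6⟩ (by rintro _ ⟨t, ht, rfl⟩; exact h1.mem ht)
  exact this ⟨_, h5, h7⟩

lemma edge_subset (u : HarmonicPoly n) (z : ℂ) : u.edge z ⊆ u.regularSet := by
  rw [edge_eq]; exact connectedComponentIn_subset _ _

lemma mem_edge_self {u : HarmonicPoly n} {z : ℂ} (hz : z ∈ u.regularSet) : z ∈ u.edge z := by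
  rw [edge_eq]; exact mem_connectedComponentIn hz

lemma isPreconnected_edge (u : HarmonicPoly n) (z : ℂ) : IsPreconnected (u.edge z) :=
  isPreconnected_connectedComponentIn

lemma edge_eq_of_mem {u : HarmonicPoly n} {z w : ℂ} (h : w ∈ u.edge z) : u.edge w = u.edge z := by
  rw [edge_eq] at h ⊢; rw [edge_eq]; exact (connectedComponentIn_eq h).symm

/-- `OnLift` is symmetric and transitive and holds between nearby points, so it holds throughout a
connected edge. In particular an edge cannot close up: the height is injective on it. -/
lemma onLift_of_mem_edge {u : HarmonicPoly n} {z w v : ℂ} (hw : w ∈ u.edge z)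
    (hv : v ∈ u.edge z) : u.OnLift w v := by
  refine (u.isPreconnected_edge z).induction₂ u.OnLift ?_
    (fun _ _ _ _ _ _ h1 h2 => h1.trans h2) (fun _ _ _ _ h => h.symm) hw hv
  intro x hx
  filter_upwards [mem_nhdsWithin_of_mem_nhds (eventually_onLift (u.edge_subset z hx)),
    self_mem_nhdsWithin] with y hy hyE
  exact hy (u.edge_subset z hyE).1

lemma injOn_ht_edge (u : HarmonicPoly n) (z : ℂ) : InjOn u.ht (u.edge z) := by
  intro w hw v hv h
  obtain ⟨J, s, -, -, -, -, -, h6, h7⟩ := onLift_of_mem_edge hw hv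
  rw [← h6, ← h7, h]

/-- An edge is the image of a lift of an open interval. -/
lemma exists_edge_param (u : HarmonicPoly n) (z : ℂ) :
    ∃ I γ, u.IsLift I γ ∧ IsOpen I ∧ IsPreconnected I ∧ γ '' I = u.edge z ∧
      (∀ w ∈ u.edge z, u.ht w ∈ I ∧ γ (u.ht w) = w) := by
  classical
  -- The inverse of the height on the edge agrees near each height with a local lift; hence it is
  -- continuous and its domain is open.
  set γ := Function.invFunOn u.ht (u.edge z)
  have hγ : ∀ w ∈ u.edge z, γ (u.ht w) = w := fun w hw =>
    (u.injOn_ht_edge z).leftInvOn_invFunOn hw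
  have hloc : ∀ w ∈ u.edge z, ∀ᶠ t in 𝓝 (u.ht w), t ∈ u.ht '' u.edge z ∧
      γ t ∈ u.edge z ∧ u.ht (γ t) = t ∧ ContinuousAt γ (u.ht w) := by
    intro w hw
    obtain ⟨ε, hε, s, hs, hsw, -, -⟩ := exists_local_lift (u.edge_subset z hw)
    have hmem : ∀ t ∈ Ioo (u.ht w - ε) (u.ht w + ε), s t ∈ u.edge z := by
      intro t ht
      rw [← edge_eq_of_mem hw]
      apply OnLift.mem_edge
      refine ⟨_, s, hs, isPreconnected_Ioo, isOpen_Ioo, ⟨by linarith, by linarith⟩, ?_, hsw, ?_⟩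
      · rw [hs.ht ht]; exact ht
      · rw [hs.ht ht]
    have hN : Ioo (u.ht w - ε) (u.ht w + ε) ∈ 𝓝 (u.ht w) :=
      Ioo_mem_nhds (by linarith) (by linarith)
    have hEq : ∀ t ∈ Ioo (u.ht w - ε) (u.ht w + ε), γ t = s t := by
      intro t ht
      have := hγ _ (hmem t ht)
      rwa [hs.ht ht] at this
    have hc : ContinuousAt γ (u.ht w) :=
      (hs.continuousOn.continuousAt hN).congr (by filter_upwards [hN] with t ht using (hEq t ht).symm)
    filter_upwards [hN] with t ht
    refine ⟨⟨s t, hmem t ht, hs.ht ht⟩, ?_, ?_, hc⟩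
    · rw [hEq t ht]; exact hmem t ht
    · rw [hEq t ht]; exact hs.ht ht
  refine ⟨u.ht '' u.edge z, γ, ⟨?_, ?_, ?_⟩, ?_, ?_, ?_, ?_⟩
  · rintro _ ⟨w, hw, rfl⟩
    exact (hloc w hw).self_of_nhds.2.2.2.continuousWithinAt
  · rintro _ ⟨w, hw, rfl⟩
    rw [hγ w hw]; exact eval_of_mem_zeroSet (u.edge_subset z hw).1
  · rintro _ ⟨w, hw, rfl⟩
    rw [hγ w hw]; exact (u.edge_subset z hw).2
  · rw [isOpen_iff_mem_nhds]
    rintro _ ⟨w, hw, rfl⟩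
    filter_upwards [hloc w hw] with t ht using ht.1
  · exact (u.isPreconnected_edge z).image _ u.continuous_ht.continuousOn
  · ext w
    constructor
    · rintro ⟨_, ⟨v, hv, rfl⟩, rfl⟩
      rw [hγ v hv]; exact hv
    · intro hw
      exact ⟨_, ⟨w, hw, rfl⟩, hγ w hw⟩
  · exact fun w hw => ⟨⟨w, hw, rfl⟩, hγ w hw⟩

end HarmonicPoly

end

/-! ### The upper end of an edge: a critical point or a direction at infinity -/

section

open Set Filter Topology

lemma Set.Finite.exists_pos_le_dist {X : Type*} [MetricSpace X] {S : Set X} (hS : S.Finite) :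
    ∃ δ > 0, ∀ a ∈ S, ∀ b ∈ S, a ≠ b → δ ≤ dist a b := by
  have h : ∀ᶠ δ in 𝓝[>] (0 : ℝ), ∀ p ∈ S ×ˢ S, p.1 ≠ p.2 → δ ≤ dist p.1 p.2 := by
    rw [eventually_all_finite (hS.prod hS)]
    intro p _
    by_cases hp : p.1 = p.2
    · simp [hp]
    · filter_upwards [Ioo_mem_nhdsGT (dist_pos.2 hp)] with δ hδ _ using hδ.2.le
  obtain ⟨δ, h1, h2⟩ := (h.and self_mem_nhdsWithin).exists
  exact ⟨δ, h2, fun a ha b hb hab => h1 (a, b) ⟨ha, hb⟩ hab⟩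

/-- Balls of half the minimal distance around the points of `S` are disjoint, so the image of a
connected tail that stays in their union stays in a single one. -/
lemma Filter.HasBasis.tendsto_of_eventually_near_finite {X ι : Type*} [TopologicalSpace X]
    {Y : Type*} [MetricSpace Y] {F : Filter X} [F.NeBot] {p : ι → Prop} {s : ι → Set X}
    (hb : F.HasBasis p s) (hpre : ∀ i, p i → IsPreconnected (s i)) {f : X → Y} {A : Set X}
    (hA : A ∈ F) (hf : ContinuousOn f A) {S : Set Y} (hS : S.Finite)
    (h : ∀ ε > 0, ∀ᶠ x in F, ∃ c ∈ S, dist (f x) c < ε) : ∃ c ∈ S, Tendsto f F (𝓝 c) := by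
  obtain ⟨δ, hδ, hsep⟩ := hS.exists_pos_le_dist
  obtain ⟨i, hi, hBi⟩ := hb.mem_iff.1 (inter_mem hA (h (δ / 2) (by positivity)))
  obtain ⟨x₀, hx₀⟩ := F.nonempty_of_mem (hb.mem_of_mem hi)
  obtain ⟨c₀, hc₀, hd₀⟩ := (hBi hx₀).2
  have himg : f '' s i ⊆ Metric.ball c₀ (δ / 2) := by
    refine IsPreconnected.subset_left_of_subset_union (v := ⋃ c ∈ S \ {c₀}, Metric.ball c (δ / 2))
      Metric.isOpen_ball
      (isOpen_biUnion fun _ _ => Metric.isOpen_ball) ?_ ?_ ⟨f x₀, ⟨x₀, hx₀, rfl⟩, hd₀⟩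
      ((hpre i hi).image f (hf.mono fun x hx => (hBi hx).1))
    · rw [disjoint_iUnion₂_right]
      intro c hc
      apply Metric.ball_disjoint_ball
      have := hsep c₀ hc₀ c hc.1 (fun h => hc.2 h.symm)
      linarith
    · rintro _ ⟨x, hx, rfl⟩
      obtain ⟨c, hc, hd⟩ := (hBi hx).2
      by_cases hcc : c = c₀
      · left; rw [← hcc]; exact hd
      · right; exact mem_biUnion (show c ∈ S \ {c₀} from ⟨hc, hcc⟩) hd
  refine ⟨c₀, hc₀, Metric.tendsto_nhds.2 fun ε hε => ?_⟩
  filter_upwards [h (min ε (δ / 2)) (by positivity), hb.mem_of_mem hi] with x hx hxi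
  obtain ⟨c, hc, hd⟩ := hx
  have h1 : dist (f x) c₀ < δ / 2 := himg ⟨x, hxi, rfl⟩
  by_cases hcc : c = c₀
  · rw [← hcc]; exact hd.trans_le (min_le_left _ _)
  · have := hsep c hc c₀ hc₀ hcc
    have h2 := dist_triangle_left c c₀ (f x)
    have h3 := hd.trans_le (min_le_right _ _)
    linarith

namespace HarmonicPoly

variable {n : ℕ}

/-- The filter of the upper end of a set. -/
def highFilter (u : HarmonicPoly n) (E : Set ℂ) : Filter ℂ :=
  ⨅ w ∈ E, 𝓟 {v | v ∈ E ∧ u.ht w ≤ u.ht v}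

lemma hasBasis_highFilter (u : HarmonicPoly n) {z : ℂ} (hz : z ∈ u.regularSet) :
    (u.highFilter (u.edge z)).HasBasis (fun w => w ∈ u.edge z)
      (fun w => {v | v ∈ u.edge z ∧ u.ht w ≤ u.ht v}) := by
  apply hasBasis_biInf_principal
  · intro w hw v hv
    rcases le_total (u.ht w) (u.ht v) with h | h
    · exact ⟨v, hv, fun x hx => ⟨hx.1, h.trans hx.2⟩, fun x hx => hx⟩
    · exact ⟨w, hw, fun x hx => hx, fun x hx => ⟨hx.1, h.trans hx.2⟩⟩
  · exact ⟨z, mem_edge_self hz⟩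

lemma neBot_highFilter (u : HarmonicPoly n) {z : ℂ} (hz : z ∈ u.regularSet) :
    (u.highFilter (u.edge z)).NeBot :=
  (u.hasBasis_highFilter hz).neBot_iff.2 fun {w} hw => ⟨w, hw, le_rfl⟩

lemma edge_mem_highFilter (u : HarmonicPoly n) {z : ℂ} (hz : z ∈ u.regularSet) :
    u.edge z ∈ u.highFilter (u.edge z) :=
  mem_of_superset ((u.hasBasis_highFilter hz).mem_of_mem (mem_edge_self hz)) fun _ h => h.1

lemma eventually_highFilter_le (u : HarmonicPoly n) {z w : ℂ} (hz : z ∈ u.regularSet)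
    (hw : w ∈ u.edge z) : ∀ᶠ v in u.highFilter (u.edge z), v ∈ u.edge z ∧ u.ht w ≤ u.ht v :=
  (u.hasBasis_highFilter hz).mem_of_mem hw

lemma isPreconnected_tail (u : HarmonicPoly n) (z w : ℂ) :
    IsPreconnected {v | v ∈ u.edge z ∧ u.ht w ≤ u.ht v} := by
  obtain ⟨I, γ, hl, ho, hp, him, hinv⟩ := u.exists_edge_param z
  have : {v | v ∈ u.edge z ∧ u.ht w ≤ u.ht v} = γ '' (I ∩ Ici (u.ht w)) := by
    ext v
    constructor
    · rintro ⟨h1, h2⟩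
      exact ⟨u.ht v, ⟨(hinv v h1).1, h2⟩, (hinv v h1).2⟩
    · rintro ⟨t, ⟨h1, h2⟩, rfl⟩
      exact ⟨him ▸ ⟨t, h1, rfl⟩, by rw [hl.ht h1]; exact h2⟩
  rw [this]
  refine IsPreconnected.image ?_ _ (hl.continuousOn.mono inter_subset_left)
  rw [isPreconnected_iff_ordConnected] at *
  exact hp.inter ordConnected_Ici

lemma exists_ht_gt (u : HarmonicPoly n) {z w : ℂ} (hw : w ∈ u.edge z) :
    ∃ v ∈ u.edge z, u.ht w < u.ht v := by
  obtain ⟨I, γ, hl, ho, hp, him, hinv⟩ := u.exists_edge_param z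
  have h1 : I ∈ 𝓝[>] (u.ht w) := mem_nhdsWithin_of_mem_nhds (ho.mem_nhds (hinv w hw).1)
  obtain ⟨t, ht, h⟩ := Filter.nonempty_of_mem (inter_mem h1 self_mem_nhdsWithin)
  exact ⟨γ t, him ▸ ⟨t, ht, rfl⟩, by rw [hl.ht ht]; exact h⟩

lemma isCompact_edge_between (u : HarmonicPoly n) {z w v : ℂ} (hw : w ∈ u.edge z)
    (hv : v ∈ u.edge z) : IsCompact {x | x ∈ u.edge z ∧ u.ht w ≤ u.ht x ∧ u.ht x ≤ u.ht v} := by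
  obtain ⟨I, γ, hl, ho, hp, him, hinv⟩ := u.exists_edge_param z
  have hsub : Icc (u.ht w) (u.ht v) ⊆ I :=
    (isPreconnected_iff_ordConnected.1 hp).out (hinv w hw).1 (hinv v hv).1
  have : {x | x ∈ u.edge z ∧ u.ht w ≤ u.ht x ∧ u.ht x ≤ u.ht v} =
      γ '' Icc (u.ht w) (u.ht v) := by
    ext x
    constructor
    · rintro ⟨h1, h2⟩
      exact ⟨u.ht x, h2, (hinv x h1).2⟩
    · rintro ⟨t, h, rfl⟩
      refine ⟨him ▸ ⟨t, hsub h, rfl⟩, ?_⟩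
      rw [hl.ht (hsub h)]; exact h
  rw [this]
  exact isCompact_Icc.image_of_continuousOn (hl.continuousOn.mono hsub)

/-- By its local lift, a regular cluster point would lie on the edge itself. The edge continues to
greater heights from there, so its upper tails are bounded away in height from that point. -/
lemma not_clusterPt_highFilter (u : HarmonicPoly n) {z x : ℂ} (hz : z ∈ u.regularSet)
    (hx : x ∈ u.regularSet) : ¬ ClusterPt x (u.highFilter (u.edge z)) := by
  intro h
  have h1 : ∃ w, w ∈ u.edge z ∧ u.OnLift x w := by
    have := (ClusterPt.frequently h (eventually_onLift hx)).and_eventually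
      (u.edge_mem_highFilter hz)
    obtain ⟨w, hw1, hw2⟩ := this.exists
    exact ⟨w, hw2, hw1 (u.edge_subset z hw2).1⟩
  obtain ⟨w, hwE, hw⟩ := h1
  have hxE : x ∈ u.edge z := by
    rw [← edge_eq_of_mem hwE]; exact hw.symm.mem_edge
  obtain ⟨v, hvE, hv⟩ := u.exists_ht_gt hxE
  have h2 : ∀ᶠ y in 𝓝 x, u.ht y < u.ht v := u.continuous_ht.continuousAt.eventually_lt
    continuousAt_const hv
  obtain ⟨y, hy1, hy2⟩ := ((ClusterPt.frequently h h2).and_eventually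
    (u.eventually_highFilter_le hz hvE)).exists
  linarith [hy2.2]

lemma clusterPt_highFilter (u : HarmonicPoly n) {z x : ℂ} (hz : z ∈ u.regularSet)
    (hx : ClusterPt x (u.highFilter (u.edge z))) : x ∈ u.criticalSet := by
  have hxZ : x ∈ u.zeroSet := by
    rw [← u.isClosed_zeroSet.closure_eq, mem_closure_iff_clusterPt]
    exact hx.mono (le_principal_iff.2 (mem_of_superset (u.edge_mem_highFilter hz)
      ((u.edge_subset z).trans u.regularSet_subset)))
  exact (mem_regularSet_or hxZ).resolve_left fun h => u.not_clusterPt_highFilter hz h hx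

/-! ### Behaviour at infinity -/

lemma leadingCoeff_ne_zero (hn : 1 ≤ n) (u : HarmonicPoly n) : u.P.leadingCoeff ≠ 0 := by
  rw [Polynomial.leadingCoeff_ne_zero]
  rintro h
  have := u.natDegree_eq
  simp [h] at this
  omega

lemma eval_eq_pow_mul (u : HarmonicPoly n) {z : ℂ} (hz : z ≠ 0) :
    u.P.eval z = z ^ n * u.P.reverse.eval z⁻¹ := by
  have := @Polynomial.eval₂_reverse_mul_pow _ _ _ _ (RingHom.id ℂ) z (invertibleOfNonzero hz) u.P
  rw [u.natDegree_eq, invOf_eq_inv, Polynomial.eval₂_id, Polynomial.eval₂_id] at this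
  rw [← this, mul_comm]

lemma tendsto_reverse (u : HarmonicPoly n) :
    Tendsto (fun z => u.P.reverse.eval z⁻¹) (Bornology.cobounded ℂ) (𝓝 u.P.leadingCoeff) := by
  have h1 : Tendsto (fun z => u.P.reverse.eval z) (𝓝 0) (𝓝 u.P.leadingCoeff) := by
    have := u.P.reverse.continuous.tendsto (0 : ℂ)
    rwa [← Polynomial.coeff_zero_eq_eval_zero, Polynomial.coeff_zero_reverse] at this
  exact h1.comp tendsto_inv₀_cobounded

lemma tendsto_norm_eval (hn : 1 ≤ n) (u : HarmonicPoly n) :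
    Tendsto (fun z => ‖u.P.eval z‖) (Bornology.cobounded ℂ) atTop := by
  apply Polynomial.tendsto_norm_atTop
  · rw [← Polynomial.natDegree_pos_iff_degree_pos, u.natDegree_eq]; omega
  · exact tendsto_norm_cobounded_atTop

lemma norm_leafDir (u : HarmonicPoly n) (k : Fin (2 * n)) : ‖u.leafDir k‖ = 1 := by
  have : ((k : ℕ) * Real.pi / n * Complex.I : ℂ) = ((k * Real.pi / n : ℝ) : ℂ) * Complex.I := by
    push_cast; ring
  rw [leafDir, norm_mul, u.norm_dir, this, Complex.norm_exp_ofReal_mul_I, one_mul]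

lemma leafDir_eq_pow (hn : 1 ≤ n) (u : HarmonicPoly n) (k : Fin (2 * n)) :
    u.leafDir k = u.dir * Complex.exp (2 * Real.pi * Complex.I / ((2 * n : ℕ) : ℂ)) ^ (k : ℕ) := by
  have : (n : ℂ) ≠ 0 := by exact_mod_cast (by omega : n ≠ 0)
  rw [leafDir, ← Complex.exp_nat_mul]
  congr 2
  push_cast
  field_simp

lemma dir_ne_zero (u : HarmonicPoly n) : u.dir ≠ 0 := by
  rw [← norm_ne_zero_iff, u.norm_dir]; exact one_ne_zero

lemma leafDir_injective (hn : 1 ≤ n) (u : HarmonicPoly n) : Function.Injective u.leafDir := by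
  intro k l h
  rw [u.leafDir_eq_pow hn, u.leafDir_eq_pow hn] at h
  have h2 := mul_left_cancel₀ u.dir_ne_zero h
  exact Fin.ext ((Complex.isPrimitiveRoot_exp (2 * n) (by omega)).pow_inj k.2 l.2 h2)

/-- With `a` the leading coefficient, a c^n and a dir^n are purely imaginary of the same norm |a|.
So their squares agree and c / dir is a 2n-th root of unity. -/
lemma exists_leafDir_eq (hn : 1 ≤ n) (u : HarmonicPoly n) {c : ℂ} (hc : ‖c‖ = 1)
    (h : (u.P.leadingCoeff * c ^ n).re = 0) : ∃ k, c = u.leafDir k := by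
  set a := u.P.leadingCoeff
  have ha : a ≠ 0 := u.leadingCoeff_ne_zero hn
  have key : ∀ x : ℂ, x.re = 0 → x ^ 2 = -((‖x‖ : ℂ) ^ 2) := by
    intro x hx
    have hx' : x = x.im * Complex.I := by apply Complex.ext <;> simp [hx]
    rw [hx']
    simp [mul_pow]
    norm_cast
    exact (sq_abs _).symm
  have h1 := key _ h
  have h2 := key _ u.re_dir
  rw [norm_mul, norm_pow, hc] at h1
  rw [norm_mul, norm_pow, u.norm_dir, ← h1, mul_pow, mul_pow, ← pow_mul, ← pow_mul] at h2
  have h3 := mul_left_cancel₀ (pow_ne_zero 2 ha) h2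
  have hd := u.dir_ne_zero
  have h4 : (c / u.dir) ^ (2 * n) = 1 := by
    rw [div_pow, mul_comm 2 n, h3, div_self]
    exact pow_ne_zero _ (by rw [← norm_ne_zero_iff, hc]; exact one_ne_zero)
  have : NeZero (2 * n) := ⟨by omega⟩
  obtain ⟨i, hi, he⟩ := (Complex.isPrimitiveRoot_exp (2 * n) (by omega)).eq_pow_of_pow_eq_one h4
  refine ⟨⟨i, hi⟩, ?_⟩
  rw [u.leafDir_eq_pow hn]
  simp only
  rw [he]
  field_simp

lemma norm_div_norm {z : ℂ} (hz : z ≠ 0) : ‖z / (‖z‖ : ℂ)‖ = 1 := by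
  rw [norm_div, Complex.norm_real, norm_norm, div_self (norm_ne_zero_iff.2 hz)]

lemma eventually_cobounded_ne_zero : ∀ᶠ z in Bornology.cobounded ℂ, z ≠ 0 := by
  have := tendsto_norm_cobounded_atTop (E := ℂ) |>.eventually_gt_atTop 0
  filter_upwards [this] with z hz using norm_pos_iff.1 hz

/-- Along a filter at infinity, `P z / |z| ^ n` converges if the direction of `z` does. -/
lemma tendsto_eval_div_norm_pow (u : HarmonicPoly n) {F : Filter ℂ}
    (hF : F ≤ Bornology.cobounded ℂ) {c : ℂ} (hc : Tendsto (fun z => z / (‖z‖ : ℂ)) F (𝓝 c)) :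
    Tendsto (fun z => u.P.eval z / (‖z‖ : ℂ) ^ n) F (𝓝 (u.P.leadingCoeff * c ^ n)) := by
  have h := (u.tendsto_reverse.mono_left hF).mul (hc.pow n)
  refine h.congr' ?_
  filter_upwards [hF eventually_cobounded_ne_zero] with z hz
  rw [u.eval_eq_pow_mul hz, div_pow]
  ring

/-- Otherwise some ultrafilter of zeros goes to infinity with directions away from all leaf
directions. By compactness of the circle the directions converge to some `c`, and dividing Re P = 0
by |z|^n gives Re (a c^n) = 0 in the limit. -/
lemma eventually_near_leafDir (hn : 1 ≤ n) (u : HarmonicPoly n) {δ : ℝ} (hδ : 0 < δ) :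
    ∀ᶠ z in Bornology.cobounded ℂ ⊓ 𝓟 u.zeroSet, ∃ k, dist (z / (‖z‖ : ℂ)) (u.leafDir k) < δ := by
  by_contra hcon
  rw [not_eventually] at hcon
  set F := (Bornology.cobounded ℂ ⊓ 𝓟 u.zeroSet) ⊓
    𝓟 {z | ¬ ∃ k, dist (z / (‖z‖ : ℂ)) (u.leafDir k) < δ} with hF
  have hne : F.NeBot := frequently_mem_iff_neBot.1 hcon
  set U := Ultrafilter.of F
  have hU : (U : Filter ℂ) ≤ F := Ultrafilter.of_le F
  have hcob : (U : Filter ℂ) ≤ Bornology.cobounded ℂ :=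
    hU.trans (inf_le_left.trans inf_le_left)
  have hZ : ∀ᶠ z in (U : Filter ℂ), z ∈ u.zeroSet :=
    le_principal_iff.1 (hU.trans (inf_le_left.trans inf_le_right))
  have hbad : ∀ᶠ z in (U : Filter ℂ), ¬ ∃ k, dist (z / (‖z‖ : ℂ)) (u.leafDir k) < δ :=
    le_principal_iff.1 (hU.trans inf_le_right)
  have hsph : ((U.map fun z => z / (‖z‖ : ℂ) : Ultrafilter ℂ) : Filter ℂ) ≤
      𝓟 (Metric.sphere 0 1) := by
    rw [le_principal_iff]
    show ∀ᶠ z in (U : Filter ℂ), z / (‖z‖ : ℂ) ∈ Metric.sphere 0 1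
    filter_upwards [hcob eventually_cobounded_ne_zero] with z hz
    simpa using norm_div_norm hz
  obtain ⟨c, hc, hlim⟩ := (isCompact_sphere (0 : ℂ) 1).ultrafilter_le_nhds _ hsph
  have hlim' : Tendsto (fun z => z / (‖z‖ : ℂ)) U (𝓝 c) := hlim
  have h1 := (Complex.continuous_re.tendsto _).comp (u.tendsto_eval_div_norm_pow hcob hlim')
  have h2 : (u.P.leadingCoeff * c ^ n).re = 0 := by
    refine tendsto_nhds_unique h1 (tendsto_const_nhds.congr' ?_)
    filter_upwards [hZ] with z hz
    have hz' : (u.P.eval z).re = 0 := hz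
    simp only [Function.comp]
    rw [← Complex.ofReal_pow, Complex.div_ofReal_re, hz', zero_div]
  obtain ⟨k, hk⟩ := u.exists_leafDir_eq hn (by simpa using hc) h2
  obtain ⟨z, hz1, hz2⟩ := (hbad.and (Metric.tendsto_nhds.1 hlim' δ hδ)).exists
  exact hz1 ⟨k, hk ▸ hz2⟩

/-! ### The upper end of an edge -/

def HighLeaf (u : HarmonicPoly n) (E : Set ℂ) (k : Fin (2 * n)) : Prop :=
  Tendsto u.ht (u.highFilter E) atTop ∧
    Tendsto (fun z => z / (‖z‖ : ℂ)) (u.highFilter E) (𝓝 (u.leafDir k))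

def HighNode (u : HarmonicPoly n) (E : Set ℂ) (p : ℂ) : Prop := u.highFilter E ≤ 𝓝 p

lemma le_cobounded_of_tendsto_ht (u : HarmonicPoly n) {F : Filter ℂ} (h : Tendsto u.ht F atTop) :
    F ≤ Bornology.cobounded ℂ := by
  rw [Metric.hasBasis_cobounded_compl_closedBall (0 : ℂ) |>.ge_iff]
  intro r _
  obtain ⟨M, hM⟩ := ((isCompact_closedBall (0 : ℂ) r).image u.continuous_ht).bddAbove
  filter_upwards [h.eventually_gt_atTop M] with z hz hzr
  exact absurd (hM ⟨z, hzr, rfl⟩) (not_le.2 hz)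

/-- If the height is bounded above on the edge, then |P| = |h| is bounded on an upper tail, which
therefore lies in a compact set and clusters only at the finitely many critical points. If not, the
height tends to infinity and the directions approach the finite set of leaf directions. Either way
connectedness of the tails singles out one limit. -/
lemma exists_high (hn : 1 ≤ n) (u : HarmonicPoly n) {z : ℂ} (hz : z ∈ u.regularSet) :
    (∃ p ∈ u.criticalSet, u.HighNode (u.edge z) p) ∨ ∃ k, u.HighLeaf (u.edge z) k := by
  have hne := u.neBot_highFilter hz
  by_cases hb : BddAbove (u.ht '' u.edge z)
  · left
    obtain ⟨M, hM⟩ := hb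
    have hK : ∃ K, IsCompact K ∧ K ∈ u.highFilter (u.edge z) := by
      have h1 := (u.tendsto_norm_eval hn).eventually_gt_atTop (max |u.ht z| |M|)
      rw [Filter.Eventually, (Metric.hasBasis_cobounded_compl_closedBall (0 : ℂ)).mem_iff] at h1
      obtain ⟨r, -, hr⟩ := h1
      refine ⟨Metric.closedBall 0 r, isCompact_closedBall _ _, ?_⟩
      filter_upwards [u.eventually_highFilter_le hz (mem_edge_self hz)] with w hw
      by_contra hwr
      have h2 := hr hwr
      have h3 := hM ⟨w, hw.1, rfl⟩
      have h4 : u.P.eval w = _ := eval_of_mem_zeroSet (u.edge_subset z hw.1).1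
      simp only [mem_ofPred_eq] at h2
      rw [h4, norm_mul, Complex.norm_I, mul_one, Complex.norm_real, Real.norm_eq_abs] at h2
      have := abs_le_max_abs_abs hw.2 h3
      linarith
    obtain ⟨K, hK, hKF⟩ := hK
    have := (u.hasBasis_highFilter hz).tendsto_of_eventually_near_finite
      (fun w _ => u.isPreconnected_tail z w) univ_mem continuousOn_id (u.finite_criticalSet hn) ?_
    · obtain ⟨p, hp, h⟩ := this
      exact ⟨p, hp, h⟩
    · intro ε hε
      by_contra hcon
      rw [not_eventually] at hcon
      have hne2 := frequently_mem_iff_neBot.1 hcon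
      obtain ⟨x, hxK, hx⟩ := @hK.exists_clusterPt _ _ _ _ hne2
        (inf_le_left.trans (le_principal_iff.2 hKF))
      have hxC := u.clusterPt_highFilter hz (hx.mono inf_le_left)
      have h2 : ∀ᶠ y in 𝓝 x, dist y x < ε := Metric.ball_mem_nhds x hε
      obtain ⟨y, hy1, hy2⟩ := ((hx.mono inf_le_right).frequently h2).and_eventually
        (mem_principal_self _) |>.exists
      exact hy2 ⟨x, hxC, hy1⟩
  · right
    have hT : Tendsto u.ht (u.highFilter (u.edge z)) atTop := by
      rw [tendsto_atTop]
      intro M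
      rw [not_bddAbove_iff] at hb
      obtain ⟨_, ⟨w, hw, rfl⟩, hMw⟩ := hb M
      filter_upwards [u.eventually_highFilter_le hz hw] with v hv using hMw.le.trans hv.2
    have hcob := u.le_cobounded_of_tendsto_ht hT
    obtain ⟨c, ⟨k, rfl⟩, hc⟩ := (u.hasBasis_highFilter hz).tendsto_of_eventually_near_finite
      (f := fun z => z / (‖z‖ : ℂ)) (S := range u.leafDir)
      (fun w _ => u.isPreconnected_tail z w) (hcob eventually_cobounded_ne_zero)
      (by
        intro x hx
        have : (‖x‖ : ℂ) ≠ 0 := by exact_mod_cast norm_ne_zero_iff.2 hx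
        exact (continuousAt_id.div (Complex.continuous_ofReal.comp continuous_norm).continuousAt this).continuousWithinAt)
      (finite_range _)
      (fun ε hε => by
        have : u.highFilter (u.edge z) ≤ Bornology.cobounded ℂ ⊓ 𝓟 u.zeroSet :=
          le_inf hcob (le_principal_iff.2 (mem_of_superset (u.edge_mem_highFilter hz)
            ((u.edge_subset z).trans u.regularSet_subset)))
        filter_upwards [this (u.eventually_near_leafDir hn hε)] with w hw
        obtain ⟨k, hk⟩ := hw
        exact ⟨_, ⟨k, rfl⟩, hk⟩)
    exact ⟨k, hT, hc⟩

end HarmonicPoly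

end

/-! ### Both ends of an edge -/

section

open Set Filter Topology

namespace HarmonicPoly

variable {n : ℕ}

/-! ### Reflection of the height -/

/-- The harmonic polynomial `-u`. -/
noncomputable def neg (u : HarmonicPoly n) : HarmonicPoly n where
  P := -u.P
  natDegree_eq := by rw [Polynomial.natDegree_neg, u.natDegree_eq]
  dir := u.dir
  norm_dir := u.norm_dir
  re_dir := by rw [Polynomial.leadingCoeff_neg, neg_mul, Complex.neg_re, u.re_dir, neg_zero]

lemma neg_ht (u : HarmonicPoly n) (z : ℂ) : u.neg.ht z = -u.ht z := by simp [ht, neg]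

lemma neg_toFun (u : HarmonicPoly n) (z : ℂ) : u.neg.toFun z = -u.toFun z := by simp [toFun, neg]

lemma neg_derivative_eval (u : HarmonicPoly n) (z : ℂ) :
    u.neg.P.derivative.eval z = -u.P.derivative.eval z := by simp [neg]

lemma neg_zeroSet (u : HarmonicPoly n) : u.neg.zeroSet = u.zeroSet := by
  ext z; simp [zeroSet, neg_toFun]

lemma neg_regularSet (u : HarmonicPoly n) : u.neg.regularSet = u.regularSet := by
  ext z; simp [regularSet, neg_toFun, neg_derivative_eval]

lemma neg_criticalSet (u : HarmonicPoly n) : u.neg.criticalSet = u.criticalSet := by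
  ext z; simp [mem_criticalSet_iff, neg_toFun, neg_derivative_eval]

lemma neg_edge (u : HarmonicPoly n) (z : ℂ) : u.neg.edge z = u.edge z := by
  rw [edge_eq, edge_eq, neg_regularSet]

lemma neg_leafDir (u : HarmonicPoly n) (k : Fin (2 * n)) : u.neg.leafDir k = u.leafDir k := rfl

lemma neg_multiplicity (u : HarmonicPoly n) (z : ℂ) :
    u.neg.multiplicity z = u.multiplicity z := by
  simp only [multiplicity, neg, Polynomial.derivative_neg]
  by_cases h : u.P.derivative = 0
  · simp [h]
  · rw [show -Polynomial.derivative u.P = Polynomial.C (-1) * Polynomial.derivative u.P by simp,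
      Polynomial.rootMultiplicity_mul (by simpa using h), Polynomial.rootMultiplicity_C, zero_add]

/-- The lower end of an edge of u is its upper end for -u, which has the same zero set, edges and
leaf directions and the opposite height. -/
lemma eventually_lowFilter_le (u : HarmonicPoly n) {z w : ℂ} (hz : z ∈ u.regularSet)
    (hw : w ∈ u.edge z) : ∀ᶠ v in u.neg.highFilter (u.edge z), v ∈ u.edge z ∧ u.ht v ≤ u.ht w := by
  have := u.neg.eventually_highFilter_le (z := z) (w := w) (by rwa [neg_regularSet])
    (by rwa [neg_edge])
  simpa [neg_edge, neg_ht] using this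

lemma exists_ht_lt (u : HarmonicPoly n) {z w : ℂ} (hw : w ∈ u.edge z) :
    ∃ v ∈ u.edge z, u.ht v < u.ht w := by
  have := u.neg.exists_ht_gt (z := z) (w := w) (by rwa [neg_edge])
  simpa [neg_edge, neg_ht] using this

/-- A filter on an edge without cluster points on the edge meets one of the two ends. -/
lemma neBot_inf_high_or_low (u : HarmonicPoly n) {z : ℂ} (hz : z ∈ u.regularSet) {G : Filter ℂ}
    [G.NeBot] (hG : G ≤ 𝓟 (u.edge z)) (hcl : ∀ x ∈ u.edge z, ¬ ClusterPt x G) :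
    (G ⊓ u.highFilter (u.edge z)).NeBot ∨ (G ⊓ u.neg.highFilter (u.edge z)).NeBot := by
  by_contra hcon
  push Not at hcon
  obtain ⟨h1, h2⟩ := hcon
  rw [← disjoint_iff, (u.hasBasis_highFilter hz).disjoint_iff_right] at h1
  have hb := u.neg.hasBasis_highFilter (z := z) (by rwa [neg_regularSet])
  simp only [neg_edge, neg_ht, neg_le_neg_iff] at hb
  rw [← disjoint_iff, hb.disjoint_iff_right] at h2
  obtain ⟨w, hw, hw'⟩ := h1
  obtain ⟨v, hv, hv'⟩ := h2
  have hK := u.isCompact_edge_between hv hw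
  have hGK : G ≤ 𝓟 {x | x ∈ u.edge z ∧ u.ht v ≤ u.ht x ∧ u.ht x ≤ u.ht w} := by
    rw [le_principal_iff]
    filter_upwards [hw', hv', le_principal_iff.1 hG] with x h1 h2 h3
    refine ⟨h3, ?_, ?_⟩
    · by_contra h
      exact h2 ⟨h3, (not_le.1 h).le⟩
    · by_contra h
      exact h1 ⟨h3, (not_le.1 h).le⟩
  obtain ⟨x, hx, hxc⟩ := hK.exists_clusterPt hGK
  exact hcl x hx.1 hxc

/-- The upper end of the edge `E` is the vertex. -/
def IsHigh (u : HarmonicPoly n) (E : Set ℂ) : u.Vertex → Prop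
  | Sum.inl k => u.HighLeaf E k
  | Sum.inr p => u.HighNode E p

/-- The lower end of the edge `E` is the vertex. -/
def IsLow (u : HarmonicPoly n) (E : Set ℂ) : u.Vertex → Prop
  | Sum.inl k => u.neg.HighLeaf E k
  | Sum.inr p => u.neg.HighNode E p

lemma exists_isHigh (hn : 1 ≤ n) (u : HarmonicPoly n) {z : ℂ} (hz : z ∈ u.regularSet) :
    ∃ x, u.IsHigh (u.edge z) x := by
  rcases u.exists_high hn hz with ⟨p, hp, h⟩ | ⟨k, h⟩
  · exact ⟨Sum.inr ⟨p, hp⟩, h⟩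
  · exact ⟨Sum.inl k, h⟩

lemma exists_isLow (hn : 1 ≤ n) (u : HarmonicPoly n) {z : ℂ} (hz : z ∈ u.regularSet) :
    ∃ x, u.IsLow (u.edge z) x := by
  have := u.neg.exists_high hn (z := z) (by rwa [neg_regularSet])
  rw [neg_criticalSet, neg_edge] at this
  rcases this with ⟨p, hp, h⟩ | ⟨k, h⟩
  · exact ⟨Sum.inr ⟨p, hp⟩, h⟩
  · exact ⟨Sum.inl k, h⟩

/-- A filter that goes to a vertex. -/
def GoesTo (u : HarmonicPoly n) (F : Filter ℂ) : u.Vertex → Prop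
  | Sum.inl k => F ≤ Bornology.cobounded ℂ ∧
      Tendsto (fun z => z / (‖z‖ : ℂ)) F (𝓝 (u.leafDir k))
  | Sum.inr p => F ≤ 𝓝 (p : ℂ)

lemma GoesTo.mono {u : HarmonicPoly n} {F G : Filter ℂ} {x : u.Vertex} (h : u.GoesTo F x)
    (hG : G ≤ F) : u.GoesTo G x := by
  cases x with
  | inl k => exact ⟨hG.trans h.1, h.2.mono_left hG⟩
  | inr p => exact hG.trans h

lemma GoesTo.unique (hn : 1 ≤ n) {u : HarmonicPoly n} {F : Filter ℂ} [hF : F.NeBot]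
    {x y : u.Vertex} (hx : u.GoesTo F x) (hy : u.GoesTo F y) : x = y := by
  have key : ∀ p : ℂ, F ≤ 𝓝 p → F ≤ Bornology.cobounded ℂ → False := fun p h1 h2 =>
    hF.ne (le_bot_iff.1 ((le_inf h1 h2).trans (Metric.disjoint_nhds_cobounded p).le_bot))
  cases x with
  | inl k =>
    cases y with
    | inl l => rw [u.leafDir_injective hn (tendsto_nhds_unique hx.2 hy.2)]
    | inr q => exact (key q hy hx.1).elim
  | inr p =>
    cases y with
    | inl l => exact (key p hx hy.1).elim
    | inr q =>
      have : (p : ℂ) = q := tendsto_nhds_unique (f := id) (tendsto_id'.2 hx) (tendsto_id'.2 hy)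
      rw [Subtype.ext this]

lemma IsHigh.goesTo {u : HarmonicPoly n} {E : Set ℂ} {x : u.Vertex} (h : u.IsHigh E x) :
    u.GoesTo (u.highFilter E) x := by
  cases x with
  | inl k => exact ⟨u.le_cobounded_of_tendsto_ht h.1, h.2⟩
  | inr p => exact h

lemma IsLow.goesTo {u : HarmonicPoly n} {E : Set ℂ} {x : u.Vertex} (h : u.IsLow E x) :
    u.GoesTo (u.neg.highFilter E) x := by
  cases x with
  | inl k => exact ⟨u.neg.le_cobounded_of_tendsto_ht h.1, h.2⟩
  | inr p => exact h

lemma neBot_lowFilter (u : HarmonicPoly n) {z : ℂ} (hz : z ∈ u.regularSet) :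
    (u.neg.highFilter (u.edge z)).NeBot := by
  have := u.neg.neBot_highFilter (z := z) (by rwa [neg_regularSet])
  rwa [neg_edge] at this

lemma edge_mem_lowFilter (u : HarmonicPoly n) {z : ℂ} (hz : z ∈ u.regularSet) :
    u.edge z ∈ u.neg.highFilter (u.edge z) := by
  have := u.neg.edge_mem_highFilter (z := z) (by rwa [neg_regularSet])
  rwa [neg_edge] at this

lemma reaches_of_goesTo {u : HarmonicPoly n} {E : Set ℂ} {F : Filter ℂ} [F.NeBot] (hE : E ∈ F)
    {x : u.Vertex} (h : u.GoesTo F x) : u.Reaches E x := by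
  cases x with
  | inl k =>
    obtain ⟨h1, h2⟩ := h
    have hf : ∀ m : ℕ, ∃ z ∈ E, (m : ℝ) < ‖z‖ ∧
        dist (z / (‖z‖ : ℂ)) (u.leafDir k) < 1 / ((m : ℝ) + 1) := by
      intro m
      have e1 : ∀ᶠ z in F, (m : ℝ) < ‖z‖ :=
        h1 (tendsto_norm_cobounded_atTop.eventually_gt_atTop (m : ℝ))
      have e2 := Metric.tendsto_nhds.1 h2 (1 / ((m : ℝ) + 1)) (by positivity)
      obtain ⟨z, hz1, hz2, hz3⟩ := (Filter.Eventually.and hE (e1.and e2)).exists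
      exact ⟨z, hz1, hz2, hz3⟩
    choose s hs1 hs2 hs3 using hf
    refine ⟨s, hs1, tendsto_atTop_mono (fun m => (hs2 m).le) tendsto_natCast_atTop_atTop, ?_⟩
    rw [tendsto_iff_dist_tendsto_zero]
    exact squeeze_zero (fun _ => dist_nonneg) (fun m => (hs3 m).le)
      tendsto_one_div_add_atTop_nhds_zero_nat
  | inr p =>
    show (p : ℂ) ∈ closure E
    rw [mem_closure_iff_clusterPt]
    exact Filter.NeBot.mono ‹_› (le_inf h (le_principal_iff.2 hE))

/-- Both ways of reaching a vertex become one filter on the edge. Having no cluster point on the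
edge, it must run into one of the two ends, by `neBot_inf_high_or_low`. -/
lemma exists_goesTo_of_reaches {u : HarmonicPoly n} {z : ℂ}
    {x : u.Vertex} (h : u.Reaches (u.edge z) x) : ∃ G : Filter ℂ, G.NeBot ∧ G ≤ 𝓟 (u.edge z) ∧
      u.GoesTo G x ∧ ∀ y ∈ u.edge z, ¬ ClusterPt y G := by
  cases x with
  | inl k =>
    obtain ⟨s, h1, h2, h3⟩ := h
    have hc : map s atTop ≤ Bornology.cobounded ℂ := tendsto_norm_atTop_iff_cobounded.1 h2
    refine ⟨map s atTop, inferInstance, ?_, ⟨hc, h3⟩, ?_⟩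
    · exact le_principal_iff.2 (mem_map.2 (univ_mem' h1))
    · intro y _ hy
      exact hy.ne (le_bot_iff.1 ((inf_le_inf_left _ hc).trans
        (Metric.disjoint_nhds_cobounded y).le_bot))
  | inr p =>
    have h' : (p : ℂ) ∈ closure (u.edge z) := h
    rw [mem_closure_iff_clusterPt] at h'
    refine ⟨𝓝 (p : ℂ) ⊓ 𝓟 (u.edge z), h', inf_le_right, (inf_le_left : _ ≤ 𝓝 (p : ℂ)), ?_⟩
    intro y hy hyc
    have : y = p := eq_of_nhds_neBot (hyc.mono inf_le_left)
    exact not_mem_criticalSet (u.edge_subset z hy) (this ▸ p.2)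

/-- a L^n is the limit of P / |z|^n, whose imaginary part has the sign of the height. It cannot
vanish, since its real part does; so this sign tells leaves at upper ends from leaves at lower ends.
-/
lemma leadingCoeff_mul_leafDir_im (u : HarmonicPoly n) {z : ℂ} {k : Fin (2 * n)}
    (hz : z ∈ u.regularSet)
    (h : u.HighLeaf (u.edge z) k) : 0 ≤ (u.P.leadingCoeff * u.leafDir k ^ n).im := by
  have := u.neBot_highFilter hz
  have hc := u.le_cobounded_of_tendsto_ht h.1
  have h1 := (Complex.continuous_im.tendsto _).comp (u.tendsto_eval_div_norm_pow hc h.2)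
  refine ge_of_tendsto h1 ?_
  filter_upwards [h.1.eventually_ge_atTop 0] with w hw
  simp only [Function.comp]
  rw [← Complex.ofReal_pow, Complex.div_ofReal_im]
  exact div_nonneg hw (by positivity)

lemma leafDir_pow_re (hn : 1 ≤ n) (u : HarmonicPoly n) (k : Fin (2 * n)) :
    (u.P.leadingCoeff * u.leafDir k ^ n).re = 0 := by
  have hn0 : (n : ℂ) ≠ 0 := by exact_mod_cast (by omega : n ≠ 0)
  have : u.leafDir k ^ n = u.dir ^ n * (((-1) ^ (k : ℕ) : ℝ) : ℂ) := by
    rw [leafDir, mul_pow, ← Complex.exp_nat_mul]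
    congr 1
    rw [show (n : ℂ) * ((k : ℕ) * Real.pi / n * Complex.I) = (k : ℕ) * (Real.pi * Complex.I) by
      field_simp, Complex.exp_nat_mul, Complex.exp_pi_mul_I]
    push_cast; rfl
  rw [this, ← mul_assoc, Complex.re_mul_ofReal, u.re_dir, zero_mul]

lemma leafDir_pow_im_ne (hn : 1 ≤ n) (u : HarmonicPoly n) (k : Fin (2 * n)) :
    (u.P.leadingCoeff * u.leafDir k ^ n).im ≠ 0 := by
  intro h
  have : u.P.leadingCoeff * u.leafDir k ^ n = 0 := Complex.ext (u.leafDir_pow_re hn k) h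
  have h2 := congrArg norm this
  rw [norm_mul, norm_pow, u.norm_leafDir, one_pow, mul_one, norm_zero, norm_eq_zero] at h2
  exact u.leadingCoeff_ne_zero hn h2

lemma highLeaf_im_pos (hn : 1 ≤ n) (u : HarmonicPoly n) {z : ℂ} {k : Fin (2 * n)}
    (hz : z ∈ u.regularSet)
    (h : u.HighLeaf (u.edge z) k) : 0 < (u.P.leadingCoeff * u.leafDir k ^ n).im :=
  lt_of_le_of_ne (u.leadingCoeff_mul_leafDir_im hz h) (u.leafDir_pow_im_ne hn k).symm

lemma lowLeaf_im_neg (hn : 1 ≤ n) (u : HarmonicPoly n) {z : ℂ} {k : Fin (2 * n)}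
    (hz : z ∈ u.regularSet)
    (h : u.neg.HighLeaf (u.edge z) k) : (u.P.leadingCoeff * u.leafDir k ^ n).im < 0 := by
  have := u.neg.highLeaf_im_pos hn (z := z) (k := k) (by rwa [neg_regularSet]) (by rwa [neg_edge])
  have h2 : u.neg.P.leadingCoeff = -u.P.leadingCoeff := Polynomial.leadingCoeff_neg _
  rw [neg_leafDir, h2, neg_mul, Complex.neg_im] at this
  linarith

lemma IsHigh.lt {u : HarmonicPoly n} {z w : ℂ} (hz : z ∈ u.regularSet) {p : u.criticalSet}
    (h : u.IsHigh (u.edge z) (Sum.inr p)) (hw : w ∈ u.edge z) : u.ht w < u.ht p := by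
  obtain ⟨v, hv, hwv⟩ := u.exists_ht_gt hw
  have := u.neBot_highFilter hz
  refine hwv.trans_le (ge_of_tendsto (f := u.ht) (x := u.highFilter (u.edge z))
    (u.continuous_ht.continuousAt.mono_left h) ?_)
  exact (u.eventually_highFilter_le hz hv).mono fun _ h => h.2

lemma IsLow.lt {u : HarmonicPoly n} {z w : ℂ} (hz : z ∈ u.regularSet) {p : u.criticalSet}
    (h : u.IsLow (u.edge z) (Sum.inr p)) (hw : w ∈ u.edge z) : u.ht p < u.ht w := by
  obtain ⟨v, hv, hwv⟩ := u.exists_ht_lt hw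
  have := u.neBot_lowFilter hz
  refine lt_of_le_of_lt (le_of_tendsto (f := u.ht) (x := u.neg.highFilter (u.edge z))
    (u.continuous_ht.continuousAt.mono_left h) ?_) hwv
  exact (u.eventually_lowFilter_le hz hv).mono fun _ h => h.2

lemma IsHigh.ne_of_isLow (hn : 1 ≤ n) {u : HarmonicPoly n} {z : ℂ} (hz : z ∈ u.regularSet)
    {x y : u.Vertex} (hx : u.IsHigh (u.edge z) x) (hy : u.IsLow (u.edge z) y) : x ≠ y := by
  rintro rfl
  cases x with
  | inl k => exact lt_asymm (u.highLeaf_im_pos hn hz hx) (u.lowLeaf_im_neg hn hz hy)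
  | inr p => exact lt_asymm (hx.lt hz (mem_edge_self hz)) (hy.lt hz (mem_edge_self hz))

lemma IsHigh.unique (hn : 1 ≤ n) {u : HarmonicPoly n} {z : ℂ} (hz : z ∈ u.regularSet)
    {x y : u.Vertex} (hx : u.IsHigh (u.edge z) x) (hy : u.IsHigh (u.edge z) y) : x = y :=
  have := u.neBot_highFilter hz
  GoesTo.unique hn hx.goesTo hy.goesTo

lemma IsLow.unique (hn : 1 ≤ n) {u : HarmonicPoly n} {z : ℂ} (hz : z ∈ u.regularSet)
    {x y : u.Vertex} (hx : u.IsLow (u.edge z) x) (hy : u.IsLow (u.edge z) y) : x = y :=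
  have := u.neBot_lowFilter hz
  GoesTo.unique hn hx.goesTo hy.goesTo

/-- `Reaches` only asks for accumulation at the vertex, which could be weaker than convergence of an
end. It is not, because each end converges somewhere and limits are unique. -/
lemma reaches_iff (hn : 1 ≤ n) {u : HarmonicPoly n} {z : ℂ} (hz : z ∈ u.regularSet)
    {x : u.Vertex} : u.Reaches (u.edge z) x ↔ u.IsHigh (u.edge z) x ∨ u.IsLow (u.edge z) x := by
  constructor
  · intro h
    obtain ⟨G, hG, hGE, hGx, hcl⟩ := exists_goesTo_of_reaches h
    rcases u.neBot_inf_high_or_low hz hGE hcl with hne | hne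
    · left
      obtain ⟨y, hy⟩ := u.exists_isHigh hn hz
      rwa [GoesTo.unique hn (hGx.mono inf_le_left) (hy.goesTo.mono inf_le_right)]
    · right
      obtain ⟨y, hy⟩ := u.exists_isLow hn hz
      rwa [GoesTo.unique hn (hGx.mono inf_le_left) (hy.goesTo.mono inf_le_right)]
  · rintro (h | h)
    · have := u.neBot_highFilter hz
      exact reaches_of_goesTo (u.edge_mem_highFilter hz) h.goesTo
    · have := u.neBot_lowFilter hz
      exact reaches_of_goesTo (u.edge_mem_lowFilter hz) h.goesTo

/-- Every edge has exactly two distinct ends. -/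
lemma exists_ends (hn : 1 ≤ n) (u : HarmonicPoly n) {z : ℂ} (hz : z ∈ u.regularSet) :
    ∃ x y : u.Vertex, x ≠ y ∧ u.IsHigh (u.edge z) x ∧ u.IsLow (u.edge z) y ∧
      ∀ v, u.Reaches (u.edge z) v ↔ v = x ∨ v = y := by
  obtain ⟨x, hx⟩ := u.exists_isHigh hn hz
  obtain ⟨y, hy⟩ := u.exists_isLow hn hz
  refine ⟨x, y, hx.ne_of_isLow hn hz hy, hx, hy, fun v => ?_⟩
  rw [reaches_iff hn hz]
  constructor
  · rintro (h | h)
    · exact Or.inl (h.unique hn hz hx)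
    · exact Or.inr (h.unique hn hz hy)
  · rintro (rfl | rfl)
    · exact Or.inl hx
    · exact Or.inr hy

lemma adj_iff {u : HarmonicPoly n} {x y : u.Vertex} : u.forestGraph.Adj x y ↔
    x ≠ y ∧ ∃ z ∈ u.regularSet, u.Reaches (u.edge z) x ∧ u.Reaches (u.edge z) y := by
  rw [← zeroSet_diff_criticalSet]; rfl

end HarmonicPoly

end

/-! ### Each leaf belongs to exactly one edge -/

section

open Set Filter Topology

/-- A polynomial of positive real part derivative (up to rotation) on a convex set is injective. -/
lemma Polynomial.injOn_of_convex_of_re_pos (P : Polynomial ℂ) (c : ℂ) {S : Set ℂ}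
    (hS : Convex ℝ S) (h : ∀ z ∈ S, 0 < (c * P.derivative.eval z).re) :
    InjOn (fun z => P.eval z) S := by
  intro z hz w hw hzw
  by_contra hne
  -- Noshiro–Warschawski argument: apply Rolle on the segment from `w` to `z`. The factor `star (z -
  -- w)` turns the derivative into |z - w|² Re (c P'), which is positive.
  have hd : ∀ s : ℝ, HasDerivAt (fun s : ℝ => (c * star (z - w) * P.eval (w + s * (z - w))).re)
      (c * star (z - w) * (P.derivative.eval (w + s * (z - w)) * (z - w))).re s := by
    intro s
    have h1 : HasDerivAt (fun s : ℝ => w + (s : ℂ) * (z - w)) (z - w) s := by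
      simpa using ((Complex.ofRealCLM.hasDerivAt (x := s)).mul_const (z - w)).const_add w
    have h2 := ((P.hasDerivAt (w + s * (z - w))).comp s h1).const_mul (c * star (z - w))
    exact (Complex.reCLM.hasFDerivAt.comp_hasDerivAt s h2)
  obtain ⟨s, hs, hs0⟩ := exists_hasDerivAt_eq_zero (zero_lt_one' ℝ)
    (fun s _ => (hd s).continuousAt.continuousWithinAt) (by simp at hzw; simp [hzw]) fun s _ => hd s
  have hmem : w + s * (z - w) ∈ S := by
    have := hS hw hz (show 0 ≤ 1 - s by linarith [hs.2]) hs.1.le (by ring)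
    convert this using 1
    simp only [Complex.real_smul]; push_cast; ring
  have h3 := h _ hmem
  have h4 : c * star (z - w) * (P.derivative.eval (w + s * (z - w)) * (z - w)) =
      ((Complex.normSq (z - w) : ℝ) : ℂ) * (c * P.derivative.eval (w + s * (z - w))) := by
    rw [← Complex.mul_conj, Complex.star_def]; ring
  rw [h4, Complex.re_ofReal_mul] at hs0
  have h5 : 0 < Complex.normSq (z - w) := Complex.normSq_pos.2 (sub_ne_zero.2 hne)
  exact (mul_pos h5 h3).ne' hs0

namespace HarmonicPoly

variable {n : ℕ}

lemma natDegree_derivative (u : HarmonicPoly n) : u.P.derivative.natDegree = n - 1 := by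
  rw [Polynomial.natDegree_derivative, u.natDegree_eq]

lemma tendsto_derivative_div (hn : 1 ≤ n) (u : HarmonicPoly n) {F : Filter ℂ}
    (hF : F ≤ Bornology.cobounded ℂ) {c : ℂ} (hc : Tendsto (fun z => z / (‖z‖ : ℂ)) F (𝓝 c)) :
    Tendsto (fun z => u.P.derivative.eval z / (‖z‖ : ℂ) ^ (n - 1)) F
      (𝓝 (n * u.P.leadingCoeff * c ^ (n - 1))) := by
  have h1 : Tendsto (fun z => u.P.derivative.reverse.eval z) (𝓝 0)
      (𝓝 (n * u.P.leadingCoeff)) := by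
    have := u.P.derivative.reverse.continuous.tendsto (0 : ℂ)
    rw [← Polynomial.coeff_zero_eq_eval_zero, Polynomial.coeff_zero_reverse,
      Polynomial.leadingCoeff, u.natDegree_derivative, Polynomial.coeff_derivative,
      Nat.sub_add_cancel hn] at this
    convert this using 2
    rw [Polynomial.leadingCoeff, u.natDegree_eq, Nat.cast_sub hn]
    push_cast; ring
  have h := ((h1.comp tendsto_inv₀_cobounded).mono_left hF).mul (hc.pow (n - 1))
  refine h.congr' ?_
  filter_upwards [hF eventually_cobounded_ne_zero] with z hz
  have := @Polynomial.eval₂_reverse_mul_pow _ _ _ _ (RingHom.id ℂ) z (invertibleOfNonzero hz)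
    u.P.derivative
  rw [u.natDegree_derivative, invOf_eq_inv, Polynomial.eval₂_id, Polynomial.eval₂_id] at this
  rw [← this, div_pow]
  simp only [Function.comp]
  ring

/-- Near infinity in an asymptotic direction, `P` is injective. -/
lemma exists_injOn_cone (hn : 1 ≤ n) (u : HarmonicPoly n) (k : Fin (2 * n)) :
    ∃ S : Set ℂ, InjOn (fun z => u.P.eval z) S ∧ ∀ F : Filter ℂ, F ≤ Bornology.cobounded ℂ →
      Tendsto (fun z => z / (‖z‖ : ℂ)) F (𝓝 (u.leafDir k)) → S ∈ F := by
  set L := u.leafDir k with hL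
  have hLn : ‖L‖ = 1 := u.norm_leafDir k
  set a := u.P.leadingCoeff
  -- In direction `L`, c P' is asymptotic to the positive number n |a L^(n-1)|² |z|^(n-1).
  set c := star (a * L ^ (n - 1)) with hc
  set F₀ := Bornology.cobounded ℂ ⊓ comap (fun z : ℂ => z / (‖z‖ : ℂ)) (𝓝 L) with hF₀
  have h1 := (Complex.continuous_re.tendsto _).comp
    ((u.tendsto_derivative_div hn (F := F₀) inf_le_left
      (tendsto_comap.mono_left inf_le_right)).const_mul c)
  have hpos : 0 < (c * (n * a * L ^ (n - 1))).re := by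
    have : c * (n * a * L ^ (n - 1)) = ((n * Complex.normSq (a * L ^ (n - 1)) : ℝ) : ℂ) := by
      push_cast
      rw [← Complex.mul_conj, hc, Complex.star_def]; ring
    rw [this, Complex.ofReal_re]
    have : a * L ^ (n - 1) ≠ 0 := by
      refine mul_ne_zero (u.leadingCoeff_ne_zero hn) (pow_ne_zero _ ?_)
      rw [← norm_ne_zero_iff, hLn]; exact one_ne_zero
    have h2 := Complex.normSq_pos.2 this
    have : (0 : ℝ) < n := by exact_mod_cast hn
    positivity
  have h2 : ∀ᶠ z in F₀, 0 < (c * u.P.derivative.eval z).re := by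
    filter_upwards [h1.eventually_const_lt hpos, (inf_le_left : F₀ ≤ _)
      eventually_cobounded_ne_zero] with z hz hz0
    simp only [Function.comp] at hz
    rw [← mul_div_assoc, ← Complex.ofReal_pow, Complex.div_ofReal_re] at hz
    by_contra hneg
    have : (c * u.P.derivative.eval z).re / ‖z‖ ^ (n - 1) ≤ 0 :=
      div_nonpos_of_nonpos_of_nonneg (not_lt.1 hneg) (by positivity)
    linarith
  have hbasis := (Metric.hasBasis_cobounded_compl_closedBall (0 : ℂ)).inf
    ((Metric.nhds_basis_ball (x := L)).comap (fun z : ℂ => z / (‖z‖ : ℂ)))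
  obtain ⟨⟨R, η⟩, ⟨-, hη⟩, hsub⟩ := hbasis.eventually_iff.1 h2
  simp only at hη hsub
  -- For a unit vector v one has |v - L|² = 2 - 2 q(v), so q(v) > 1 - ε gives |v - L|² < 2ε ≤ η² /
  -- 2. The bound 1/2 keeps 1 - ε positive, which convexity of the cone needs, and makes q(z)
  -- comparable to |z| on it.
  set ε := min (η ^ 2 / 4) (1 / 2) with hε
  have hεpos : 0 < ε := by positivity
  have hε1 : ε ≤ 1 / 2 := min_le_right _ _
  set q : ℂ →L[ℝ] ℝ := Complex.reCLM.comp
    ((ContinuousLinearMap.mul ℂ ℂ (star L)).restrictScalars ℝ) with hq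
  have hqv : ∀ z, q z = (star L * z).re := fun z => rfl
  have hqle : ∀ z, q z ≤ ‖z‖ := by
    intro z
    rw [hqv]
    refine (Complex.re_le_norm _).trans ?_
    rw [norm_mul, norm_star, hLn, one_mul]
  -- A circular cone around direction `L` cut off by a half-plane: convex, and contained in the
  -- region where Re (c P') > 0.
  refine ⟨{z | max R 0 < q z ∧ (1 - ε) * ‖z‖ < q z}, ?_, ?_⟩
  · apply Polynomial.injOn_of_convex_of_re_pos _ c
    · apply Convex.inter
      · exact convex_halfSpace_gt q.toLinearMap.isLinear _
      · intro x hx y hy s t hs ht hst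
        have hx' : (1 - ε) * ‖x‖ < q x := hx
        have hy' : (1 - ε) * ‖y‖ < q y := hy
        show (1 - ε) * ‖s • x + t • y‖ < q (s • x + t • y)
        rw [map_add, map_smul, map_smul, smul_eq_mul, smul_eq_mul]
        have h3 : ‖s • x + t • y‖ ≤ s * ‖x‖ + t * ‖y‖ := by
          refine (norm_add_le _ _).trans ?_
          rw [norm_smul, norm_smul, Real.norm_of_nonneg hs, Real.norm_of_nonneg ht]
        have h4 : (1 - ε) * ‖s • x + t • y‖ ≤ (1 - ε) * (s * ‖x‖ + t * ‖y‖) :=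
          mul_le_mul_of_nonneg_left h3 (by linarith)
        refine lt_of_le_of_lt h4 ?_
        rcases hs.eq_or_lt with rfl | hs'
        · have : t = 1 := by linarith
          subst this; simpa using hy'
        · nlinarith [mul_lt_mul_of_pos_left hx' hs', mul_le_mul_of_nonneg_left hy'.le ht]
    · rintro z ⟨hz1, hz2⟩
      have hzn : max R 0 < ‖z‖ := hz1.trans_le (hqle z)
      have hz0 : 0 < ‖z‖ := (le_max_right _ _).trans_lt hzn
      apply hsub
      refine ⟨?_, ?_⟩
      · simp only [mem_compl_iff, mem_closedBall_zero_iff, not_le]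
        exact (le_max_left _ _).trans_lt hzn
      · simp only [mem_preimage, mem_ball_iff_norm]
        have hzz : z ≠ 0 := norm_pos_iff.1 hz0
        have e1 : ‖z / (‖z‖ : ℂ) - L‖ ^ 2 = 2 - 2 * (q z / ‖z‖) := by
          have hsub : ‖z / (‖z‖ : ℂ) - L‖ ^ 2 = ‖z / (‖z‖ : ℂ)‖ ^ 2 -
              2 * (star L * (z / (‖z‖ : ℂ))).re + ‖L‖ ^ 2 := by
            rw [← Complex.normSq_eq_norm_sq, ← Complex.normSq_eq_norm_sq,
              ← Complex.normSq_eq_norm_sq, Complex.normSq_sub, mul_comm (star L), Complex.star_def]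
            ring
          rw [hsub, norm_div_norm hzz, hLn, hqv, ← mul_div_assoc, Complex.div_ofReal_re]
          ring
        have e2 : 1 - ε < q z / ‖z‖ := by rwa [lt_div_iff₀ hz0]
        have e3 : ε ≤ η ^ 2 / 4 := min_le_left _ _
        have : ‖z / (‖z‖ : ℂ) - L‖ ^ 2 < η ^ 2 := by rw [e1]; nlinarith
        exact lt_of_pow_lt_pow_left₀ 2 hη.le this
  · intro F hF hdir
    have e1 : Tendsto (fun z : ℂ => q (z / (‖z‖ : ℂ))) F (𝓝 1) := by
      have := (q.continuous.tendsto L).comp hdir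
      have hq1 : q L = 1 := by
        rw [hqv, Complex.star_def, mul_comm, Complex.mul_conj, Complex.normSq_eq_norm_sq, hLn]; simp
      rwa [hq1] at this
    have e2 := e1.eventually_const_lt (show 1 - ε < 1 by linarith)
    have e3 : ∀ᶠ z in F, 2 * max R 0 < ‖z‖ :=
      hF (tendsto_norm_cobounded_atTop.eventually_gt_atTop _)
    filter_upwards [e2, e3, hF eventually_cobounded_ne_zero] with z h2 h3 h0
    have hz0 : 0 < ‖z‖ := norm_pos_iff.2 h0
    have : q (z / (‖z‖ : ℂ)) = q z / ‖z‖ := by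
      rw [hqv, hqv, ← mul_div_assoc, Complex.div_ofReal_re]
    rw [this, lt_div_iff₀ hz0] at h2
    refine ⟨?_, h2⟩
    nlinarith [le_max_right R 0]

/-- Both edges meet the set where P is injective at all large heights. On the zero set equal heights
mean equal values of P, so the two edges share a point. -/
lemma edge_eq_of_highLeaf (hn : 1 ≤ n) (u : HarmonicPoly n) {z w : ℂ} (hz : z ∈ u.regularSet)
    (hw : w ∈ u.regularSet) {k : Fin (2 * n)} (hk : u.HighLeaf (u.edge z) k)
    (hk' : u.HighLeaf (u.edge w) k) : u.edge z = u.edge w := by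
  obtain ⟨S, hS, hF⟩ := u.exists_injOn_cone hn k
  have key : ∀ z ∈ u.regularSet, u.HighLeaf (u.edge z) k → ∀ᶠ t in atTop, ∃ v ∈ u.edge z, v ∈ S ∧
      u.ht v = t := by
    intro z hz hk
    have h1 := hF _ (u.le_cobounded_of_tendsto_ht hk.1) hk.2
    obtain ⟨v, hv, hvS⟩ := (u.hasBasis_highFilter hz).mem_iff.1 h1
    filter_upwards [eventually_ge_atTop (u.ht v)] with t ht
    have := u.neBot_highFilter hz
    obtain ⟨x, hx, hxt⟩ := ((hk.1.eventually_ge_atTop t).and (u.edge_mem_highFilter hz)).exists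
    obtain ⟨y, hy, hyt⟩ := (u.isPreconnected_tail _ _).intermediate_value ⟨hv, le_rfl⟩
      ⟨hxt, ht.trans hx⟩ u.continuous_ht.continuousOn ⟨ht, hx⟩
    exact ⟨y, hy.1, hvS hy, hyt⟩
  obtain ⟨t, ⟨v, hv, hvS, hvt⟩, ⟨v', hv', hvS', hvt'⟩⟩ := ((key z hz hk).and (key w hw hk')).exists
  have : v = v' := by
    apply hS hvS hvS'
    simp only
    rw [eval_of_mem_zeroSet (u.edge_subset z hv).1, eval_of_mem_zeroSet (u.edge_subset w hv').1,
      hvt, hvt']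
  rw [← edge_eq_of_mem hv, ← edge_eq_of_mem hv', this]

lemma edge_eq_of_reaches_leaf (hn : 1 ≤ n) (u : HarmonicPoly n) {z w : ℂ} (hz : z ∈ u.regularSet)
    (hw : w ∈ u.regularSet) {k : Fin (2 * n)} (hk : u.Reaches (u.edge z) (Sum.inl k))
    (hk' : u.Reaches (u.edge w) (Sum.inl k)) : u.edge z = u.edge w := by
  rw [reaches_iff hn hz] at hk
  rw [reaches_iff hn hw] at hk'
  rcases hk with hk | hk <;> rcases hk' with hk' | hk'
  · exact u.edge_eq_of_highLeaf hn hz hw hk hk'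
  · exact absurd (u.highLeaf_im_pos hn hz hk) (u.lowLeaf_im_neg hn hw hk').not_gt
  · exact absurd (u.highLeaf_im_pos hn hw hk') (u.lowLeaf_im_neg hn hz hk).not_gt
  · have := u.neg.edge_eq_of_highLeaf hn (z := z) (w := w) (k := k) (by rwa [neg_regularSet])
      (by rwa [neg_regularSet]) (by rw [neg_edge]; exact hk) (by rw [neg_edge]; exact hk')
    rwa [neg_edge, neg_edge] at this

/-- The zero set has points far away in every asymptotic direction. -/
lemma eventually_exists_zero_near_leafDir (hn : 1 ≤ n) (u : HarmonicPoly n) (k : Fin (2 * n))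
    {δ : ℝ} (hδ : 0 < δ) :
    ∀ᶠ r : ℝ in atTop, ∃ z ∈ u.zeroSet, ‖z‖ = r ∧ dist (z / (‖z‖ : ℂ)) (u.leafDir k) < δ := by
  set L := u.leafDir k with hL
  have hLn : ‖L‖ = 1 := u.norm_leafDir k
  -- On the arc around direction `L` the leading term of Re P is -σ sin (n θ) up to the factor r^n.
  -- It has opposite signs at θ = ±α because 0 < n α ≤ 1 < π, and δ / 2 keeps the zero found between
  -- them close to `L`.
  set α : ℝ := min (δ / 2) (1 / n) with hα
  have hn0 : (0 : ℝ) < n := by exact_mod_cast hn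
  have hα0 : 0 < α := by positivity
  have hαn : n * α ≤ 1 := by
    have := min_le_right (δ / 2) (1 / n : ℝ)
    calc n * α ≤ n * (1 / n) := by gcongr
      _ = 1 := by field_simp
  set e : ℝ → ℂ := fun θ => L * Complex.exp (θ * Complex.I) with he
  have hen : ∀ θ, ‖e θ‖ = 1 := by
    intro θ; rw [he]; simp only; rw [norm_mul, hLn, Complex.norm_exp_ofReal_mul_I, one_mul]
  have hray : ∀ c : ℂ, ‖c‖ = 1 → Tendsto (fun r : ℝ => u.toFun (r * c) / r ^ n) atTop
      (𝓝 (u.P.leadingCoeff * c ^ n).re) := by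
    intro c hc
    have hnorm : ∀ᶠ r : ℝ in atTop, ‖(r : ℂ) * c‖ = r := by
      filter_upwards [eventually_ge_atTop 0] with r hr
      rw [norm_mul, hc, mul_one, Complex.norm_real, Real.norm_of_nonneg hr]
    have h1 : map (fun r : ℝ => (r : ℂ) * c) atTop ≤ Bornology.cobounded ℂ := by
      rw [← comap_norm_atTop, ← map_le_iff_le_comap, map_map]
      exact tendsto_id.congr' (hnorm.mono fun r hr => hr.symm)
    have h2 : Tendsto (fun z => z / (‖z‖ : ℂ)) (map (fun r : ℝ => (r : ℂ) * c) atTop) (𝓝 c) := by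
      rw [tendsto_map'_iff]
      refine tendsto_const_nhds.congr' ?_
      filter_upwards [hnorm, eventually_gt_atTop 0] with r hr hr0
      have : (r : ℂ) ≠ 0 := by exact_mod_cast hr0.ne'
      simp only [Function.comp]
      rw [hr]
      field_simp
    have h3 := (Complex.continuous_re.tendsto _).comp
      (tendsto_map'_iff.1 (u.tendsto_eval_div_norm_pow h1 h2))
    refine h3.congr' ?_
    filter_upwards [hnorm] with r hr
    simp only [Function.comp]
    rw [hr, ← Complex.ofReal_pow, Complex.div_ofReal_re]; rfl
  set σ := (u.P.leadingCoeff * L ^ n).im with hσ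
  have hval : ∀ θ : ℝ, (u.P.leadingCoeff * (e θ) ^ n).re = -σ * Real.sin (n * θ) := by
    intro θ
    have h1 : u.P.leadingCoeff * L ^ n = σ * Complex.I := by
      apply Complex.ext
      · simp [u.leafDir_pow_re hn k, hL]
      · simp [hσ]
    have h2 : Complex.exp (θ * Complex.I) ^ n = Complex.exp (((n * θ : ℝ) : ℂ) * Complex.I) := by
      rw [← Complex.exp_nat_mul]; push_cast; ring_nf
    rw [he]; simp only
    rw [mul_pow, ← mul_assoc, h1, h2, Complex.exp_ofReal_mul_I]
    generalize Real.cos (n * θ) = x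
    generalize Real.sin (n * θ) = y
    simp
  have hsin : 0 < Real.sin (n * α) :=
    Real.sin_pos_of_pos_of_lt_pi (by positivity) (by linarith [Real.pi_gt_three])
  have hσ0 : σ ≠ 0 := u.leafDir_pow_im_ne hn k
  have h1 := hray _ (hen α)
  have h2 := hray _ (hen (-α))
  rw [hval] at h1 h2
  have h3 := h1.mul h2
  have hneg : -σ * Real.sin (n * α) * (-σ * Real.sin (n * -α)) < 0 := by
    rw [mul_neg, Real.sin_neg]
    have : 0 < σ ^ 2 := by positivity
    nlinarith [mul_pos this (mul_pos hsin hsin)]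
  filter_upwards [h3.eventually_lt_const hneg, eventually_gt_atTop 0] with r hr hr0
  have hr' : u.toFun (r * e α) * u.toFun (r * e (-α)) < 0 := by
    have : 0 < r ^ n := by positivity
    rw [div_mul_div_comm] at hr
    by_contra hcon
    have := div_nonneg (not_lt.1 hcon) (by positivity : 0 ≤ r ^ n * r ^ n)
    linarith
  have hcont : Continuous fun θ : ℝ => u.toFun (r * e θ) := by
    apply u.continuous_toFun.comp
    rw [he]; fun_prop
  have hz0 : (0 : ℝ) ∈ (fun θ : ℝ => u.toFun (r * e θ)) '' uIcc (-α) α := by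
    apply intermediate_value_uIcc hcont.continuousOn
    rw [mem_uIcc]
    rcases mul_neg_iff.1 hr' with ⟨h1, h2⟩ | ⟨h1, h2⟩
    · left; exact ⟨h2.le, h1.le⟩
    · right; exact ⟨h1.le, h2.le⟩
  obtain ⟨θ, hθ, hθ0⟩ := hz0
  rw [uIcc_of_le (by linarith)] at hθ
  have hnr : ‖(r : ℂ) * e θ‖ = r := by
    rw [norm_mul, hen, mul_one, Complex.norm_real, Real.norm_of_nonneg hr0.le]
  refine ⟨r * e θ, hθ0, hnr, ?_⟩
  rw [hnr]
  have hrc : (r : ℂ) ≠ 0 := by exact_mod_cast hr0.ne'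
  rw [mul_div_cancel_left₀ _ hrc, he, dist_eq_norm]
  simp only
  rw [show L * Complex.exp (θ * Complex.I) - L = L * (Complex.exp (θ * Complex.I) - 1) by ring,
    norm_mul, hLn, one_mul]
  have h5 := Real.norm_exp_I_mul_ofReal_sub_one_le (x := θ)
  rw [mul_comm] at h5
  refine h5.trans_lt ?_
  rw [Real.norm_eq_abs]
  have h6 : |θ| ≤ α := abs_le.2 hθ
  have h7 : α ≤ δ / 2 := min_le_left _ _
  linarith

lemma exists_leafDir_sep (hn : 1 ≤ n) (u : HarmonicPoly n) :
    ∃ δ > 0, ∀ k l, k ≠ l → δ ≤ dist (u.leafDir k) (u.leafDir l) := by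
  obtain ⟨δ, hδ, h⟩ := (finite_range u.leafDir).exists_pos_le_dist
  exact ⟨δ, hδ, fun k l hkl => h _ ⟨k, rfl⟩ _ ⟨l, rfl⟩ fun he => hkl (u.leafDir_injective hn he)⟩

lemma exists_radius (hn : 1 ≤ n) (u : HarmonicPoly n) {δ : ℝ} (hδ : 0 < δ) :
    ∃ R, ∀ z ∈ u.zeroSet, R < ‖z‖ → z ∈ u.regularSet ∧
      ∃ k, dist (z / (‖z‖ : ℂ)) (u.leafDir k) < δ := by
  have h1 := u.eventually_near_leafDir hn hδ
  rw [eventually_inf_principal] at h1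
  have h2 : ∀ᶠ z in Bornology.cobounded ℂ, z ∉ u.criticalSet :=
    Bornology.isBounded_def.1 (u.finite_criticalSet hn).isBounded
  obtain ⟨R, -, hR⟩ :=
    (Metric.hasBasis_cobounded_compl_closedBall (0 : ℂ)).eventually_iff.1 (h1.and h2)
  refine ⟨R, fun z hz hzR => ?_⟩
  have := hR (show z ∈ (Metric.closedBall (0 : ℂ) R)ᶜ by simpa using hzR)
  exact ⟨(mem_regularSet_or hz).resolve_right this.2, this.1 hz⟩

/-- Above height `M` the edge stays outside the disc of radius `R`, where there are no critical
points and all directions lie in disjoint balls around the leaf directions. So the upper tail from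
`z` neither ends at a node nor leaves the ball of `k`. -/
lemma highLeaf_of_near (hn : 1 ≤ n) (u : HarmonicPoly n) {δ R M : ℝ} (hδ : 0 < δ)
    (hsep : ∀ k l, k ≠ l → 3 * δ ≤ dist (u.leafDir k) (u.leafDir l))
    (hR : ∀ z ∈ u.zeroSet, R < ‖z‖ → z ∈ u.regularSet ∧
      ∃ k, dist (z / (‖z‖ : ℂ)) (u.leafDir k) < δ)
    (hR0 : 0 ≤ R) (hM : ∀ z, ‖z‖ ≤ R → u.ht z ≤ M) {z : ℂ} (hz : z ∈ u.zeroSet)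
    (hzM : M < u.ht z) {k : Fin (2 * n)} (hk : dist (z / (‖z‖ : ℂ)) (u.leafDir k) < δ) :
    z ∈ u.regularSet ∧ u.HighLeaf (u.edge z) k := by
  have hfar : ∀ v, M < u.ht v → R < ‖v‖ := fun v hv => not_le.1 fun h => (hM v h).not_gt hv
  have hzreg := (hR z hz (hfar z hzM)).1
  refine ⟨hzreg, ?_⟩
  rcases u.exists_high hn hzreg with ⟨p, hp, h⟩ | ⟨l, hl⟩
  · have h1 := IsHigh.lt (p := ⟨p, hp⟩) hzreg h (mem_edge_self hzreg)
    exact absurd hp (not_mem_criticalSet (hR p hp.1 (hfar p (hzM.trans h1))).1)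
  · suffices k = l by rw [this]; exact hl
    set T := {v | v ∈ u.edge z ∧ u.ht z ≤ u.ht v}
    have hT : ∀ v ∈ T, v ∈ u.zeroSet ∧ R < ‖v‖ := fun v hv =>
      ⟨(u.edge_subset z hv.1).1, hfar v (hzM.trans_le hv.2)⟩
    have himg : (fun z => z / (‖z‖ : ℂ)) '' T ⊆ Metric.ball (u.leafDir k) δ := by
      refine IsPreconnected.subset_left_of_subset_union
        (v := ⋃ l ∈ {l | l ≠ k}, Metric.ball (u.leafDir l) δ) Metric.isOpen_ball
        (isOpen_biUnion fun _ _ => Metric.isOpen_ball) ?_ ?_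
        ⟨_, ⟨z, ⟨mem_edge_self hzreg, le_rfl⟩, rfl⟩, hk⟩
        ((u.isPreconnected_tail _ _).image _ ?_)
      · rw [disjoint_iUnion₂_right]
        intro l hl
        apply Metric.ball_disjoint_ball
        linarith [hsep k l (fun h => hl h.symm)]
      · rintro _ ⟨v, hv, rfl⟩
        obtain ⟨l, hl⟩ := (hR v (hT v hv).1 (hT v hv).2).2
        by_cases hlk : l = k
        · left; rw [← hlk]; exact hl
        · right; exact mem_biUnion (show l ∈ {l | l ≠ k} from hlk) hl
      · intro v hv
        have hv0 : v ≠ 0 := norm_pos_iff.1 (hR0.trans_lt (hT v hv).2)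
        have : (‖v‖ : ℂ) ≠ 0 := by exact_mod_cast norm_ne_zero_iff.2 hv0
        exact (continuousAt_id.div (Complex.continuous_ofReal.comp continuous_norm).continuousAt
          this).continuousWithinAt
    have hne := u.neBot_highFilter hzreg
    have h3 : dist (u.leafDir l) (u.leafDir k) ≤ δ := by
      refine le_of_tendsto (hl.2.dist tendsto_const_nhds) ?_
      filter_upwards [u.eventually_highFilter_le hzreg (mem_edge_self hzreg)] with v hv
      exact (himg ⟨v, hv, rfl⟩ : dist _ _ < δ).le
    by_contra hne
    have := hsep l k fun h => hne h.symm
    linarith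

/-- A radius beyond which the zero set consists of the ends of edges going to the leaves. -/
lemma exists_radius_reaches (hn : 1 ≤ n) (u : HarmonicPoly n) {δ : ℝ} (hδ : 0 < δ)
    (hsep : ∀ k l, k ≠ l → 3 * δ ≤ dist (u.leafDir k) (u.leafDir l)) :
    ∃ R, 0 ≤ R ∧ ∀ z ∈ u.zeroSet, R < ‖z‖ → z ∈ u.regularSet ∧
      (∃ k, dist (z / (‖z‖ : ℂ)) (u.leafDir k) < δ) ∧
      ∀ k, dist (z / (‖z‖ : ℂ)) (u.leafDir k) < δ → u.Reaches (u.edge z) (Sum.inl k) := by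
  obtain ⟨R, hR⟩ := u.exists_radius hn hδ
  set R₀ := max R 0
  obtain ⟨M, hM⟩ := ((isCompact_closedBall (0 : ℂ) R₀).image
    u.continuous_eval.norm).bddAbove
  have hM' : ∀ z, ‖z‖ ≤ R₀ → ‖u.P.eval z‖ ≤ M := fun z hz => hM ⟨z, by simpa using hz, rfl⟩
  -- Beyond `R₁` the absolute height of a zero exceeds the bound `M` for |P| on the disc of radius
  -- `R₀`. According to the sign of the height, `highLeaf_of_near` applies to u or to -u.
  obtain ⟨R₁, -, hR₁⟩ := (Metric.hasBasis_cobounded_compl_closedBall (0 : ℂ)).eventually_iff.1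
    ((u.tendsto_norm_eval hn).eventually_gt_atTop M)
  have hR0 : ∀ z ∈ u.zeroSet, R₀ < ‖z‖ → z ∈ u.regularSet ∧
      ∃ k, dist (z / (‖z‖ : ℂ)) (u.leafDir k) < δ :=
    fun z hz h => hR z hz ((le_max_left _ _).trans_lt h)
  refine ⟨max R₀ R₁, (le_max_right R 0).trans (le_max_left _ _), fun z hz hzR => ?_⟩
  have hz1 := hR0 z hz ((le_max_left _ _).trans_lt hzR)
  refine ⟨hz1.1, hz1.2, fun k hk => ?_⟩
  have hzM : M < ‖u.P.eval z‖ := hR₁ (show z ∈ (Metric.closedBall (0 : ℂ) R₁)ᶜ by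
    simpa using (le_max_right _ _).trans_lt hzR)
  rw [eval_of_mem_zeroSet hz, norm_mul, Complex.norm_I, mul_one, Complex.norm_real,
    Real.norm_eq_abs] at hzM
  rw [reaches_iff hn hz1.1]
  rcases lt_abs.1 hzM with h | h
  · left
    exact (u.highLeaf_of_near hn hδ hsep hR0 (le_max_right _ _)
      (fun z hz => ((le_abs_self _).trans (Complex.abs_im_le_norm _)).trans (hM' z hz)) hz h hk).2
  · right
    have := u.neg.highLeaf_of_near hn hδ hsep (R := R₀) (M := M)
      (by rw [neg_zeroSet, neg_regularSet]; exact hR0) (le_max_right _ _)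
      (fun z hz => by
        rw [neg_ht]
        exact ((neg_le_abs _).trans (Complex.abs_im_le_norm _)).trans (hM' z hz))
      (z := z) (k := k) (by rwa [neg_zeroSet]) (by rwa [neg_ht]) hk
    rw [neg_edge] at this
    exact this.2

lemma exists_edge_reaches_leaf (hn : 1 ≤ n) (u : HarmonicPoly n) (k : Fin (2 * n)) :
    ∃ z ∈ u.regularSet, u.Reaches (u.edge z) (Sum.inl k) := by
  obtain ⟨δ, hδ, hsep⟩ := u.exists_leafDir_sep hn
  obtain ⟨R, hR0, hR⟩ := u.exists_radius_reaches hn (δ := δ / 3) (by positivity)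
    (fun k l h => by linarith [hsep k l h])
  obtain ⟨r, ⟨z, hz, hzr, hzk⟩, hrR⟩ := ((u.eventually_exists_zero_near_leafDir hn k
    (δ := δ / 3) (by positivity)).and (eventually_gt_atTop R)).exists
  have := hR z hz (hzr ▸ hrR)
  exact ⟨z, this.1, this.2.2 k hzk⟩

/-- Every leaf has exactly one neighbour. -/
lemma existsUnique_adj_leaf (hn : 1 ≤ n) (u : HarmonicPoly n) (k : Fin (2 * n)) :
    ∃! y, u.forestGraph.Adj (Sum.inl k) y := by
  obtain ⟨z, hz, hzk⟩ := u.exists_edge_reaches_leaf hn k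
  obtain ⟨x, y, hxy, -, -, hr⟩ := u.exists_ends hn hz
  have h1 : ∃ v, Sum.inl k ≠ v ∧ u.Reaches (u.edge z) v ∧
      ∀ w, u.Reaches (u.edge z) w → w = Sum.inl k ∨ w = v := by
    rcases (hr _).1 hzk with h | h
    · refine ⟨y, h ▸ hxy, (hr y).2 (Or.inr rfl), fun w hw => ?_⟩
      rw [h]; exact (hr w).1 hw
    · refine ⟨x, h ▸ hxy.symm, (hr x).2 (Or.inl rfl), fun w hw => ?_⟩
      rw [h]; exact ((hr w).1 hw).symm
  obtain ⟨v, hv, hv1, hv2⟩ := h1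
  refine ⟨v, adj_iff.2 ⟨hv, z, hz, hzk, hv1⟩, fun w hw => ?_⟩
  obtain ⟨hne, z', hz', h1, h2⟩ := adj_iff.1 hw
  rw [u.edge_eq_of_reaches_leaf hn hz' hz h1 hzk] at h2
  exact (hv2 w h2).resolve_left hne.symm

end HarmonicPoly

end

/-! ### Counting the edges at a critical point -/

section

open Set Filter Topology

namespace HarmonicPoly

variable {n : ℕ}

lemma rootMultiplicity_sub_C (hn : 1 ≤ n) (u : HarmonicPoly n) (p : ℂ) :
    (u.P - Polynomial.C (u.P.eval p)).rootMultiplicity p = u.multiplicity p + 1 := by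
  set Q := u.P - Polynomial.C (u.P.eval p) with hQ
  have hroot : Q.IsRoot p := by simp [hQ]
  have hQ0 : Q ≠ 0 := by
    intro h
    have h2 := congrArg Polynomial.derivative h
    rw [hQ, Polynomial.derivative_sub, Polynomial.derivative_C, sub_zero] at h2
    exact u.derivative_ne_zero hn (by simpa using h2)
  have h1 := Polynomial.derivative_rootMultiplicity_of_root hroot
  have h2 : Polynomial.derivative Q = Polynomial.derivative u.P := by simp [hQ]
  rw [h2] at h1
  have h3 : 0 < Q.rootMultiplicity p := (Polynomial.rootMultiplicity_pos hQ0).2 hroot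
  rw [multiplicity]; omega

/-- In a local coordinate `e` at `p`, the polynomial is `P p + e ^ (m + 1)`. -/
lemma exists_local_power (hn : 1 ≤ n) (u : HarmonicPoly n) (p : ℂ) :
    ∃ e : OpenPartialHomeomorph ℂ ℂ, p ∈ e.source ∧ e p = 0 ∧ ∀ z ∈ e.source,
      u.P.eval z = u.P.eval p + e z ^ (u.multiplicity p + 1) ∧
      (z ≠ p → u.P.derivative.eval z ≠ 0) := by
  set Q := u.P - Polynomial.C (u.P.eval p) with hQ
  set k := u.multiplicity p + 1 with hk
  have hk0 : (k : ℂ) ≠ 0 := Nat.cast_ne_zero.2 (Nat.succ_ne_zero _)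
  have hQ0 : Q ≠ 0 := by
    intro h
    have h1 := u.rootMultiplicity_sub_C hn p
    rw [← hQ, h, Polynomial.rootMultiplicity_zero] at h1
    omega
  obtain ⟨g, hg, hgp⟩ := Polynomial.exists_eq_pow_rootMultiplicity_mul_and_not_dvd Q hQ0 p
  rw [hQ, u.rootMultiplicity_sub_C hn p, ← hQ, ← hk] at hg
  have hgp' : g.eval p ≠ 0 := by rwa [Polynomial.dvd_iff_isRoot] at hgp
  obtain ⟨c, hc⟩ := IsAlgClosed.exists_pow_nat_eq (g.eval p) (Nat.succ_pos (u.multiplicity p))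
  rw [← Nat.succ_eq_add_one] at hk
  rw [← hk] at hc
  have hc0 : c ≠ 0 := by
    rintro rfl
    rw [zero_pow (by omega)] at hc
    exact hgp' hc.symm
  -- A k-th root of P - P(p) = (z - p)^k g: near `p` the quotient g / g(p) is close to 1, so its
  -- principal logarithm is holomorphic, and c^k = g(p).
  set h : ℂ → ℂ := fun z => (z - p) * (c * Complex.exp (Complex.log (g.eval z / g.eval p) / k))
    with hh
  have hr : ∃ d, HasStrictDerivAt
      (fun z => c * Complex.exp (Complex.log (g.eval z / g.eval p) / k)) d p := by
    have h1 := (g.hasStrictDerivAt p).div_const (g.eval p)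
    have h2 := h1.clog (by rw [div_self hgp']; exact Complex.one_mem_slitPlane)
    exact ⟨_, ((h2.div_const (k : ℂ)).cexp).const_mul c⟩
  obtain ⟨d, hd⟩ := hr
  have hder : HasStrictDerivAt h c p := by
    have h0 : HasStrictDerivAt (fun z : ℂ => z - p) 1 p := (hasStrictDerivAt_id p).sub_const p
    have h1 := h0.mul hd
    have h2 : 1 * (c * Complex.exp (Complex.log (g.eval p / g.eval p) / k)) + (p - p) * d = c := by
      rw [div_self hgp', Complex.log_one, zero_div, Complex.exp_zero]; ring
    rw [h2] at h1
    exact h1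
  set e := (hder.hasStrictFDerivAt_equiv hc0).toOpenPartialHomeomorph h with he
  have hcoe : ∀ x, e x = h x := fun x => rfl
  have hpe : p ∈ e.source := (hder.hasStrictFDerivAt_equiv hc0).mem_toOpenPartialHomeomorph_source
  -- Within `O` the factor `g` has no zeros and no critical point of P other than `p` occurs.
  set O : Set ℂ := {z | g.eval z ≠ 0} ∩ ({z | u.P.derivative.IsRoot z} \ {p})ᶜ with hO
  have hOopen : IsOpen O := by
    refine (isOpen_ne_fun g.continuous continuous_const).inter ?_
    exact ((Polynomial.finite_setOfPred_isRoot (u.derivative_ne_zero hn)).sdiff).isClosed.isOpen_compl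
  have hpO : p ∈ O := ⟨hgp', fun h => h.2 rfl⟩
  refine ⟨e.restrOpen O hOopen, ?_, ?_, ?_⟩
  · rw [OpenPartialHomeomorph.restrOpen_source]; exact ⟨hpe, hpO⟩
  · show h p = 0
    simp [hh]
  · intro z hz
    rw [OpenPartialHomeomorph.restrOpen_source] at hz
    constructor
    · show _ = _ + h z ^ k
      have h1 : u.P.eval z = u.P.eval p + Q.eval z := by simp [hQ]
      have hgz : g.eval z / g.eval p ≠ 0 := div_ne_zero hz.2.1 hgp'
      rw [h1, hg, hh]
      simp only [Polynomial.eval_mul, Polynomial.eval_pow, Polynomial.eval_sub, Polynomial.eval_X,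
        Polynomial.eval_C]
      rw [mul_pow, mul_pow, ← Complex.exp_nat_mul, mul_div_cancel₀ _ hk0, Complex.exp_log hgz, hc]
      field_simp
    · intro hzp h0
      exact hz.2.2 ⟨h0, hzp⟩

lemma isHigh_of_mem_closure (hn : 1 ≤ n) (u : HarmonicPoly n) {z w : ℂ} (hz : z ∈ u.regularSet)
    {p : u.criticalSet} (hp : (p : ℂ) ∈ closure (u.edge z)) (hw : w ∈ u.edge z)
    (h : u.ht w < u.ht p) : u.IsHigh (u.edge z) (Sum.inr p) := by
  have h1 : u.Reaches (u.edge z) (Sum.inr p) := hp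
  rw [reaches_iff hn hz] at h1
  refine h1.resolve_right fun h2 => ?_
  exact lt_asymm h (h2.lt hz hw)

/-- The number of edges that end at a node from below. -/
lemma ncard_high_edges (hn : 1 ≤ n) (u : HarmonicPoly n) (p : u.criticalSet) :
    {E | ∃ z ∈ u.regularSet, E = u.edge z ∧ u.IsHigh E (Sum.inr p)}.ncard =
      u.multiplicity p + 1 := by
  classical
  obtain ⟨e, hpe, hep, he⟩ := u.exists_local_power hn p
  set k := u.multiplicity p + 1 with hk
  have hk0 : k ≠ 0 := Nat.succ_ne_zero _
  have hPp : u.P.eval (p : ℂ) = u.ht p * Complex.I := eval_of_mem_zeroSet p.2.1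
  have h0t : (0 : ℂ) ∈ e.target := hep ▸ e.map_source hpe
  have hsymm0 : e.symm 0 = p := by rw [← hep]; exact e.left_inv hpe
  obtain ⟨ρ, hρ, hball⟩ := Metric.mem_nhds_iff.1 (e.open_target.mem_nhds h0t)
  -- At height t below p the equation for the coordinate is e^k = -(h(p) - t) i. Its solutions are
  -- `rt t * ω` with ω^k = -i, so each of the k roots ω yields one arc ending at p.
  set W := (Polynomial.nthRoots k (-Complex.I)).toFinset with hW
  have hmemW : ∀ ω, ω ∈ W ↔ ω ^ k = -Complex.I := by
    intro ω; rw [hW, Multiset.mem_toFinset, Polynomial.mem_nthRoots (Nat.pos_of_ne_zero hk0)]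
  have hcardW : W.card = k := by
    have hprim := Complex.isPrimitiveRoot_exp k hk0
    rw [hW, Multiset.toFinset_card_of_nodup
      (hprim.nthRoots_nodup (neg_ne_zero.2 Complex.I_ne_zero)), hprim.card_nthRoots, if_pos]
    obtain ⟨α, hα⟩ := IsAlgClosed.exists_pow_nat_eq (-Complex.I) (Nat.pos_of_ne_zero hk0)
    exact ⟨α, hα⟩
  have hnormW : ∀ ω ∈ W, ‖ω‖ = 1 := by
    intro ω hω
    have := congrArg norm ((hmemW ω).1 hω)
    rw [norm_pow, norm_neg, Complex.norm_I] at this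
    exact (pow_eq_one_iff_of_nonneg (norm_nonneg _) hk0).1 this
  -- Heights within ρ^k of h(p) correspond to |e| < ρ, where the chart is invertible.
  set ε := ρ ^ k with hε
  have hε0 : 0 < ε := by positivity
  set rt : ℝ → ℝ := fun t => (u.ht p - t) ^ (1 / k : ℝ) with hrt
  have hkr : (k : ℝ) ≠ 0 := by exact_mod_cast hk0
  have hrtpow : ∀ t, t < u.ht p → rt t ^ k = u.ht p - t := by
    intro t ht
    rw [hrt]; simp only
    rw [← Real.rpow_natCast, ← Real.rpow_mul (by linarith), one_div, inv_mul_cancel₀ hkr,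
      Real.rpow_one]
  have hrt0 : ∀ t, t < u.ht p → 0 < rt t := fun t ht => Real.rpow_pos_of_pos (by linarith) _
  have hrtlt : ∀ t, t ∈ Ioo (u.ht p - ε) (u.ht p) → rt t < ρ := by
    intro t ht
    apply lt_of_pow_lt_pow_left₀ k hρ.le
    rw [hrtpow t ht.2]; linarith [ht.1]
  have hrtc : Continuous rt := by
    rw [hrt]
    exact (continuous_const.sub continuous_id).rpow_const fun _ => Or.inr (by positivity)
  set s : ℂ → ℝ → ℂ := fun ω t => e.symm (rt t * ω) with hs
  have htgt : ∀ ω ∈ W, ∀ t ∈ Ioo (u.ht p - ε) (u.ht p), (rt t * ω : ℂ) ∈ e.target := by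
    intro ω hω t ht
    apply hball
    rw [mem_ball_zero_iff, norm_mul, hnormW ω hω, mul_one, Complex.norm_real,
      Real.norm_of_nonneg (hrt0 t ht.2).le]
    exact hrtlt t ht
  have hlift : ∀ ω ∈ W, u.IsLift (Ioo (u.ht p - ε) (u.ht p)) (s ω) := by
    intro ω hω
    have hcont : Continuous fun t : ℝ => (rt t * ω : ℂ) :=
      (Complex.continuous_ofReal.comp hrtc).mul continuous_const
    refine ⟨e.continuousOn_symm.comp hcont.continuousOn fun t ht => htgt ω hω t ht, ?_, ?_⟩
    · intro t ht
      rw [(he _ (e.map_target (htgt ω hω t ht))).1, e.right_inv (htgt ω hω t ht), mul_pow, (hmemW ω).1 hω, ← Complex.ofReal_pow,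
        hrtpow t ht.2, hPp]
      push_cast; ring
    · intro t ht
      apply (he _ (e.map_target (htgt ω hω t ht))).2
      intro hcon
      have h1 : e (e.symm (rt t * ω)) = 0 := by rw [← hep]; exact congrArg e hcon
      rw [e.right_inv (htgt ω hω t ht)] at h1
      have h2 := congrArg norm h1
      rw [norm_mul, hnormW ω hω, mul_one, Complex.norm_real, norm_zero, norm_eq_zero] at h2
      exact (hrt0 t ht.2).ne' h2
  set t₀ := u.ht p - ε / 2 with ht₀
  have ht₀mem : t₀ ∈ Ioo (u.ht p - ε) (u.ht p) := ⟨by linarith, by linarith⟩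
  have hmem : ∀ ω ∈ W, ∀ t ∈ Ioo (u.ht p - ε) (u.ht p), s ω t ∈ u.edge (s ω t₀) := by
    intro ω hω t ht
    have hl := hlift ω hω
    refine OnLift.mem_edge ⟨_, s ω, hl, isPreconnected_Ioo, isOpen_Ioo, ?_, ?_, ?_, ?_⟩
    · rwa [hl.ht ht₀mem]
    · rwa [hl.ht ht]
    · rw [hl.ht ht₀mem]
    · rw [hl.ht ht]
  have hhigh : ∀ ω ∈ W, u.IsHigh (u.edge (s ω t₀)) (Sum.inr p) := by
    intro ω hω
    have hl := hlift ω hω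
    refine u.isHigh_of_mem_closure hn (hl.mem ht₀mem) (w := s ω t₀) ?_ (hmem ω hω _ ht₀mem)
      (by rw [hl.ht ht₀mem]; exact ht₀mem.2)
    have hlim : Tendsto (s ω) (𝓝[<] (u.ht p)) (𝓝 p) := by
      have h1 : Tendsto (fun t : ℝ => (rt t * ω : ℂ)) (𝓝[<] (u.ht p)) (𝓝 0) := by
        have hcont : Continuous fun t : ℝ => (rt t * ω : ℂ) :=
          (Complex.continuous_ofReal.comp hrtc).mul continuous_const
        have := hcont.tendsto (u.ht p)
        have h0 : rt (u.ht p) = 0 := by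
          rw [hrt]; simp only
          rw [sub_self, Real.zero_rpow (by positivity)]
        rw [h0, Complex.ofReal_zero, zero_mul] at this
        exact this.mono_left nhdsWithin_le_nhds
      have h2 := e.continuousAt_symm h0t
      rw [ContinuousAt, hsymm0] at h2
      exact h2.comp h1
    refine mem_closure_of_tendsto hlim ?_
    filter_upwards [Ioo_mem_nhdsLT (show u.ht p - ε < u.ht p by linarith)] with t ht
      using hmem ω hω t ht
  have himage : {E | ∃ z ∈ u.regularSet, E = u.edge z ∧ u.IsHigh E (Sum.inr p)} =
      (fun ω => u.edge (s ω t₀)) '' (W : Set ℂ) := by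
    ext E
    constructor
    · rintro ⟨z, hz, rfl, hzE⟩
      have hne := u.neBot_highFilter hz
      have h1 : u.highFilter (u.edge z) ≤ 𝓝 (p : ℂ) := hzE
      have h2 : ∀ᶠ v in 𝓝 (p : ℂ), u.ht p - ε < u.ht v :=
        u.continuous_ht.continuousAt.eventually (lt_mem_nhds (by linarith))
      obtain ⟨v, ⟨hv1, hv2⟩, hv3⟩ := (((show ∀ᶠ v in u.highFilter (u.edge z), v ∈ e.source from
        h1 (e.open_source.mem_nhds hpe)).and (h1 h2)).and (u.edge_mem_highFilter hz)).exists
      have hv4 := hzE.lt hz hv3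
      have hvI : u.ht v ∈ Ioo (u.ht p - ε) (u.ht p) := ⟨hv2, hv4⟩
      have hr0 := hrt0 _ hv4
      have hrc : (rt (u.ht v) : ℂ) ≠ 0 := by exact_mod_cast hr0.ne'
      have hev : e v ^ k = -((u.ht p - u.ht v : ℝ) : ℂ) * Complex.I := by
        have h3 := (he v hv1).1
        rw [eval_of_mem_zeroSet (u.edge_subset z hv3).1, hPp] at h3
        rw [eq_sub_of_add_eq' h3.symm]; push_cast; ring
      set ω := e v / rt (u.ht v) with hω
      have hωW : ω ∈ W := by
        rw [hmemW, hω, div_pow, hev, ← Complex.ofReal_pow, hrtpow _ hv4]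
        have : ((u.ht p - u.ht v : ℝ) : ℂ) ≠ 0 := by
          exact_mod_cast (sub_pos.2 hv4).ne'
        field_simp
      refine ⟨ω, hωW, ?_⟩
      have hv5 : s ω (u.ht v) = v := by
        rw [hs]; simp only
        rw [hω, mul_div_cancel₀ _ hrc]
        exact e.left_inv hv1
      have h6 := hmem ω hωW _ hvI
      rw [hv5] at h6
      simp only
      rw [← edge_eq_of_mem h6, ← edge_eq_of_mem hv3]
    · rintro ⟨ω, hω, rfl⟩
      exact ⟨s ω t₀, (hlift ω hω).mem ht₀mem, rfl, hhigh ω hω⟩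
  rw [himage, InjOn.ncard_image, ncard_coe_finset, hcardW]
  intro ω hω ω' hω' hE
  simp only at hE
  have h1 := mem_edge_self ((hlift ω hω).mem ht₀mem)
  have h2 := mem_edge_self ((hlift ω' hω').mem ht₀mem)
  rw [hE] at h1
  have h3 := u.injOn_ht_edge _ h1 h2
    (by rw [(hlift ω hω).ht ht₀mem, (hlift ω' hω').ht ht₀mem])
  have h4 := e.symm.injOn (htgt ω hω _ ht₀mem) (htgt ω' hω' _ ht₀mem) h3
  have hrc : (rt t₀ : ℂ) ≠ 0 := by exact_mod_cast (hrt0 _ ht₀mem.2).ne'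
  exact mul_left_cancel₀ hrc h4

/-- The number of edges at a node. -/
lemma ncard_edges_at_node (hn : 1 ≤ n) (u : HarmonicPoly n) (p : u.criticalSet) :
    {E | ∃ z ∈ u.regularSet, E = u.edge z ∧ u.Reaches E (Sum.inr p)}.ncard =
      2 * (u.multiplicity p + 1) := by
  have h1 := u.ncard_high_edges hn p
  -- The edges that end at p from above are the ones that end there from below for -u.
  have h2 := u.neg.ncard_high_edges hn ⟨p, by rw [neg_criticalSet]; exact p.2⟩
  simp only [neg_regularSet, neg_edge, neg_multiplicity] at h2
  have h2' : {E | ∃ z ∈ u.regularSet, E = u.edge z ∧ u.IsLow E (Sum.inr p)}.ncard =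
      u.multiplicity p + 1 := h2
  have hU : {E | ∃ z ∈ u.regularSet, E = u.edge z ∧ u.Reaches E (Sum.inr p)} =
      {E | ∃ z ∈ u.regularSet, E = u.edge z ∧ u.IsHigh E (Sum.inr p)} ∪
      {E | ∃ z ∈ u.regularSet, E = u.edge z ∧ u.IsLow E (Sum.inr p)} := by
    ext E
    constructor
    · rintro ⟨z, hz, rfl, h⟩
      rcases (reaches_iff hn hz).1 h with h | h
      · exact Or.inl ⟨z, hz, rfl, h⟩
      · exact Or.inr ⟨z, hz, rfl, h⟩
    · rintro (⟨z, hz, rfl, h⟩ | ⟨z, hz, rfl, h⟩)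
      · exact ⟨z, hz, rfl, (reaches_iff hn hz).2 (Or.inl h)⟩
      · exact ⟨z, hz, rfl, (reaches_iff hn hz).2 (Or.inr h)⟩
  rw [hU, ncard_union_eq ?_ (finite_of_ncard_pos (by omega)) (finite_of_ncard_pos (by omega)), h1,
    h2', two_mul]
  rw [Set.disjoint_left]
  rintro E ⟨z, hz, rfl, h⟩ ⟨w, hw, -, h'⟩
  exact h.ne_of_isLow hn hz h' rfl

lemma one_le_multiplicity (hn : 1 ≤ n) (u : HarmonicPoly n) (p : u.criticalSet) :
    1 ≤ u.multiplicity p :=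
  (Polynomial.rootMultiplicity_pos (u.derivative_ne_zero hn)).2 (mem_criticalSet_iff.1 p.2).2

end HarmonicPoly

end

/-! ### Disjoint connected sets do not interlace at infinity -/

section

open Set Filter Topology

/-- The quotient `(ζ - z) / (ζ - w)` has a continuous logarithm on `K` that vanishes at infinity. -/
def LogRel (K : Set ℂ) (z w : ℂ) : Prop :=
  ∃ l : ℂ → ℂ, ContinuousOn l K ∧ (∀ ζ ∈ K, Complex.exp (l ζ) = (ζ - z) / (ζ - w)) ∧
    Tendsto l (Bornology.cobounded ℂ ⊓ 𝓟 K) (𝓝 0)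

lemma LogRel.symm {K : Set ℂ} {z w : ℂ} (h : LogRel K z w) : LogRel K w z := by
  obtain ⟨l, h1, h2, h3⟩ := h
  refine ⟨fun ζ => -l ζ, h1.neg, fun ζ hζ => ?_, by simpa using h3.neg⟩
  rw [Complex.exp_neg, h2 ζ hζ, inv_div]

lemma LogRel.trans {K : Set ℂ} {z w v : ℂ} (hw : w ∉ K) (h : LogRel K z w) (h' : LogRel K w v) :
    LogRel K z v := by
  obtain ⟨l, h1, h2, h3⟩ := h
  obtain ⟨l', h1', h2', h3'⟩ := h'
  refine ⟨fun ζ => l ζ + l' ζ, h1.add h1', fun ζ hζ => ?_, by simpa using h3.add h3'⟩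
  have : ζ - w ≠ 0 := sub_ne_zero.2 fun h => hw (h ▸ hζ)
  rw [Complex.exp_add, h2 ζ hζ, h2' ζ hζ, div_mul_div_cancel₀ this]

/-- If `w` is closer to `z` than `K` is, then (ζ - w) / (ζ - z) = 1 + (z - w) / (ζ - z) stays in the
unit disc around 1 and tends to 1 at infinity; the principal logarithm will do. -/
lemma eventually_logRel {K : Set ℂ} (hK : IsClosed K) {z : ℂ} (hz : z ∉ K) :
    ∀ᶠ w in 𝓝 z, LogRel K z w := by
  obtain ⟨r, hr, hball⟩ := Metric.isOpen_iff.1 hK.isOpen_compl z hz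
  filter_upwards [Metric.ball_mem_nhds z hr] with w hw
  have hd : ∀ ζ ∈ K, r ≤ ‖ζ - z‖ := by
    intro ζ hζ
    by_contra h
    exact hball (by rw [Metric.mem_ball, dist_eq_norm]; exact not_le.1 h) hζ
  have hlt : ∀ ζ ∈ K, ‖(z - w) / (ζ - z)‖ < 1 := by
    intro ζ hζ
    rw [norm_div, div_lt_one (hr.trans_le (hd ζ hζ))]
    refine lt_of_lt_of_le ?_ (hd ζ hζ)
    rw [Metric.mem_ball, dist_comm, dist_eq_norm] at hw
    exact hw
  have hne : ∀ ζ ∈ K, ζ - z ≠ 0 := fun ζ hζ => norm_pos_iff.1 (hr.trans_le (hd ζ hζ))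
  apply LogRel.symm
  refine ⟨fun ζ => Complex.log (1 + (z - w) / (ζ - z)), ?_, ?_, ?_⟩
  · intro ζ hζ
    refine ContinuousWithinAt.clog ?_ (Complex.mem_slitPlane_of_norm_lt_one (hlt ζ hζ))
    refine ContinuousAt.continuousWithinAt ?_
    exact continuousAt_const.add (continuousAt_const.div (by fun_prop) (hne ζ hζ))
  · intro ζ hζ
    rw [Complex.exp_log (Complex.slitPlane_ne_zero
      (Complex.mem_slitPlane_of_norm_lt_one (hlt ζ hζ)))]
    have := hne ζ hζ
    field_simp
    ring
  · have h1 : Tendsto (fun ζ : ℂ => (z - w) * (ζ - z)⁻¹) (Bornology.cobounded ℂ) (𝓝 0) := by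
      have h2 : Tendsto (fun ζ : ℂ => ζ - z) (Bornology.cobounded ℂ) (Bornology.cobounded ℂ) := by
        simp [sub_eq_add_neg]
      simpa using (tendsto_inv₀_cobounded.comp h2).const_mul (z - w)
    have h3 : Tendsto (fun ζ : ℂ => Complex.log (1 + (z - w) / (ζ - z)))
        (Bornology.cobounded ℂ) (𝓝 (Complex.log (1 + 0))) := by
      refine Tendsto.clog ?_ (by simp)
      simpa [div_eq_mul_inv] using h1.const_add 1
    rw [add_zero, Complex.log_one] at h3
    exact h3.mono_left inf_le_left

lemma logRel_of_isPreconnected {K S : Set ℂ} (hK : IsClosed K) (hS : IsPreconnected S)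
    (hd : Disjoint K S) {z w : ℂ} (hz : z ∈ S) (hw : w ∈ S) : LogRel K z w := by
  have hnot : ∀ x ∈ S, x ∉ K := fun x hx hxK => Set.disjoint_left.1 hd hxK hx
  exact hS.induction₂ (LogRel K)
    (fun x hx => mem_nhdsWithin_of_mem_nhds (eventually_logRel hK (hnot x hx)))
    (fun x y z _ hy _ h1 h2 => h1.trans (hnot y hy) h2) (fun x y _ _ h => h.symm) hz hw

/-- Two values of `f` differ by an integer multiple of 2πi, so they coincide as soon as their
distance is less than 1; thus `f` is locally constant. -/
lemma IsPreconnected.eq_of_exp_eq {K : Set ℂ} (hK : IsPreconnected K) {f : ℂ → ℂ}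
    (hf : ContinuousOn f K) {a : ℂ} (ha : ∀ ζ ∈ K, Complex.exp (f ζ) = a) {z w : ℂ} (hz : z ∈ K)
    (hw : w ∈ K) : f z = f w := by
  refine hK.induction₂ (fun x y => f x = f y) ?_ (fun _ _ _ _ _ _ h1 h2 => h1.trans h2)
    (fun _ _ _ _ h => h.symm) hz hw
  intro x hx
  have h1 : ∀ᶠ y in 𝓝[K] x, dist (f y) (f x) < 1 :=
    Metric.tendsto_nhds.1 (hf x hx) 1 one_pos
  filter_upwards [h1, self_mem_nhdsWithin] with y hy hyK
  obtain ⟨m, hm⟩ := Complex.exp_eq_exp_iff_exists_int.1 ((ha y hyK).trans (ha x hx).symm)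
  rw [hm, dist_eq_norm, add_sub_cancel_left, norm_mul, norm_mul, norm_mul, Complex.norm_I,
    mul_one, Complex.norm_real, Complex.norm_intCast, Real.norm_of_nonneg Real.pi_pos.le] at hy
  simp only [Complex.norm_ofNat] at hy
  have hm0 : m = 0 := by
    by_contra hne
    have : (1 : ℝ) ≤ |(m : ℝ)| := by exact_mod_cast Int.one_le_abs hne
    nlinarith [Real.pi_gt_three]
  rw [hm, hm0]; simp

/-- Applied to x = (ζ - z) / β: if -x misses the slit plane, then ζ lies on the ray from z in
direction β. Membership in the slit plane therefore expresses that the ray is avoided. -/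
lemma exists_real_of_neg_notMem_slitPlane {x : ℂ} (h : -x ∉ Complex.slitPlane) :
    ∃ t : ℝ, 0 ≤ t ∧ x = t := by
  rw [Complex.mem_slitPlane_iff, not_or, not_lt, not_not, Complex.neg_re, Complex.neg_im] at h
  exact ⟨x.re, by linarith [h.1], Complex.ext (by simp) (by simpa using h.2)⟩

lemma neg_div_mem_slitPlane {α β : ℂ} (hα : ‖α‖ = 1) (hβ : ‖β‖ = 1) (h : α ≠ β) :
    -(α / β) ∈ Complex.slitPlane := by
  by_contra hcon
  obtain ⟨t, h1, h3⟩ := exists_real_of_neg_notMem_slitPlane hcon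
  have h4 : ‖α / β‖ = 1 := by rw [norm_div, hα, hβ, div_one]
  rw [h3, Complex.norm_real, Real.norm_of_nonneg h1] at h4
  rw [h4, Complex.ofReal_one] at h3
  have hβ0 : β ≠ 0 := norm_pos_iff.1 (by rw [hβ]; exact one_pos)
  exact h ((div_eq_one_iff_eq hβ0).1 h3)

lemma tendsto_arg_neg_sub_div {F : Filter ℂ} (hF : F ≤ Bornology.cobounded ℂ) {α β z : ℂ}
    (hα : ‖α‖ = 1) (hβ : ‖β‖ = 1) (h : α ≠ β)
    (hdir : Tendsto (fun ζ => ζ / (‖ζ‖ : ℂ)) F (𝓝 α)) :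
    Tendsto (fun ζ => Complex.arg (-((ζ - z) / β))) F (𝓝 (Complex.arg (-(α / β)))) := by
  have h1 : Tendsto (fun ζ : ℂ => (ζ - z) / (‖ζ‖ : ℂ)) F (𝓝 α) := by
    have h2 : Tendsto (fun ζ : ℂ => z / (‖ζ‖ : ℂ)) F (𝓝 0) := by
      have h3 : Tendsto (fun ζ : ℂ => ‖z‖ / ‖ζ‖) F (𝓝 0) :=
        (tendsto_const_nhds.div_atTop tendsto_norm_cobounded_atTop).mono_left hF
      rw [tendsto_zero_iff_norm_tendsto_zero]
      simpa using h3
    simpa [sub_div] using hdir.sub h2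
  have h4 := (Complex.continuousAt_arg (neg_div_mem_slitPlane hα hβ h)).tendsto.comp
    ((h1.div_const β).neg)
  refine h4.congr' ?_
  filter_upwards [hF HarmonicPoly.eventually_cobounded_ne_zero] with ζ hζ
  have hpos : 0 < ‖ζ‖⁻¹ := inv_pos.2 (norm_pos_iff.2 hζ)
  simp only [Function.comp]
  rw [show -((ζ - z) / (‖ζ‖ : ℂ) / β) = ((‖ζ‖⁻¹ : ℝ) : ℂ) * -((ζ - z) / β) by
    push_cast; ring, Complex.arg_real_mul _ hpos]

/-- If `z` and `w` are joined off the connected set `K` and the rays from `z` and `w` in directions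
`β` and `δ` avoid `K`, then the two asymptotic directions of `K` lie on the same side of the rays. -/
lemma arg_sub_arg_eq_of_logRel {K : Set ℂ} (hK : IsPreconnected K) {z w β δ α κ : ℂ}
    (hrel : LogRel K z w) (hzK : ∀ ζ ∈ K, -((ζ - z) / β) ∈ Complex.slitPlane)
    (hwK : ∀ ζ ∈ K, -((ζ - w) / δ) ∈ Complex.slitPlane) (hβ : ‖β‖ = 1) (hδ : ‖δ‖ = 1)
    (hα : ‖α‖ = 1) (hκ : ‖κ‖ = 1) (hαβ : α ≠ β) (hαδ : α ≠ δ) (hκβ : κ ≠ β) (hκδ : κ ≠ δ)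
    {F G : Filter ℂ} [F.NeBot] [G.NeBot] (hF : F ≤ Bornology.cobounded ℂ ⊓ 𝓟 K)
    (hG : G ≤ Bornology.cobounded ℂ ⊓ 𝓟 K) (hFα : Tendsto (fun ζ => ζ / (‖ζ‖ : ℂ)) F (𝓝 α))
    (hGκ : Tendsto (fun ζ => ζ / (‖ζ‖ : ℂ)) G (𝓝 κ)) :
    Complex.arg (-(α / β)) - Complex.arg (-(α / δ)) =
      Complex.arg (-(κ / β)) - Complex.arg (-(κ / δ)) := by
  obtain ⟨l, hl1, hl2, hl3⟩ := hrel
  -- `ψ` is continuous on `K` and exp ψ is the constant δ / β, so `ψ` is constant on the connected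
  -- set `K`. As l tends to 0, the limits of Im ψ in the directions α and κ are the two sides of the
  -- claim.
  set ψ : ℂ → ℂ := fun ζ => Complex.log (-((ζ - z) / β)) - Complex.log (-((ζ - w) / δ)) - l ζ
    with hψ
  have hβ0 : β ≠ 0 := norm_pos_iff.1 (by rw [hβ]; exact one_pos)
  have hδ0 : δ ≠ 0 := norm_pos_iff.1 (by rw [hδ]; exact one_pos)
  have hc : ContinuousOn ψ K := by
    refine ((ContinuousOn.clog ?_ hzK).sub (ContinuousOn.clog ?_ hwK)).sub hl1
    · fun_prop
    · fun_prop
  have hexp : ∀ ζ ∈ K, Complex.exp (ψ ζ) = δ / β := by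
    intro ζ hζ
    have h1 := Complex.slitPlane_ne_zero (hzK ζ hζ)
    have h2 := Complex.slitPlane_ne_zero (hwK ζ hζ)
    have h3 : ζ - z ≠ 0 := fun h => h1 (by simp [h])
    have h4 : ζ - w ≠ 0 := fun h => h2 (by simp [h])
    rw [hψ]; simp only
    rw [Complex.exp_sub, Complex.exp_sub, Complex.exp_log h1, Complex.exp_log h2, hl2 ζ hζ]
    field_simp
  have hlim : ∀ {F : Filter ℂ} {α : ℂ}, F ≤ Bornology.cobounded ℂ ⊓ 𝓟 K → ‖α‖ = 1 → α ≠ β →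
      α ≠ δ → Tendsto (fun ζ => ζ / (‖ζ‖ : ℂ)) F (𝓝 α) → Tendsto (fun ζ => (ψ ζ).im) F
      (𝓝 (Complex.arg (-(α / β)) - Complex.arg (-(α / δ)))) := by
    intro F α hF hα h1 h2 hdir
    have e1 := tendsto_arg_neg_sub_div (z := z) (hF.trans inf_le_left) hα hβ h1 hdir
    have e2 := tendsto_arg_neg_sub_div (z := w) (hF.trans inf_le_left) hα hδ h2 hdir
    have e3 := (Complex.continuous_im.tendsto _).comp (hl3.mono_left hF)
    have e4 := (e1.sub e2).sub e3
    simpa [hψ, Complex.log_im, Function.comp_def] using e4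
  have h1 := hlim hF hα hαβ hαδ hFα
  have h2 := hlim hG hκ hκβ hκδ hGκ
  have hFK : K ∈ F := le_principal_iff.1 (hF.trans inf_le_right)
  have hGK : K ∈ G := le_principal_iff.1 (hG.trans inf_le_right)
  obtain ⟨x₀, hx₀⟩ := F.nonempty_of_mem hFK
  have hconst : ∀ ζ ∈ K, (ψ ζ).im = (ψ x₀).im := fun ζ hζ =>
    congrArg Complex.im (hK.eq_of_exp_eq hc hexp hζ hx₀)
  have h3 : Tendsto (fun ζ => (ψ ζ).im) F (𝓝 (ψ x₀).im) :=
    tendsto_const_nhds.congr' (by filter_upwards [hFK] with ζ hζ using (hconst ζ hζ).symm)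
  have h4 : Tendsto (fun ζ => (ψ ζ).im) G (𝓝 (ψ x₀).im) :=
    tendsto_const_nhds.congr' (by filter_upwards [hGK] with ζ hζ using (hconst ζ hζ).symm)
  rw [tendsto_nhds_unique h1 h3, tendsto_nhds_unique h2 h4]

/-- Moving from `z` in nearly its own direction keeps the norm at least |z| / 2, which accounts for
the factor 2 in `2 * R`; the deviation from direction `L` is below 2 |z| η before division by the
norm, hence below 4η. A ray that starts far out on one set thus avoids another set which keeps away
from that direction. -/
lemma ray_stays_in_cone {L z : ℂ} (hL : ‖L‖ = 1) {R η s : ℝ} (hR : 0 ≤ R) (hz : 2 * R < ‖z‖)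
    (hη : η ≤ 1 / 2) (hd : dist (z / (‖z‖ : ℂ)) L < η) (hs : 0 ≤ s) :
    R < ‖z + s * L‖ ∧ dist ((z + s * L) / (‖z + s * L‖ : ℂ)) L < 4 * η := by
  have hz0 : 0 < ‖z‖ := by linarith
  have hzc : (‖z‖ : ℂ) ≠ 0 := by exact_mod_cast hz0.ne'
  have h1 : ‖z - ‖z‖ * L‖ ≤ ‖z‖ * η := by
    have : z - ‖z‖ * L = ‖z‖ * (z / ‖z‖ - L) := by field_simp
    rw [this, norm_mul, Complex.norm_real, norm_norm]
    rw [dist_eq_norm] at hd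
    exact mul_le_mul_of_nonneg_left hd.le hz0.le
  have h1' : ‖z - ‖z‖ * L‖ < ‖z‖ * η := by
    have : z - ‖z‖ * L = ‖z‖ * (z / ‖z‖ - L) := by field_simp
    rw [this, norm_mul, Complex.norm_real, norm_norm]
    rw [dist_eq_norm] at hd
    exact mul_lt_mul_of_pos_left hd hz0
  have hrL : ‖((‖z‖ + s : ℝ) : ℂ) * L‖ = ‖z‖ + s := by
    rw [norm_mul, hL, mul_one, Complex.norm_real, Real.norm_of_nonneg (by positivity)]
  have hdec : z + s * L = ((‖z‖ + s : ℝ) : ℂ) * L + (z - ‖z‖ * L) := by push_cast; ring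
  have h2 : ‖z‖ + s - ‖z - ‖z‖ * L‖ ≤ ‖z + s * L‖ := by
    rw [hdec]; nth_rewrite 1 [← hrL]
    have := norm_sub_norm_le (((‖z‖ + s : ℝ) : ℂ) * L) (-(z - ‖z‖ * L))
    rwa [norm_neg, sub_neg_eq_add] at this
  have h3 : ‖z + s * L‖ ≤ ‖z‖ + s + ‖z - ‖z‖ * L‖ := by
    rw [hdec]; nth_rewrite 2 [← hrL]
    exact norm_add_le _ _
  have hη0 : 0 < η := dist_nonneg.trans_lt hd
  have hhalf : ‖z‖ * η ≤ ‖z‖ / 2 := by nlinarith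
  have hbig : ‖z‖ / 2 ≤ ‖z + s * L‖ := by linarith
  refine ⟨by linarith, ?_⟩
  set N := ‖z + s * L‖ with hN
  have hN0 : 0 < N := by linarith
  have hNc : (N : ℂ) ≠ 0 := by exact_mod_cast hN0.ne'
  have h4 : ‖(z + s * L) - N * L‖ < 2 * (‖z‖ * η) := by
    have : (z + s * L) - N * L = ((‖z‖ + s - N : ℝ) : ℂ) * L + (z - ‖z‖ * L) := by push_cast; ring
    rw [this]
    refine (norm_add_le _ _).trans_lt ?_
    rw [norm_mul, hL, mul_one, Complex.norm_real, Real.norm_eq_abs]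
    have : |‖z‖ + s - N| ≤ ‖z - ‖z‖ * L‖ := abs_le.2 ⟨by linarith, by linarith⟩
    linarith
  have h5 : (z + s * L) / (N : ℂ) - L = ((z + s * L) - N * L) / N := by field_simp
  rw [dist_eq_norm, h5, norm_div, Complex.norm_real, Real.norm_of_nonneg hN0.le, div_lt_iff₀ hN0]
  nlinarith

namespace HarmonicPoly

variable {n : ℕ}

/-- The argument of -x has its cut along the positive axis, so the correction ±π records whether `a`
precedes `b`. This turns equations between angles into statements about order. -/
lemma arg_neg_leafDir_div (hn : 1 ≤ n) (u : HarmonicPoly n) {a b : Fin (2 * n)} (hab : a ≠ b) :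
    Complex.arg (-(u.leafDir a / u.leafDir b)) =
      ((a : ℕ) : ℝ) * Real.pi / n - ((b : ℕ) : ℝ) * Real.pi / n +
        (if a < b then Real.pi else -Real.pi) := by
  have hn0 : (0 : ℝ) < n := by exact_mod_cast hn
  set θ : ℝ := ((a : ℕ) : ℝ) * Real.pi / n - ((b : ℕ) : ℝ) * Real.pi / n with hθ
  have h1 : u.leafDir a / u.leafDir b = Complex.exp (θ * Complex.I) := by
    rw [leafDir, leafDir, mul_div_mul_left _ _ u.dir_ne_zero, ← Complex.exp_sub]
    congr 1
    rw [hθ]; push_cast; ring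
  have hθ' : θ = (((a : ℕ) : ℝ) - ((b : ℕ) : ℝ)) * (Real.pi / n) := by rw [hθ]; ring
  have hpn : 0 < Real.pi / n := div_pos Real.pi_pos hn0
  have h2n : 2 * Real.pi = (2 * n) * (Real.pi / n) := by field_simp
  have ha : ((a : ℕ) : ℝ) + 1 ≤ 2 * n := by exact_mod_cast a.2
  have hb : ((b : ℕ) : ℝ) + 1 ≤ 2 * n := by exact_mod_cast b.2
  have ha0 : (0 : ℝ) ≤ ((a : ℕ) : ℝ) := Nat.cast_nonneg _
  have hb0 : (0 : ℝ) ≤ ((b : ℕ) : ℝ) := Nat.cast_nonneg _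
  split_ifs with h
  · have hlt : ((a : ℕ) : ℝ) + 1 ≤ ((b : ℕ) : ℝ) := by exact_mod_cast h
    have h3 : -(u.leafDir a / u.leafDir b) =
        Complex.exp (((θ + Real.pi : ℝ) : ℂ) * Complex.I) := by
      rw [h1, Complex.ofReal_add, add_mul, Complex.exp_add, Complex.exp_pi_mul_I, mul_neg_one]
    rw [h3, Complex.exp_mul_I, Complex.arg_cos_add_sin_mul_I]
    constructor
    · nlinarith
    · nlinarith
  · have hlt : ((b : ℕ) : ℝ) + 1 ≤ ((a : ℕ) : ℝ) := by
      exact_mod_cast lt_of_le_of_ne (not_lt.1 h) hab.symm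
    have h3 : -(u.leafDir a / u.leafDir b) =
        Complex.exp (((θ + -Real.pi : ℝ) : ℂ) * Complex.I) := by
      rw [h1, Complex.ofReal_add, add_mul, Complex.exp_add, Complex.ofReal_neg, neg_mul,
        Complex.exp_neg, Complex.exp_pi_mul_I]
      norm_num
    rw [h3, Complex.exp_mul_I, Complex.arg_cos_add_sin_mul_I]
    constructor
    · nlinarith
    · nlinarith

/-- Two disjoint connected sets, one of them closed, do not have interlaced asymptotic
directions. -/
lemma not_interlaced_of_disjoint (hn : 1 ≤ n) (u : HarmonicPoly n) {K B : Set ℂ} (hK : IsClosed K)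
    (hKc : IsPreconnected K) (hB : IsPreconnected B) (hd : Disjoint K B)
    {a b c d : Fin (2 * n)} (hab : a ≠ b) (had : a ≠ d) (hcb : c ≠ b) (hcd : c ≠ d)
    (ha : u.Reaches K (Sum.inl a)) (hc : u.Reaches K (Sum.inl c))
    (hb : u.Reaches B (Sum.inl b)) (hd' : u.Reaches B (Sum.inl d))
    {R δ : ℝ} (hR : 0 ≤ R) (hδ : 0 < δ)
    (hKb : ∀ ζ ∈ K, R < ‖ζ‖ → δ ≤ dist (ζ / (‖ζ‖ : ℂ)) (u.leafDir b))
    (hKd : ∀ ζ ∈ K, R < ‖ζ‖ → δ ≤ dist (ζ / (‖ζ‖ : ℂ)) (u.leafDir d)) :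
    (if a < b then (1 : ℤ) else 0) - (if a < d then 1 else 0) =
      (if c < b then 1 else 0) - (if c < d then 1 else 0) := by
  have hray : ∀ b, u.Reaches B (Sum.inl b) →
      (∀ ζ ∈ K, R < ‖ζ‖ → δ ≤ dist (ζ / (‖ζ‖ : ℂ)) (u.leafDir b)) →
      ∃ z ∈ B, ∀ ζ ∈ K, -((ζ - z) / u.leafDir b) ∈ Complex.slitPlane := by
    rintro b ⟨s, hs1, hs2, hs3⟩ hKb
    set η := min (δ / 4) (1 / 2)
    have hη : 0 < η := by positivity
    obtain ⟨m, hm1, hm2⟩ := ((hs2.eventually_gt_atTop (2 * R)).and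
      (Metric.tendsto_nhds.1 hs3 η hη)).exists
    refine ⟨s m, hs1 m, fun ζ hζ => ?_⟩
    have hL0 : u.leafDir b ≠ 0 := norm_pos_iff.1 (by rw [u.norm_leafDir]; exact one_pos)
    by_contra hcon
    obtain ⟨t, h1, h3⟩ := exists_real_of_neg_notMem_slitPlane hcon
    have h4 : ζ = s m + t * u.leafDir b := by
      rw [div_eq_iff hL0] at h3
      rw [← h3]; ring
    obtain ⟨h5, h6⟩ := ray_stays_in_cone (u.norm_leafDir b) hR hm1 (min_le_right _ _) hm2
      h1
    rw [← h4] at h5 h6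
    have := hKb ζ hζ h5
    have h7 : η ≤ δ / 4 := min_le_left _ _
    linarith
  have hfilt : ∀ a, u.Reaches K (Sum.inl a) → ∃ F : Filter ℂ, F.NeBot ∧
      F ≤ Bornology.cobounded ℂ ⊓ 𝓟 K ∧
      Tendsto (fun ζ => ζ / (‖ζ‖ : ℂ)) F (𝓝 (u.leafDir a)) := by
    rintro a ⟨s, hs1, hs2, hs3⟩
    refine ⟨map s atTop, inferInstance, le_inf (tendsto_norm_atTop_iff_cobounded.1 hs2)
      (le_principal_iff.2 (mem_map.2 (univ_mem' hs1))), hs3⟩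
  obtain ⟨z, hzB, hz⟩ := hray b hb hKb
  obtain ⟨w, hwB, hw⟩ := hray d hd' hKd
  obtain ⟨F, hF1, hF2, hF3⟩ := hfilt a ha
  obtain ⟨G, hG1, hG2, hG3⟩ := hfilt c hc
  have hinj := u.leafDir_injective hn
  have key := arg_sub_arg_eq_of_logRel hKc (logRel_of_isPreconnected hK hB hd hzB hwB) hz hw
    (u.norm_leafDir b) (u.norm_leafDir d) (u.norm_leafDir a) (u.norm_leafDir c)
    (hinj.ne hab) (hinj.ne had) (hinj.ne hcb) (hinj.ne hcd) hF2 hG2 hF3 hG3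
  rw [u.arg_neg_leafDir_div hn hab, u.arg_neg_leafDir_div hn had, u.arg_neg_leafDir_div hn hcb,
    u.arg_neg_leafDir_div hn hcd] at key
  have hpi := Real.pi_pos
  -- The terms linear in the indices cancel in `key`; what remains compares multiples of π, which
  -- correspond to the 0 and 1 of the claim.
  split_ifs at key ⊢ <;> first | rfl | (exfalso; linarith)

end HarmonicPoly

end

/-! ### No cycles, by the maximum principle -/

section

open Set Filter Topology

namespace HarmonicPoly

variable {n : ℕ}

/-- Maximum principle: the components of `{u > 0}` are unbounded. -/
lemma not_isBounded_component_pos (u : HarmonicPoly n) {z : ℂ} (hz : 0 < u.toFun z) :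
    ¬ Bornology.IsBounded (connectedComponentIn {w | 0 < u.toFun w} z) := by
  intro hb
  set Ω := connectedComponentIn {w | 0 < u.toFun w} z
  have hopen : IsOpen {w | 0 < u.toFun w} := isOpen_lt continuous_const u.continuous_toFun
  have hΩ : IsOpen Ω := hopen.connectedComponentIn
  have hzΩ : z ∈ Ω := mem_connectedComponentIn hz
  have hfr : ∀ x ∈ frontier Ω, u.toFun x ≤ 0 := by
    intro x hx
    by_contra hcon
    have hx0 : 0 < u.toFun x := not_le.1 hcon
    have hxcl : x ∈ closure Ω := frontier_subset_closure hx
    have hnb : connectedComponentIn {w | 0 < u.toFun w} x ∈ 𝓝 x :=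
      hopen.connectedComponentIn.mem_nhds (mem_connectedComponentIn hx0)
    obtain ⟨y, hy1, hy2⟩ := mem_closure_iff_nhds.1 hxcl _ hnb
    have h1 := connectedComponentIn_eq hy1
    have h2 := connectedComponentIn_eq hy2
    have : x ∈ Ω := by
      show x ∈ connectedComponentIn _ z
      rw [h2, ← h1]; exact mem_connectedComponentIn hx0
    rw [hΩ.frontier_eq] at hx
    exact hx.2 this
  -- The modulus of exp P is e^u, which is at most 1 on the frontier; on a bounded component the
  -- maximum modulus principle would give u(z) ≤ 0.
  have hdiff : Differentiable ℂ fun w => Complex.exp (u.P.eval w) :=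
    Complex.differentiable_exp.comp u.P.differentiable
  have := Complex.norm_le_of_forall_mem_frontier_norm_le hb (hdiff.diffContOnCl) (C := 1)
    (fun w hw => by
      rw [Complex.norm_exp]
      exact Real.exp_le_one_iff.2 (hfr w hw)) (subset_closure hzΩ)
  rw [Complex.norm_exp, Real.exp_le_one_iff] at this
  exact (not_le.2 hz) this

lemma exists_unbounded_of_notMem_zeroSet (u : HarmonicPoly n) {z : ℂ} (hz : z ∉ u.zeroSet) :
    ∃ S, IsPreconnected S ∧ Disjoint u.zeroSet S ∧ z ∈ S ∧ ¬ Bornology.IsBounded S := by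
  have key : ∀ v : HarmonicPoly n, 0 < v.toFun z →
      ∃ S, IsPreconnected S ∧ Disjoint v.zeroSet S ∧ z ∈ S ∧ ¬ Bornology.IsBounded S := by
    intro v hv
    refine ⟨_, isPreconnected_connectedComponentIn, ?_, mem_connectedComponentIn hv,
      v.not_isBounded_component_pos hv⟩
    rw [Set.disjoint_left]
    intro x hx hx'
    have h1 : x ∈ {w | 0 < v.toFun w} := connectedComponentIn_subset _ _ hx'
    exact (mem_ofPred.1 h1).ne' hx
  rcases lt_trichotomy (u.toFun z) 0 with h | h | h
  · have := key u.neg (by rw [neg_toFun]; linarith)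
    rwa [neg_zeroSet] at this
  · exact absurd h hz
  · exact key u h

/-- Join `z` off the zero set to a point `w` of modulus larger than all of `K`. Then (ζ - z) / (ζ -
w) has a continuous logarithm, and so does ζ - w = -w (1 - ζ / w), as 1 - ζ / w lies in the unit
disc around 1. -/
lemma exists_log_sub (u : HarmonicPoly n) {K : Set ℂ} (hK : Bornology.IsBounded K)
    (hKZ : K ⊆ u.zeroSet) {z : ℂ} (hz : z ∉ u.zeroSet) :
    ∃ l : ℂ → ℂ, ContinuousOn l K ∧ ∀ ζ ∈ K, Complex.exp (l ζ) = ζ - z := by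
  obtain ⟨S, hS, hd, hzS, hSb⟩ := u.exists_unbounded_of_notMem_zeroSet hz
  obtain ⟨R, hR⟩ := hK.subset_closedBall (0 : ℂ)
  have hw : ∃ w ∈ S, max R 0 < ‖w‖ := by
    by_contra hcon
    push Not at hcon
    exact hSb (Metric.isBounded_closedBall.subset fun w hw =>
      mem_closedBall_zero_iff.2 (hcon w hw))
  obtain ⟨w, hwS, hwR⟩ := hw
  obtain ⟨l, hl1, hl2, -⟩ := logRel_of_isPreconnected u.isClosed_zeroSet hS hd hzS hwS
  have hw0 : w ≠ 0 := norm_pos_iff.1 ((le_max_right _ _).trans_lt hwR)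
  have hslit : ∀ ζ ∈ K, 1 + -(ζ / w) ∈ Complex.slitPlane := by
    intro ζ hζ
    apply Complex.mem_slitPlane_of_norm_lt_one
    rw [norm_neg, norm_div, div_lt_one (norm_pos_iff.2 hw0)]
    have := mem_closedBall_zero_iff.1 (hR hζ)
    exact this.trans_lt ((le_max_left _ _).trans_lt hwR)
  refine ⟨fun ζ => l ζ + (Complex.log (1 + -(ζ / w)) + Complex.log (-w)), ?_, ?_⟩
  · refine (hl1.mono hKZ).add ((ContinuousOn.clog ?_ hslit).add continuousOn_const)
    fun_prop
  · intro ζ hζ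
    have hne := Complex.slitPlane_ne_zero (hslit ζ hζ)
    have h1 : ζ - w ≠ 0 := by
      intro h
      apply hne
      rw [sub_eq_zero.1 h, div_self hw0]; ring
    rw [Complex.exp_add, Complex.exp_add, Complex.exp_log hne, Complex.exp_log (neg_ne_zero.2 hw0),
      hl2 ζ (hKZ hζ)]
    field_simp
    ring

/-- A bounded connected subset of the zero set, with a regular point removed, cannot join the two
sides of this point. -/
lemma not_joins_sides (u : HarmonicPoly n) {z₀ : ℂ} (hz₀ : z₀ ∈ u.regularSet) {K : Set ℂ}
    (hK : Bornology.IsBounded K) (hKZ : K ⊆ u.zeroSet) (hz₀K : z₀ ∈ K)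
    (hKc : IsPreconnected (K \ {z₀})) {s : ℝ → ℂ} (hs0 : s (u.ht z₀) = z₀)
    (hs : HasDerivAt s (Complex.I / u.P.derivative.eval z₀) (u.ht z₀))
    (hsK : ∀ᶠ t in 𝓝 (u.ht z₀), s t ∈ K) : False := by
  set D := u.P.derivative.eval z₀ with hD
  have hD0 : D ≠ 0 := hz₀.2
  set t₀ := u.ht z₀
  -- the normal direction
  have hnormal : HasDerivAt (fun x : ℝ => u.toFun (z₀ + x * D⁻¹)) 1 0 := by
    have h1 : HasDerivAt (fun x : ℝ => z₀ + (x : ℂ) * D⁻¹) D⁻¹ 0 := by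
      simpa using ((Complex.ofRealCLM.hasDerivAt (x := (0 : ℝ))).mul_const D⁻¹).const_add z₀
    have h2 : HasDerivAt (fun z => u.P.eval z) D (z₀ + ((0 : ℝ) : ℂ) * D⁻¹) := by
      simpa using u.P.hasDerivAt z₀
    have h3 := Complex.reCLM.hasFDerivAt.comp_hasDerivAt (0 : ℝ) (h2.comp (0 : ℝ) h1)
    simpa [mul_inv_cancel₀ hD0, Function.comp_def, toFun] using h3
  have hu0 : u.toFun z₀ = 0 := hz₀.1
  have hsign : ∀ᶠ x : ℝ in 𝓝 0, x ≠ 0 → 0 < x⁻¹ * u.toFun (z₀ + x * D⁻¹) := by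
    have h1 := hasDerivAt_iff_tendsto_slope.1 hnormal
    have h2 := h1.eventually_const_lt (show (0 : ℝ) < 1 by norm_num)
    rw [eventually_nhdsWithin_iff] at h2
    filter_upwards [h2] with x hx hx0
    have := hx hx0
    rw [slope_def_field] at this
    simp only [Complex.ofReal_zero, zero_mul, add_zero, hu0, sub_zero] at this
    rwa [div_eq_inv_mul] at this
  obtain ⟨r, hr, hball⟩ := Metric.eventually_nhds_iff.1 hsign
  set ε := r / 2 with hε
  have hε0 : 0 < ε := by positivity
  have hnz : ∀ x : ℝ, |x| ≤ ε → x ≠ 0 → z₀ + x * D⁻¹ ∉ u.zeroSet := by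
    intro x hx hx0 hmem
    have h1 := hball (y := x) (by rw [dist_zero_right, Real.norm_eq_abs]; linarith) hx0
    have h2 : u.toFun (z₀ + x * D⁻¹) = 0 := hmem
    rw [h2, mul_zero] at h1
    exact lt_irrefl _ h1
  have hz1 : z₀ + ε * D⁻¹ ∉ u.zeroSet := hnz ε (by rw [abs_of_pos hε0]) hε0.ne'
  have hw1 : z₀ - ε * D⁻¹ ∉ u.zeroSet := by
    have := hnz (-ε) (by rw [abs_neg, abs_of_pos hε0]) (by linarith)
    rwa [Complex.ofReal_neg, neg_mul, ← sub_eq_add_neg] at this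
  obtain ⟨l₁, hl₁, hl₁'⟩ := u.exists_log_sub hK hKZ hz1
  obtain ⟨l₂, hl₂, hl₂'⟩ := u.exists_log_sub hK hKZ hw1
  have hεc : (ε : ℂ) ≠ 0 := by exact_mod_cast hε0.ne'
  -- In the coordinate `η` the zero set has imaginary tangent at `z₀`, and the normal segment is
  -- [-ε, ε]. Its points other than -ε go to the real half-line ρ ≤ 0, with `z₀` going to -1, so the
  -- principal logarithm of `ρ` is cut only along the normal segment, which `K` meets in `z₀` alone.
  set η : ℂ → ℂ := fun ζ => (ζ - z₀) * D with hη
  set ρ : ℂ → ℂ := fun ζ => (η ζ - ε) / (η ζ + ε) with hρ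
  have hden : ∀ ζ ∈ K, η ζ + ε ≠ 0 := by
    intro ζ hζ h
    apply hw1
    have : ζ = z₀ - ε * D⁻¹ := by
      rw [hη] at h; simp only at h
      field_simp
      linear_combination h
    exact this ▸ hKZ hζ
  have hexp : ∀ ζ ∈ K, Complex.exp (l₁ ζ - l₂ ζ) = ρ ζ := by
    intro ζ hζ
    have h1 := hden ζ hζ
    rw [Complex.exp_sub, hl₁' ζ hζ, hl₂' ζ hζ, hρ, hη]
    simp only
    rw [← mul_div_mul_right _ _ hD0]
    congr 1 <;> field_simp <;> ring
  have hslit : ∀ ζ ∈ K \ {z₀}, ρ ζ ∈ Complex.slitPlane := by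
    intro ζ hζ
    by_contra hcon
    rw [← neg_neg (ρ ζ)] at hcon
    obtain ⟨t, ht0, ht⟩ := exists_real_of_neg_notMem_slitPlane hcon
    have h1 := hden ζ hζ.1
    have h2 : η ζ = ((ε * (1 - t) / (1 + t) : ℝ) : ℂ) := by
      have h3 : (1 + t : ℂ) ≠ 0 := by
        have : (1 + t : ℝ) ≠ 0 := by positivity
        exact_mod_cast this
      rw [hρ] at ht; simp only at ht
      rw [← neg_div, div_eq_iff h1] at ht
      push_cast
      rw [eq_div_iff h3]
      linear_combination -ht
    set x := ε * (1 - t) / (1 + t) with hx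
    have h4 : ζ = z₀ + x * D⁻¹ := by
      rw [← h2, hη]; field_simp; ring
    have hx1 : |x| ≤ ε := by
      have : 0 < 1 + t := by positivity
      rw [hx, abs_div, abs_of_pos this, div_le_iff₀ this, abs_mul, abs_of_pos hε0]
      gcongr
      exact abs_le.2 ⟨by linarith, by linarith⟩
    by_cases hx0 : x = 0
    · apply hζ.2
      rw [h4, hx0]; simp
    · exact hnz x hx1 hx0 (h4 ▸ hKZ hζ.1)
  -- the two branches differ by a constant
  have hcont : ContinuousOn (fun ζ => (l₁ ζ - l₂ ζ) - Complex.log (ρ ζ)) (K \ {z₀}) := by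
    refine ((hl₁.sub hl₂).mono sdiff_subset).sub (ContinuousOn.clog ?_ hslit)
    refine ContinuousOn.div ?_ ?_ fun ζ hζ => hden ζ hζ.1
    · rw [hη]; fun_prop
    · rw [hη]; fun_prop
  have hone : ∀ ζ ∈ K \ {z₀}, Complex.exp ((l₁ ζ - l₂ ζ) - Complex.log (ρ ζ)) = 1 := by
    intro ζ hζ
    rw [Complex.exp_sub, hexp ζ hζ.1, Complex.exp_log (Complex.slitPlane_ne_zero (hslit ζ hζ)),
      div_self (Complex.slitPlane_ne_zero (hslit ζ hζ))]
  -- the sides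
  have hside : ∀ᶠ t in 𝓝 t₀, t ≠ t₀ → 0 < (t - t₀)⁻¹ * (η (s t)).im := by
    have h1 : HasDerivAt (fun t => (η (s t)).im) 1 t₀ := by
      have h2 := (hs.sub_const z₀).mul_const D
      rw [div_mul_cancel₀ _ hD0] at h2
      have h3 := Complex.imCLM.hasFDerivAt.comp_hasDerivAt t₀ h2
      rw [show Complex.imCLM Complex.I = 1 from Complex.I_im] at h3
      exact h3
    have h4 := hasDerivAt_iff_tendsto_slope.1 h1
    have h5 := h4.eventually_const_lt (show (0 : ℝ) < 1 by norm_num)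
    rw [eventually_nhdsWithin_iff] at h5
    filter_upwards [h5] with t ht ht0
    have := ht ht0
    rw [slope_def_field, hs0] at this
    simp only [hη, sub_self, zero_mul, Complex.zero_im, sub_zero] at this
    rwa [div_eq_inv_mul] at this
  have hsne : ∀ᶠ t in 𝓝 t₀, t ≠ t₀ → s t ∈ K \ {z₀} := by
    filter_upwards [hside, hsK] with t ht htK ht0
    refine ⟨htK, fun h => ?_⟩
    have h1 := ht ht0
    rw [mem_singleton_iff.1 h, hη] at h1
    simp at h1
  obtain ⟨t₁, ht₁K⟩ : ∃ t₁, s t₁ ∈ K \ {z₀} := by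
    have h1 : ∀ᶠ t in 𝓝[>] t₀, s t ∈ K \ {z₀} := by
      filter_upwards [mem_nhdsWithin_of_mem_nhds hsne, self_mem_nhdsWithin] with t ht ht'
      exact ht (ne_of_gt ht')
    exact h1.exists
  set c := (l₁ (s t₁) - l₂ (s t₁)) - Complex.log (ρ (s t₁)) with hc
  have hlog : ∀ ζ ∈ K \ {z₀}, Complex.log (ρ ζ) = (l₁ ζ - l₂ ζ) - c := by
    intro ζ hζ
    have h1 : (l₁ ζ - l₂ ζ) - Complex.log (ρ ζ) = c := hKc.eq_of_exp_eq hcont hone hζ ht₁K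
    rw [← h1]; ring
  -- The value at `z₀` of the continuous branch that agrees with the principal logarithm of `ρ` on
  -- the rest of `K`. Along the edge the imaginary part of this branch has the sign of t - t₀, so Im
  -- m = 0 and exp m > 0; but exp m = ρ(z₀) = -1.
  set m := (l₁ z₀ - l₂ z₀) - c with hm
  have hlim : Tendsto (fun t => (l₁ (s t) - l₂ (s t)) - c) (𝓝 t₀) (𝓝 m) := by
    have h1 : Tendsto s (𝓝 t₀) (𝓝[K] z₀) := by
      refine tendsto_nhdsWithin_iff.2 ⟨?_, hsK⟩
      have := hs.continuousAt.tendsto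
      rwa [hs0] at this
    exact (((hl₁ z₀ hz₀K).sub (hl₂ z₀ hz₀K)).tendsto.comp h1).sub_const c
  have him : ∀ᶠ t in 𝓝 t₀, t ≠ t₀ → 0 < (t - t₀)⁻¹ * ((l₁ (s t) - l₂ (s t)) - c).im := by
    filter_upwards [hside, hsne] with t ht1 ht2 ht0
    have hK' := ht2 ht0
    rw [← hlog _ hK', Complex.log_im]
    have h1 := ht1 ht0
    have hρim : (ρ (s t)).im = (2 * ε / Complex.normSq (η (s t) + ε)) * (η (s t)).im := by
      rw [hρ]; simp only
      rw [Complex.div_im]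
      simp
      ring
    have hpos : 0 < 2 * ε / Complex.normSq (η (s t) + ε) := by
      have := Complex.normSq_pos.2 (hden _ hK'.1)
      positivity
    rcases lt_or_gt_of_ne (sub_ne_zero.2 ht0) with h | h
    · have h2 : (η (s t)).im < 0 := by
        by_contra hcon
        have := mul_nonpos_of_nonpos_of_nonneg (inv_nonpos.2 h.le) (not_lt.1 hcon)
        linarith
      have h3 : (ρ (s t)).im < 0 := by rw [hρim]; exact mul_neg_of_pos_of_neg hpos h2
      exact mul_pos_of_neg_of_neg (inv_lt_zero.2 h) (Complex.arg_neg_iff.2 h3)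
    · have h2 : 0 < (η (s t)).im := by
        by_contra hcon
        have := mul_nonpos_of_nonneg_of_nonpos (inv_nonneg.2 h.le) (not_lt.1 hcon)
        linarith
      have h3 : 0 < (ρ (s t)).im := by rw [hρim]; exact mul_pos hpos h2
      refine mul_pos (inv_pos.2 h) (lt_of_le_of_ne (Complex.arg_nonneg_iff.2 h3.le) ?_)
      intro h0
      rw [eq_comm, Complex.arg_eq_zero_iff] at h0
      exact h3.ne' h0.2
  have hmim := (Complex.continuous_im.tendsto _).comp hlim
  have hm0 : m.im = 0 := by
    apply le_antisymm
    · refine le_of_tendsto (hmim.mono_left (nhdsWithin_le_nhds (s := Iio t₀))) ?_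
      filter_upwards [mem_nhdsWithin_of_mem_nhds him, self_mem_nhdsWithin] with t ht ht'
      have h1 := ht (ne_of_lt ht')
      have h2 : (t - t₀)⁻¹ < 0 := inv_lt_zero.2 (sub_neg.2 ht')
      simp only [Function.comp]
      by_contra hcon
      have := mul_nonpos_of_nonpos_of_nonneg h2.le (not_le.1 hcon).le
      linarith
    · refine ge_of_tendsto (hmim.mono_left (nhdsWithin_le_nhds (s := Ioi t₀))) ?_
      filter_upwards [mem_nhdsWithin_of_mem_nhds him, self_mem_nhdsWithin] with t ht ht'
      have h1 := ht (ne_of_gt ht')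
      have h2 : 0 < (t - t₀)⁻¹ := inv_pos.2 (sub_pos.2 ht')
      simp only [Function.comp]
      by_contra hcon
      have := mul_nonpos_of_nonneg_of_nonpos h2.le (not_le.1 hcon).le
      linarith
  have hexpm : Complex.exp m = -1 := by
    have h1 : Complex.exp (l₁ z₀ - l₂ z₀) = -1 := by
      rw [hexp z₀ hz₀K, hρ, hη]; simp only
      rw [sub_self, zero_mul, zero_sub, zero_add, neg_div, div_self hεc]
    have h2 : Complex.exp c = 1 := hone _ ht₁K
    rw [hm, Complex.exp_sub, h1, h2, div_one]
  have := congrArg Complex.re hexpm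
  rw [Complex.exp_re, hm0, Real.cos_zero, mul_one] at this
  have h2 := Real.exp_pos m.re
  rw [this] at h2
  norm_num at h2

lemma isPreconnected_tail_lt (u : HarmonicPoly n) (z w : ℂ) :
    IsPreconnected {v | v ∈ u.edge z ∧ u.ht w < u.ht v} := by
  obtain ⟨I, γ, hl, ho, hp, him, hinv⟩ := u.exists_edge_param z
  have : {v | v ∈ u.edge z ∧ u.ht w < u.ht v} = γ '' (I ∩ Ioi (u.ht w)) := by
    ext v
    constructor
    · rintro ⟨h1, h2⟩
      exact ⟨u.ht v, ⟨(hinv v h1).1, h2⟩, (hinv v h1).2⟩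
    · rintro ⟨t, ⟨h1, h2⟩, rfl⟩
      exact ⟨him ▸ ⟨t, h1, rfl⟩, by rw [hl.ht h1]; exact h2⟩
  rw [this]
  refine IsPreconnected.image ?_ _ (hl.continuousOn.mono inter_subset_left)
  rw [isPreconnected_iff_ordConnected] at *
  exact hp.inter ordConnected_Ioi

lemma isBounded_edge (u : HarmonicPoly n) {z : ℂ} (hz : z ∈ u.regularSet) {p q : u.criticalSet}
    (hp : u.IsHigh (u.edge z) (Sum.inr p)) (hq : u.IsLow (u.edge z) (Sum.inr q)) :
    Bornology.IsBounded (u.edge z) := by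
  have h1 : ∃ w ∈ u.edge z, {v | v ∈ u.edge z ∧ u.ht w ≤ u.ht v} ⊆ Metric.ball (p : ℂ) 1 :=
    (u.hasBasis_highFilter hz).mem_iff.1 ((show u.highFilter (u.edge z) ≤ 𝓝 (p : ℂ) from hp)
      (Metric.ball_mem_nhds _ one_pos))
  have hb := u.neg.hasBasis_highFilter (z := z) (by rwa [neg_regularSet])
  simp only [neg_edge, neg_ht, neg_le_neg_iff] at hb
  have h2 : ∃ w ∈ u.edge z, {v | v ∈ u.edge z ∧ u.ht v ≤ u.ht w} ⊆ Metric.ball (q : ℂ) 1 :=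
    hb.mem_iff.1 ((show u.neg.highFilter (u.edge z) ≤ 𝓝 (q : ℂ) from hq)
      (Metric.ball_mem_nhds _ one_pos))
  obtain ⟨w, hw, hw'⟩ := h1
  obtain ⟨v, hv, hv'⟩ := h2
  refine ((Metric.isBounded_ball (x := (p : ℂ)) (r := 1)).union
    ((Metric.isBounded_ball (x := (q : ℂ)) (r := 1)).union
      (u.isCompact_edge_between hv hw).isBounded)).subset ?_
  intro x hx
  rcases le_total (u.ht w) (u.ht x) with h | h
  · exact Or.inl (hw' ⟨hx, h⟩)
  · rcases le_total (u.ht x) (u.ht v) with h' | h'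
    · exact Or.inr (Or.inl (hv' ⟨hx, h'⟩))
    · exact Or.inr (Or.inr ⟨hx, h', h⟩)

/-- The two ends of an edge are not connected to each other in a bounded part of the zero set off
the edge. -/
lemma not_connected_off_edge (u : HarmonicPoly n) {z : ℂ} (hz : z ∈ u.regularSet)
    {p q : u.criticalSet} (hp : u.IsHigh (u.edge z) (Sum.inr p))
    (hq : u.IsLow (u.edge z) (Sum.inr q)) {K : Set ℂ} (hK : IsPreconnected K)
    (hKb : Bornology.IsBounded K) (hKZ : K ⊆ u.zeroSet) (hpK : (p : ℂ) ∈ K) (hqK : (q : ℂ) ∈ K)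
    (hd : Disjoint K (u.edge z)) : False := by
  obtain ⟨ε, hε, s, hs, hs0, hder, -⟩ := exists_local_lift hz
  have hsE : ∀ t ∈ Ioo (u.ht z - ε) (u.ht z + ε), s t ∈ u.edge z := fun t ht =>
    OnLift.mem_edge ⟨_, s, hs, isPreconnected_Ioo, isOpen_Ioo, ⟨by linarith, by linarith⟩,
      by rwa [hs.ht ht], hs0, by rw [hs.ht ht]⟩
  have hzE := mem_edge_self hz
  have hzK : z ∉ K := fun h => Set.disjoint_left.1 hd h hzE
  -- Removing `z` leaves `K` with two half-edges attached at `p` and at `q`, which is still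
  -- connected.
  refine u.not_joins_sides hz (K := K ∪ u.edge z) (hKb.union (u.isBounded_edge hz hp hq))
    (union_subset hKZ ((u.edge_subset z).trans u.regularSet_subset)) (Or.inr hzE) ?_ hs0 hder ?_
  · have hne := u.neBot_highFilter hz
    have hne' := u.neBot_lowFilter hz
    have hpc : (p : ℂ) ∈ closure {v | v ∈ u.edge z ∧ u.ht z < u.ht v} := by
      obtain ⟨v, hv, hzv⟩ := u.exists_ht_gt hzE
      rw [mem_closure_iff_clusterPt]
      refine NeBot.mono hne (le_inf hp (le_principal_iff.2 ?_))
      filter_upwards [u.eventually_highFilter_le hz hv] with x hx using ⟨hx.1, hzv.trans_le hx.2⟩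
    have hqc : (q : ℂ) ∈ closure {v | v ∈ u.edge z ∧ u.ht v < u.ht z} := by
      obtain ⟨v, hv, hzv⟩ := u.exists_ht_lt hzE
      rw [mem_closure_iff_clusterPt]
      refine NeBot.mono hne' (le_inf hq (le_principal_iff.2 ?_))
      filter_upwards [u.eventually_lowFilter_le hz hv] with x hx using ⟨hx.1, hx.2.trans_lt hzv⟩
    have hlow : IsPreconnected {v | v ∈ u.edge z ∧ u.ht v < u.ht z} := by
      have := u.neg.isPreconnected_tail_lt z z
      simpa only [neg_edge, neg_ht, neg_lt_neg_iff] using this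
    have h1 : IsPreconnected ({v | v ∈ u.edge z ∧ u.ht z < u.ht v} ∪ {(p : ℂ)}) :=
      (u.isPreconnected_tail_lt z z).subset_closure subset_union_left
        (union_subset subset_closure (singleton_subset_iff.2 hpc))
    have h2 : IsPreconnected ({v | v ∈ u.edge z ∧ u.ht v < u.ht z} ∪ {(q : ℂ)}) :=
      hlow.subset_closure subset_union_left
        (union_subset subset_closure (singleton_subset_iff.2 hqc))
    have h3 := (hK.union (p : ℂ) hpK (Or.inr rfl) h1).union (q : ℂ) (Or.inl hqK) (Or.inr rfl) h2
    convert h3 using 1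
    ext x
    constructor
    · rintro ⟨hx | hx, hxz⟩
      · exact Or.inl (Or.inl hx)
      · rcases lt_trichotomy (u.ht x) (u.ht z) with h | h | h
        · exact Or.inr (Or.inl ⟨hx, h⟩)
        · exact absurd (u.injOn_ht_edge z hx hzE h) hxz
        · exact Or.inl (Or.inr (Or.inl ⟨hx, h⟩))
    · rintro ((hx | ⟨hx, hx'⟩ | hx) | ⟨hx, hx'⟩ | hx)
      · exact ⟨Or.inl hx, fun h => hzK (h ▸ hx)⟩
      · exact ⟨Or.inr hx, fun h => hx'.ne (by rw [mem_singleton_iff.1 h])⟩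
      · rw [mem_singleton_iff.1 hx]
        exact ⟨Or.inl hpK, fun h => hzK (mem_singleton_iff.1 h ▸ hpK)⟩
      · exact ⟨Or.inr hx, fun h => hx'.ne (by rw [mem_singleton_iff.1 h])⟩
      · rw [mem_singleton_iff.1 hx]
        exact ⟨Or.inl hqK, fun h => hzK (mem_singleton_iff.1 h ▸ hqK)⟩
  · filter_upwards [Ioo_mem_nhds (show u.ht z - ε < u.ht z by linarith)
      (show u.ht z < u.ht z + ε by linarith)] with t ht using Or.inr (hsE t ht)

end HarmonicPoly

end

/-! ### The zero set is a noncrossing forest -/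

section

open Set Filter Topology

/-- The three elements are pairwise different and occur in this cyclic order. -/
def CycLt {α : Type*} [LT α] (a b c : α) : Prop :=
  (a < b ∧ b < c) ∨ (b < c ∧ c < a) ∨ (c < a ∧ a < b)

namespace HarmonicPoly

variable {n : ℕ}

/-- Adding a regular limit point to an edge leaves it connected inside the regular set, of which the
edge is a component. -/
lemma closure_edge_subset (u : HarmonicPoly n) (z : ℂ) :
    closure (u.edge z) ⊆ u.edge z ∪ u.criticalSet := by
  intro x hx
  have hxZ : x ∈ u.zeroSet := closure_minimal ((u.edge_subset z).trans u.regularSet_subset)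
    u.isClosed_zeroSet hx
  rcases u.mem_regularSet_or hxZ with h | h
  · left
    obtain ⟨w, hw⟩ : (u.edge z).Nonempty := closure_nonempty_iff.1 ⟨x, hx⟩
    have h1 : insert x (u.edge z) ⊆ u.regularSet := insert_subset h (u.edge_subset z)
    have h2 : IsPreconnected (insert x (u.edge z)) :=
      (u.isPreconnected_edge z).subset_closure (subset_insert _ _)
        (insert_subset hx subset_closure)
    have h3 := h2.subset_connectedComponentIn (Or.inr hw) h1 (mem_insert _ _)
    rw [← edge_eq_of_mem hw, edge_eq]
    exact h3
  · exact Or.inr h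

lemma disjoint_edge_of_ne (u : HarmonicPoly n) {z w : ℂ} (h : u.edge z ≠ u.edge w) :
    Disjoint (u.edge z) (u.edge w) := by
  rw [Set.disjoint_left]
  intro x hx hx'
  exact h ((edge_eq_of_mem hx).symm.trans (edge_eq_of_mem hx'))

lemma isBounded_edge_of_reaches (hn : 1 ≤ n) (u : HarmonicPoly n) {z : ℂ} (hz : z ∈ u.regularSet)
    {p q : u.criticalSet} (hpq : p ≠ q) (hp : u.Reaches (u.edge z) (Sum.inr p))
    (hq : u.Reaches (u.edge z) (Sum.inr q)) : Bornology.IsBounded (u.edge z) := by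
  rcases (reaches_iff hn hz).1 hp with hp | hp <;> rcases (reaches_iff hn hz).1 hq with hq | hq
  · exact absurd (Sum.inr_injective (IsHigh.unique hn hz hp hq)) hpq
  · exact u.isBounded_edge hz hp hq
  · exact u.isBounded_edge hz hq hp
  · exact absurd (Sum.inr_injective (IsLow.unique hn hz hp hq)) hpq

lemma not_reaches_off_edge (hn : 1 ≤ n) (u : HarmonicPoly n) {z : ℂ} (hz : z ∈ u.regularSet)
    {p q : u.criticalSet} (hpq : p ≠ q) (hp : u.Reaches (u.edge z) (Sum.inr p))
    (hq : u.Reaches (u.edge z) (Sum.inr q)) {K : Set ℂ} (hK : IsPreconnected K)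
    (hKb : Bornology.IsBounded K) (hKZ : K ⊆ u.zeroSet) (hpK : (p : ℂ) ∈ K) (hqK : (q : ℂ) ∈ K)
    (hd : Disjoint K (u.edge z)) : False := by
  rcases (reaches_iff hn hz).1 hp with hp | hp <;> rcases (reaches_iff hn hz).1 hq with hq | hq
  · exact absurd (Sum.inr_injective (IsHigh.unique hn hz hp hq)) hpq
  · exact u.not_connected_off_edge hz hp hq hK hKb hKZ hpK hqK hd
  · exact u.not_connected_off_edge hz hq hp hK hKb hKZ hqK hpK hd
  · exact absurd (Sum.inr_injective (IsLow.unique hn hz hp hq)) hpq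

/-- The closure of a second edge between two nodes would be a bounded connected set joining the ends
of the first edge off that edge. Hence nothing is lost by describing the forest as a simple graph.
-/
lemma edge_eq_of_reaches (hn : 1 ≤ n) (u : HarmonicPoly n) {z w : ℂ} (hz : z ∈ u.regularSet)
    (hw : w ∈ u.regularSet) {x y : u.Vertex} (hxy : x ≠ y) (hzx : u.Reaches (u.edge z) x)
    (hzy : u.Reaches (u.edge z) y) (hwx : u.Reaches (u.edge w) x)
    (hwy : u.Reaches (u.edge w) y) : u.edge z = u.edge w := by
  rcases x with k | p
  · exact u.edge_eq_of_reaches_leaf hn hz hw hzx hwx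
  rcases y with k | q
  · exact u.edge_eq_of_reaches_leaf hn hz hw hzy hwy
  by_contra hne
  have hpq : p ≠ q := fun h => hxy (by rw [h])
  refine u.not_reaches_off_edge hn hz hpq hzx hzy (u.isPreconnected_edge w).closure
    (u.isBounded_edge_of_reaches hn hw hpq hwx hwy).closure
    (closure_minimal ((u.edge_subset w).trans u.regularSet_subset) u.isClosed_zeroSet) hwx hwy ?_
  rw [Set.disjoint_left]
  intro x hx hx'
  rcases u.closure_edge_subset w hx with h | h
  · exact Set.disjoint_left.1 (u.disjoint_edge_of_ne hne) hx' h
  · exact not_mem_criticalSet (u.edge_subset z hx') h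

lemma eq_or_eq_of_reaches (hn : 1 ≤ n) (u : HarmonicPoly n) {z : ℂ} (hz : z ∈ u.regularSet)
    {x y v : u.Vertex} (hxy : x ≠ y) (hx : u.Reaches (u.edge z) x) (hy : u.Reaches (u.edge z) y)
    (hv : u.Reaches (u.edge z) v) : v = x ∨ v = y := by
  obtain ⟨a, b, -, -, -, hr⟩ := u.exists_ends hn hz
  rcases (hr x).1 hx with rfl | rfl <;> rcases (hr y).1 hy with rfl | rfl <;>
    rcases (hr v).1 hv with rfl | rfl <;> simp_all

/-- The subset of the plane swept by a walk in the forest. -/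
def hull (u : HarmonicPoly n) {x y : u.Vertex} (w : u.forestGraph.Walk x y) : Set ℂ :=
  {z | (∃ p : u.criticalSet, (p : ℂ) = z ∧ Sum.inr p ∈ w.support) ∨ (z ∈ u.regularSet ∧
    ∃ a b, s(a, b) ∈ w.edges ∧ u.Reaches (u.edge z) a ∧ u.Reaches (u.edge z) b)}

/-- The inner node as a point of the plane, nothing for a leaf. -/
def nodeSet (u : HarmonicPoly n) : u.Vertex → Set ℂ
  | Sum.inl _ => ∅
  | Sum.inr p => {(p : ℂ)}

lemma mem_nodeSet {u : HarmonicPoly n} {x : u.Vertex} {z : ℂ} :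
    z ∈ u.nodeSet x ↔ ∃ p : u.criticalSet, (p : ℂ) = z ∧ Sum.inr p = x := by
  rcases x with k | q
  · simp [nodeSet]
  · simp only [nodeSet, mem_singleton_iff]
    constructor
    · rintro rfl; exact ⟨q, rfl, rfl⟩
    · rintro ⟨p, rfl, h⟩; rw [Sum.inr_injective h]

lemma hull_nil (u : HarmonicPoly n) (x : u.Vertex) :
    u.hull (SimpleGraph.Walk.nil : u.forestGraph.Walk x x) = u.nodeSet x := by
  ext z
  simp [hull, mem_nodeSet]

/-- Since the edge joining `x` and `y` is unique, the first step of the walk sweeps the closure of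
just one edge. This makes induction along the walk possible. -/
lemma hull_cons (hn : 1 ≤ n) (u : HarmonicPoly n) {x y v : u.Vertex}
    (h : u.forestGraph.Adj x y) (w : u.forestGraph.Walk y v) {z : ℂ} (hz : z ∈ u.regularSet)
    (hzx : u.Reaches (u.edge z) x) (hzy : u.Reaches (u.edge z) y) :
    u.hull (SimpleGraph.Walk.cons h w) = u.nodeSet x ∪ closure (u.edge z) ∪ u.hull w := by
  ext ζ
  constructor
  · rintro (⟨p, rfl, hp⟩ | ⟨hζ, a, b, hab, ha, hb⟩)
    · rw [SimpleGraph.Walk.support_cons, List.mem_cons] at hp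
      rcases hp with hp | hp
      · exact Or.inl (Or.inl (mem_nodeSet.2 ⟨p, rfl, hp⟩))
      · exact Or.inr (Or.inl ⟨p, rfl, hp⟩)
    · rw [SimpleGraph.Walk.edges_cons, List.mem_cons] at hab
      rcases hab with hab | hab
      · have h1 : u.Reaches (u.edge ζ) x ∧ u.Reaches (u.edge ζ) y := by
          rcases Sym2.eq_iff.1 hab with ⟨rfl, rfl⟩ | ⟨rfl, rfl⟩
          · exact ⟨ha, hb⟩
          · exact ⟨hb, ha⟩
        rw [u.edge_eq_of_reaches hn hz hζ h.ne hzx hzy h1.1 h1.2]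
        exact Or.inl (Or.inr (subset_closure (mem_edge_self hζ)))
      · exact Or.inr (Or.inr ⟨hζ, a, b, hab, ha, hb⟩)
  · rintro ((hζ | hζ) | (⟨p, rfl, hp⟩ | ⟨hζ, a, b, hab, ha, hb⟩))
    · obtain ⟨p, rfl, hp⟩ := mem_nodeSet.1 hζ
      exact Or.inl ⟨p, rfl, by rw [hp, SimpleGraph.Walk.support_cons]; exact List.mem_cons_self⟩
    · rcases u.closure_edge_subset z hζ with h1 | h1
      · refine Or.inr ⟨u.edge_subset z h1, x, y, ?_, ?_⟩
        · rw [SimpleGraph.Walk.edges_cons]; exact List.mem_cons_self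
        · rw [edge_eq_of_mem h1]; exact ⟨hzx, hzy⟩
      · have h2 : u.Reaches (u.edge z) (Sum.inr ⟨ζ, h1⟩) := hζ
        refine Or.inl ⟨⟨ζ, h1⟩, rfl, ?_⟩
        rw [SimpleGraph.Walk.support_cons, List.mem_cons]
        refine (u.eq_or_eq_of_reaches hn hz h.ne hzx hzy h2).imp_right fun h3 => ?_
        rw [h3]; exact w.start_mem_support
    · exact Or.inl ⟨p, rfl, by rw [SimpleGraph.Walk.support_cons]; exact List.mem_cons_of_mem _ hp⟩
    · refine Or.inr ⟨hζ, a, b, ?_, ha, hb⟩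
      rw [SimpleGraph.Walk.edges_cons]; exact List.mem_cons_of_mem _ hab

lemma nodeSet_subset_closure {u : HarmonicPoly n} {E : Set ℂ} {x : u.Vertex}
    (h : u.Reaches E x) : u.nodeSet x ⊆ closure E := by
  rcases x with k | p
  · exact empty_subset _
  · exact singleton_subset_iff.2 h

lemma hull_subset_zeroSet (u : HarmonicPoly n) {x y : u.Vertex} (w : u.forestGraph.Walk x y) :
    u.hull w ⊆ u.zeroSet := by
  rintro z (⟨p, rfl, -⟩ | ⟨hz, -⟩)
  · exact p.2.1
  · exact u.regularSet_subset hz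

lemma isClosed_nodeSet (u : HarmonicPoly n) (x : u.Vertex) : IsClosed (u.nodeSet x) := by
  rcases x with k | p
  · exact isClosed_empty
  · exact isClosed_singleton

lemma isClosed_hull (hn : 1 ≤ n) (u : HarmonicPoly n) {x y : u.Vertex}
    (w : u.forestGraph.Walk x y) : IsClosed (u.hull w) := by
  induction w with
  | nil => rw [hull_nil]; exact u.isClosed_nodeSet _
  | cons h w ih =>
    obtain ⟨-, z, hz, hzx, hzy⟩ := adj_iff.1 h
    rw [u.hull_cons hn h w hz hzx hzy]
    exact ((u.isClosed_nodeSet _).union isClosed_closure).union ih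

lemma isPreconnected_hull (hn : 1 ≤ n) (u : HarmonicPoly n) {x y : u.Vertex}
    (w : u.forestGraph.Walk x y) : IsPreconnected (u.hull w) := by
  induction w with
  | @nil x =>
    rw [hull_nil]
    rcases x with k | p
    · exact isPreconnected_empty
    · exact isPreconnected_singleton
  | @cons x y v h w ih =>
    obtain ⟨-, z, hz, hzx, hzy⟩ := adj_iff.1 h
    rw [u.hull_cons hn h w hz hzx hzy, union_eq_right.2 (nodeSet_subset_closure hzx)]
    have hE := (u.isPreconnected_edge z).closure
    rcases y with k | p
    -- From a leaf a walk can only turn back along the edge on which it came, so the remaining hull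
    -- contains that edge.
    · cases w with
      | nil => rw [hull_nil]; simpa [nodeSet] using hE
      | cons h' w' =>
        obtain ⟨-, z', hz', hz'x, hz'y⟩ := adj_iff.1 h'
        refine hE.union z (subset_closure (mem_edge_self hz)) ?_ ih
        rw [u.hull_cons hn h' w' hz' hz'x hz'y, u.edge_eq_of_reaches_leaf hn hz' hz hz'x hzy]
        exact Or.inl (Or.inr (subset_closure (mem_edge_self hz)))
    · exact hE.union (p : ℂ) hzy (Or.inl ⟨p, rfl, w.start_mem_support⟩) ih

lemma isBounded_hull (hn : 1 ≤ n) (u : HarmonicPoly n) {x y : u.Vertex}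
    (w : u.forestGraph.Walk x y) (hw : ∀ v ∈ w.support, ∃ p, v = Sum.inr p) :
    Bornology.IsBounded (u.hull w) := by
  induction w with
  | @nil x =>
    obtain ⟨p, rfl⟩ := hw x (by simp)
    rw [hull_nil]
    exact Bornology.isBounded_singleton
  | @cons x y v h w ih =>
    obtain ⟨-, z, hz, hzx, hzy⟩ := adj_iff.1 h
    rw [u.hull_cons hn h w hz hzx hzy, union_eq_right.2 (nodeSet_subset_closure hzx)]
    obtain ⟨p, rfl⟩ := hw x (by simp)
    obtain ⟨q, rfl⟩ := hw y (by simp)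
    refine (u.isBounded_edge_of_reaches hn hz (fun e => h.ne (by rw [e])) hzx hzy).closure.union
      (ih fun v hv => hw v ?_)
    rw [SimpleGraph.Walk.support_cons]; exact List.mem_cons_of_mem _ hv

/-- Leaves have only one neighbour, so a cycle runs through nodes only and its hull is bounded.
Without its first edge it would join the two ends of that edge off the edge. -/
lemma isAcyclic_forestGraph (hn : 1 ≤ n) (u : HarmonicPoly n) : u.forestGraph.IsAcyclic := by
  intro x c hc
  have hnode : ∀ v ∈ c.support, ∃ p, v = Sum.inr p := by
    intro v hv
    rcases v with k | p
    · exfalso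
      have h1 := hc.ncard_neighborSet_toSubgraph_eq_two hv
      obtain ⟨y, -, hy⟩ := u.existsUnique_adj_leaf hn k
      have h2 : c.toSubgraph.neighborSet (Sum.inl k) ⊆ {y} := fun v hv => hy v hv.adj_sub
      have h3 := ncard_le_ncard h2
      rw [h1, ncard_singleton] at h3
      omega
    · exact ⟨p, rfl⟩
  cases c with
  | nil => exact hc.ne_nil rfl
  | @cons _ y _ h w =>
    rw [SimpleGraph.Walk.cons_isCycle_iff] at hc
    obtain ⟨-, z, hz, hzx, hzy⟩ := adj_iff.1 h
    have hnode' : ∀ v ∈ w.support, ∃ p, v = Sum.inr p := fun v hv => hnode v (by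
      rw [SimpleGraph.Walk.support_cons]; exact List.mem_cons_of_mem _ hv)
    obtain ⟨p, rfl⟩ := hnode' x w.end_mem_support
    obtain ⟨q, rfl⟩ := hnode' y w.start_mem_support
    refine u.not_reaches_off_edge hn hz (fun e => h.ne (by rw [e])) hzx hzy
      (u.isPreconnected_hull hn w) (u.isBounded_hull hn w hnode') (u.hull_subset_zeroSet w)
      (Or.inl ⟨p, rfl, w.end_mem_support⟩) (Or.inl ⟨q, rfl, w.start_mem_support⟩) ?_
    rw [Set.disjoint_left]
    rintro ζ (⟨p', rfl, -⟩ | ⟨hζ, a, b, hab, ha, hb⟩) hζE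
    · exact not_mem_criticalSet (u.edge_subset z hζE) p'.2
    · rw [edge_eq_of_mem hζE] at ha hb
      have hne : a ≠ b := (w.adj_of_mem_edges hab).ne
      apply hc.2
      convert hab using 1
      rw [Sym2.eq_iff]
      rcases u.eq_or_eq_of_reaches hn hz h.ne hzx hzy ha with h1 | h1 <;>
        rcases u.eq_or_eq_of_reaches hn hz h.ne hzx hzy hb with h2 | h2 <;> simp_all

/-- Neighbours correspond to edges at the node: an edge has two distinct ends and is determined by
them. -/
lemma ncard_neighborSet_node (hn : 1 ≤ n) (u : HarmonicPoly n) (p : u.criticalSet) :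
    (u.forestGraph.neighborSet (Sum.inr p)).ncard = 2 * (u.multiplicity p + 1) := by
  rw [← u.ncard_edges_at_node hn p]
  have hex : ∀ y ∈ u.forestGraph.neighborSet (Sum.inr p), ∃ z ∈ u.regularSet,
      u.Reaches (u.edge z) (Sum.inr p) ∧ u.Reaches (u.edge z) y := fun y hy => (adj_iff.1 hy).2
  choose! f hf hfp hfy using hex
  refine ncard_congr (fun y _ => u.edge (f y)) ?_ ?_ ?_
  · intro y hy
    exact ⟨f y, hf y hy, rfl, hfp y hy⟩
  · intro y y' hy hy' h
    have h1 := hfy y' hy'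
    rw [← h] at h1
    exact ((u.eq_or_eq_of_reaches hn (hf y hy) (adj_iff.1 hy).1 (hfp y hy) (hfy y hy)
      h1).resolve_left (adj_iff.1 hy').1.symm).symm
  · rintro E ⟨z, hz, rfl, hzp⟩
    obtain ⟨a, b, hab, -, -, hr⟩ := u.exists_ends hn hz
    obtain ⟨y, hy, hzy⟩ : ∃ y, Sum.inr p ≠ y ∧ u.Reaches (u.edge z) y := by
      rcases (hr _).1 hzp with h | h
      · exact ⟨b, h ▸ hab, (hr b).2 (Or.inr rfl)⟩
      · exact ⟨a, h ▸ hab.symm, (hr a).2 (Or.inl rfl)⟩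
    have hadj : y ∈ u.forestGraph.neighborSet (Sum.inr p) := adj_iff.2 ⟨hy, z, hz, hzp, hzy⟩
    exact ⟨y, hadj, u.edge_eq_of_reaches hn (hf y hadj) hz hy (hfp y hadj) (hfy y hadj) hzp hzy⟩

lemma reaches_leaf_mono {u : HarmonicPoly n} {E F : Set ℂ} (h : E ⊆ F) {k : Fin (2 * n)}
    (hE : u.Reaches E (Sum.inl k)) : u.Reaches F (Sum.inl k) := by
  obtain ⟨s, h1, h2⟩ := hE
  exact ⟨s, fun m => h (h1 m), h2⟩

lemma reaches_hull_start (hn : 1 ≤ n) (u : HarmonicPoly n) {k : Fin (2 * n)} {y : u.Vertex}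
    (hy : Sum.inl k ≠ y) (w : u.forestGraph.Walk (Sum.inl k) y) :
    u.Reaches (u.hull w) (Sum.inl k) := by
  cases w with
  | nil => exact absurd rfl hy
  | cons h w =>
    obtain ⟨-, z, hz, hzx, hzy⟩ := adj_iff.1 h
    refine reaches_leaf_mono ?_ hzx
    rw [u.hull_cons hn h w hz hzx hzy]
    exact fun ζ hζ => Or.inl (Or.inr (subset_closure hζ))

lemma hull_reverse (u : HarmonicPoly n) {x y : u.Vertex} (w : u.forestGraph.Walk x y) :
    u.hull w.reverse = u.hull w := by
  ext z; simp [hull]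

lemma disjoint_hull (hn : 1 ≤ n) (u : HarmonicPoly n) {x y x' y' : u.Vertex}
    (w : u.forestGraph.Walk x y) (w' : u.forestGraph.Walk x' y')
    (hd : List.Disjoint w.support w'.support) : Disjoint (u.hull w) (u.hull w') := by
  rw [Set.disjoint_left]
  rintro z (⟨p, rfl, hp⟩ | ⟨hz, a, b, hab, ha, hb⟩) (⟨q, hq, hq'⟩ | ⟨hz', a', b', hab', ha', hb'⟩)
  · rw [Subtype.ext hq] at hq'
    exact hd hp hq'
  · exact not_mem_criticalSet hz' p.2
  · rw [← hq] at hz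
    exact not_mem_criticalSet hz q.2
  · have h1 := w.fst_mem_support_of_mem_edges hab
    have h2 := w.snd_mem_support_of_mem_edges hab
    have h3 := w'.fst_mem_support_of_mem_edges hab'
    rcases u.eq_or_eq_of_reaches hn hz (w.adj_of_mem_edges hab).ne ha hb ha' with h | h
    · exact hd (h ▸ h1) h3
    · exact hd (h ▸ h2) h3

/-- Two disjoint walks between leaves do not cross. -/
lemma not_cycLt_of_disjoint_walks (hn : 1 ≤ n) (u : HarmonicPoly n) {a b c d : Fin (2 * n)}
    (w : u.forestGraph.Walk (Sum.inl a) (Sum.inl c))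
    (w' : u.forestGraph.Walk (Sum.inl b) (Sum.inl d))
    (hd : List.Disjoint w.support w'.support) : ¬ (CycLt a b c ∧ CycLt c d a) := by
  rintro ⟨h1, h2⟩
  have hac : a ≠ c := by rintro rfl; rcases h1 with h | h | h <;> omega
  have hbd : b ≠ d := by
    rintro rfl; rcases h1 with h | h | h <;> rcases h2 with h' | h' | h' <;> omega
  obtain ⟨δ', hδ', hsep'⟩ := u.exists_leafDir_sep hn
  obtain ⟨R, hR, hfar⟩ := u.exists_radius_reaches hn (δ := δ' / 3) (by positivity)
    (fun k l hkl => by rw [mul_div_cancel₀ _ (by norm_num : (3 : ℝ) ≠ 0)]; exact hsep' k l hkl)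
  -- A far point of the hull of `w` close to direction `e` lies on an edge that reaches the leaf
  -- `e`. Then `e` is one of the two ends of a step of `w`, although it belongs to `w'`.
  have hK : ∀ e : Fin (2 * n), Sum.inl e ∈ w'.support → ∀ ζ ∈ u.hull w, R < ‖ζ‖ →
      δ' / 3 ≤ dist (ζ / (‖ζ‖ : ℂ)) (u.leafDir e) := by
    intro e he ζ hζ hRζ
    by_contra hcon
    obtain ⟨hreg, -, h3⟩ := hfar ζ (u.hull_subset_zeroSet w hζ) hRζ
    have h4 := h3 e (not_le.1 hcon)
    rcases hζ with ⟨p, rfl, -⟩ | ⟨-, a', b', hab, ha, hb⟩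
    · exact not_mem_criticalSet hreg p.2
    · rcases u.eq_or_eq_of_reaches hn hreg (w.adj_of_mem_edges hab).ne ha hb h4 with h | h
      · exact hd (h ▸ w.fst_mem_support_of_mem_edges hab) he
      · exact hd (h ▸ w.snd_mem_support_of_mem_edges hab) he
  have hne : ∀ {e f : Fin (2 * n)}, Sum.inl e ∈ w.support → Sum.inl f ∈ w'.support → e ≠ f := by
    rintro e f he hf rfl
    exact hd he hf
  have key := u.not_interlaced_of_disjoint hn (u.isClosed_hull hn w) (u.isPreconnected_hull hn w)
    (u.isPreconnected_hull hn w') (u.disjoint_hull hn w w' hd) (a := a) (b := b) (c := c) (d := d)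
    (hne w.start_mem_support w'.start_mem_support) (hne w.start_mem_support w'.end_mem_support)
    (hne w.end_mem_support w'.start_mem_support) (hne w.end_mem_support w'.end_mem_support)
    (u.reaches_hull_start hn (fun h => hac (Sum.inl_injective h)) w)
    (by
      rw [← hull_reverse]
      exact u.reaches_hull_start hn (fun h => hac (Sum.inl_injective h).symm) w.reverse)
    (u.reaches_hull_start hn (fun h => hbd (Sum.inl_injective h)) w')
    (by
      rw [← hull_reverse]
      exact u.reaches_hull_start hn (fun h => hbd (Sum.inl_injective h).symm) w'.reverse)
    hR (by positivity) (hK b w'.start_mem_support) (hK d w'.end_mem_support)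
  unfold CycLt at h1 h2
  split_ifs at key <;> omega

end HarmonicPoly

end

/-! ### Forests: cutting an edge, parity, counting -/

section

open Set

namespace SimpleGraph

variable {V : Type*} {G : SimpleGraph V}

lemma Walk.reachable_deleteEdges {v w : V} (p : G.Walk v w) {e : Sym2 V} (he : e ∉ p.edges) :
    (G.deleteEdges {e}).Reachable v w := (p.toDeleteEdge e he).reachable

lemma Walk.reachable_deleteEdges_of_mem_support {v w a : V} (p : G.Walk v w) {e : Sym2 V}
    (he : e ∉ p.edges) (ha : a ∈ p.support) : (G.deleteEdges {e}).Reachable v a := by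
  classical
  exact (p.takeUntil a ha).reachable_deleteEdges fun h => he (p.edges_takeUntil_subset_edges ha h)

lemma deleteEdges_reachable {e : Sym2 V} {v w : V} (h : (G.deleteEdges {e}).Reachable v w) :
    G.Reachable v w := h.mono (deleteEdges_le _)

lemma Reachable.deleteEdges_or {x y v : V} (h : G.Reachable v x) :
    (G.deleteEdges {s(x, y)}).Reachable v x ∨ (G.deleteEdges {s(x, y)}).Reachable v y := by
  obtain ⟨p⟩ := h
  generalize hb : s(x, y) = e
  have key : ∀ {v w : V} (p : G.Walk v w), (G.deleteEdges {e}).Reachable w x ∨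
      (G.deleteEdges {e}).Reachable w y → (G.deleteEdges {e}).Reachable v x ∨
      (G.deleteEdges {e}).Reachable v y := by
    intro v w p
    induction p with
    | nil => exact id
    | @cons a b c hab p ih =>
      intro h
      by_cases he : s(a, b) = e
      · rw [← hb, Sym2.eq_iff] at he
        rcases he with ⟨rfl, rfl⟩ | ⟨rfl, rfl⟩
        · exact Or.inl (Reachable.refl _)
        · exact Or.inr (Reachable.refl _)
      · have h1 : (G.deleteEdges {e}).Adj a b := by
          rw [deleteEdges_adj]; exact ⟨hab, he⟩
        exact (ih h).imp h1.reachable.trans h1.reachable.trans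
  exact key p (Or.inl (Reachable.refl _))

/-- Paths in a forest are unique, so a path that survives the deletion must be the given one.
Questions about paths thereby become questions about reachability. -/
lemma IsAcyclic.mem_edges_iff (hG : G.IsAcyclic) {v w : V} {p : G.Walk v w} (hp : p.IsPath)
    {e : Sym2 V} : e ∈ p.edges ↔ ¬ (G.deleteEdges {e}).Reachable v w := by
  constructor
  · intro he h
    obtain ⟨q, hq⟩ := h.exists_isPath
    have h1 := congrArg Subtype.val ((hG.subsingleton_path v w).elim ⟨p, hp⟩
      ⟨q.mapLe (deleteEdges_le _), hq.mapLe _⟩)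
    simp only at h1
    rw [h1, Walk.edges_mapLe_eq_edges] at he
    have h2 := q.edges_subset_edgeSet he
    rw [edgeSet_deleteEdges] at h2
    exact h2.2 rfl
  · intro h
    by_contra he
    exact h (p.reachable_deleteEdges he)

lemma IsAcyclic.not_reachable_deleteEdges (hG : G.IsAcyclic) {x y : V} (h : G.Adj x y) :
    ¬ (G.deleteEdges {s(x, y)}).Reachable x y := by
  have h1 : (Walk.cons h Walk.nil : G.Walk x y).IsPath := by simp [h.ne]
  exact (hG.mem_edges_iff h1).1 (by simp)

/-- Deleting one edge splits a component into at most two pieces, so two vertices outside the piece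
of `a` share the other piece. -/
lemma reachable_deleteEdges_of_not {e : Sym2 V} {a b c : V} (hab : G.Reachable a b)
    (hac : G.Reachable a c) (h1 : ¬ (G.deleteEdges {e}).Reachable a b)
    (h2 : ¬ (G.deleteEdges {e}).Reachable a c) : (G.deleteEdges {e}).Reachable b c := by
  induction e with | _ x y
  obtain ⟨p⟩ := hab
  have he : s(x, y) ∈ p.edges := by
    by_contra he
    exact h1 (p.reachable_deleteEdges he)
  classical
  have hax : G.Reachable a x := (p.takeUntil x (p.fst_mem_support_of_mem_edges he)).reachable
  rcases hax.deleteEdges_or (y := y) with ha | ha <;>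
    rcases (p.reachable.symm.trans hax).deleteEdges_or (y := y) with hb | hb <;>
    rcases (hac.symm.trans hax).deleteEdges_or (y := y) with hc | hc
  all_goals first
    | exact absurd (ha.trans hb.symm) h1
    | exact absurd (ha.trans hc.symm) h2
    | exact hb.trans hc.symm

/-- The edges with an endpoint in `S`. -/
def touching (G : SimpleGraph V) (S : Set V) : SimpleGraph V where
  Adj u v := G.Adj u v ∧ (u ∈ S ∨ v ∈ S)
  symm := ⟨fun _ _ h => ⟨h.1.symm, h.2.symm⟩⟩
  loopless := ⟨fun _ h => h.1.ne rfl⟩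

lemma neighborSet_touching_of_mem {S : Set V} {v : V} (hv : v ∈ S) :
    (G.touching S).neighborSet v = G.neighborSet v := by
  ext w; simp [touching, hv]

section Parity

variable [Finite V]

lemma even_ncard_odd (G : SimpleGraph V) : Even {v | Odd (G.neighborSet v).ncard}.ncard := by
  classical
  have := Fintype.ofFinite V
  have h := G.even_card_odd_degree_vertices
  convert h using 1
  rw [Set.ncard_eq_toFinset_card']
  congr 1
  ext v
  simp [← card_neighborSet_eq_degree, Set.ncard_eq_toFinset_card']

lemma even_ncard_odd_of_closed {S : Set V} (hS : ∀ v ∈ S, ∀ w, G.Adj v w → w ∈ S) :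
    Even {v | v ∈ S ∧ Odd (G.neighborSet v).ncard}.ncard := by
  convert (G.touching S).even_ncard_odd using 3
  ext v
  by_cases hv : v ∈ S
  · simp [neighborSet_touching_of_mem hv, hv]
  · have : (G.touching S).neighborSet v = ∅ := by
      ext w
      simp only [touching, mem_neighborSet, mem_empty_iff_false, iff_false, not_and, not_or]
      exact fun h => ⟨hv, fun hw => hv (hS w hw v h.symm)⟩
    simp [hv, this]

/-- The handshake lemma for `touching S`: outside `S` this graph has a single vertex of nonzero
degree, namely `y`, of degree one. -/
lemma odd_ncard_odd_of_one_edge {S : Set V} {x y : V} (hxy : G.Adj x y) (hx : x ∈ S) (hy : y ∉ S)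
    (hS : ∀ v ∈ S, ∀ w, w ∉ S → G.Adj v w → v = x ∧ w = y) :
    Odd {v | v ∈ S ∧ Odd (G.neighborSet v).ncard}.ncard := by
  have h := (G.touching S).even_ncard_odd
  have h1 : {v | Odd ((G.touching S).neighborSet v).ncard} =
      insert y {v | v ∈ S ∧ Odd (G.neighborSet v).ncard} := by
    ext v
    by_cases hv : v ∈ S
    · have : v ≠ y := fun e => hy (e ▸ hv)
      simp [neighborSet_touching_of_mem hv, hv, this]
    · by_cases hvy : v = y
      · have : (G.touching S).neighborSet v = {x} := by
          ext w
          simp only [touching, mem_neighborSet, mem_singleton_iff]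
          constructor
          · rintro ⟨h2, h3⟩
            exact (hS w (h3.resolve_left hv) v hv h2.symm).1
          · rintro rfl
            exact ⟨hvy ▸ hxy.symm, Or.inr hx⟩
        subst hvy
        simp [this]
      · have : (G.touching S).neighborSet v = ∅ := by
          ext w
          simp only [touching, mem_neighborSet, mem_empty_iff_false, iff_false, not_and, not_or]
          exact fun h => ⟨hv, fun hw => hvy (hS w hw v hv h.symm).2⟩
        simp [hv, hvy, this]
  rw [h1, Set.ncard_insert_of_notMem (fun h => hy h.1)] at h
  rwa [Nat.even_add_one, Nat.not_even_iff_odd] at h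

end Parity

section Count

/-- In a forest every vertex other than the chosen root of its tree has exactly one edge towards
the root. -/
lemma IsAcyclic.existsUnique_parent (hG : G.IsAcyclic) {v r : V} (h : G.Reachable v r)
    (hne : v ≠ r) : ∃! y, G.Adj v y ∧ ¬ (G.deleteEdges {s(v, y)}).Reachable v r := by
  obtain ⟨p, hp⟩ := h.exists_isPath
  have hnil : ¬ p.Nil := Walk.not_nil_of_ne hne
  refine ⟨p.snd, ⟨p.adj_snd hnil, (hG.mem_edges_iff hp).1 ?_⟩, ?_⟩
  · exact p.mk_start_snd_mem_edges hnil
  · rintro y ⟨hy, hy'⟩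
    have h1 := (hG.mem_edges_iff hp).2 hy'
    exact hG.eq_snd_of_adj_start hp hy (p.snd_mem_support_of_mem_edges h1)

/-- Choose a root in every component. Sending each other vertex to the edge that leads towards its
root is a bijection onto the edges. -/
lemma IsAcyclic.card_eq [Finite V] (hG : G.IsAcyclic) :
    Nat.card V = G.edgeSet.ncard + Nat.card G.ConnectedComponent := by
  set root : V → V := fun v => (G.connectedComponentMk v).out with hroot
  have hr : ∀ v, G.Reachable v (root v) := fun v =>
    (ConnectedComponent.exact (Quot.out_eq (G.connectedComponentMk v))).symm
  have hadj : ∀ {v w}, G.Reachable v w → root v = root w := fun h => by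
    simp only [hroot]; rw [ConnectedComponent.sound h]
  have h1 : {v | v = root v}.ncard = Nat.card G.ConnectedComponent := by
    rw [← Set.ncard_univ G.ConnectedComponent]
    refine Set.ncard_congr (fun v _ => G.connectedComponentMk v) (fun _ _ => mem_univ _) ?_ ?_
    · intro v w hv hw h
      exact (mem_ofPred.1 hv).trans ((hadj (ConnectedComponent.exact h)).trans hw.symm)
    · intro c _
      refine ⟨c.out, ?_, Quot.out_eq c⟩
      show c.out = (G.connectedComponentMk c.out).out
      rw [show G.connectedComponentMk c.out = c from Quot.out_eq c]
  have h2 : {v | v ≠ root v}.ncard = G.edgeSet.ncard := by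
    have hex : ∀ v, v ≠ root v → ∃ y, G.Adj v y ∧
        ¬ (G.deleteEdges {s(v, y)}).Reachable v (root v) := fun v hv =>
      (hG.existsUnique_parent (hr v) hv).exists
    choose! f hf hf' using hex
    refine Set.ncard_congr (fun v _ => s(v, f v)) (fun v hv => hf v hv) ?_ ?_
    · intro v w hv hw h
      rcases Sym2.eq_iff.1 h with ⟨h, -⟩ | ⟨h3, h4⟩
      · exact h
      · exfalso
        have h5 := hf' v hv
        have h6 := hf' w hw
        rw [← h] at h6
        rw [← hadj (show G.Reachable v w from h4 ▸ (hf v hv).reachable)] at h6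
        refine hG.not_reachable_deleteEdges (hf v hv) ?_
        rw [h4] at h5 ⊢
        rw [h4] at h6
        exact reachable_deleteEdges_of_not (hr v).symm
          ((hr v).symm.trans (h4 ▸ (hf v hv).reachable)) (fun h => h5 h.symm) (fun h => h6 h.symm)
    · intro e he
      induction e with | _ x y
      have hxy : G.Adj x y := he
      have hrt := hadj hxy.reachable
      have key : ∀ {x y : V} (hxy : G.Adj x y),
          ¬ (G.deleteEdges {s(x, y)}).Reachable x (root x) → s(x, f x) = s(x, y) := by
        intro x y hxy h
        have hne : x ≠ root x := fun e => h (by rw [← e])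
        rw [(hG.existsUnique_parent (hr x) hne).unique ⟨hf x hne, hf' x hne⟩ ⟨hxy, h⟩]
      by_cases h : (G.deleteEdges {s(x, y)}).Reachable x (root x)
      · have h3 : ¬ (G.deleteEdges {s(y, x)}).Reachable y (root y) := by
          rw [Sym2.eq_swap, ← hrt]
          exact fun h4 => hG.not_reachable_deleteEdges hxy (h.trans h4.symm)
        refine ⟨y, fun e => h3 (by rw [← e]), (key hxy.symm h3).trans Sym2.eq_swap⟩
      · exact ⟨x, fun e => h (by rw [← e]), key hxy h⟩
  rw [← h1, ← h2, add_comm, ← Set.ncard_univ, ← Set.ncard_union_eq]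
  · congr 1; ext v; simp [em]
  · rw [Set.disjoint_left]; intro v hv hv'; exact hv' hv

end Count

end SimpleGraph

end

/-! ### Chord diagrams: next leaves and the paths to them -/

section

open Set

/-- The number of counterclockwise steps from `a` to `b`. -/
def cycDist {N : ℕ} (a b : Fin N) : ℕ := if a ≤ b then b - a else b + N - a

lemma CycLt.asymm {N : ℕ} {a b c : Fin N} (h : CycLt a b c) : ¬ CycLt a c b := by
  unfold CycLt at *; omega

lemma CycLt.rotate {N : ℕ} {a b c : Fin N} (h : CycLt a b c) : CycLt b c a := by
  unfold CycLt at *; omega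

lemma cycLt_of_not {N : ℕ} {a b c : Fin N} (hab : a ≠ b) (hac : a ≠ c) (hbc : b ≠ c)
    (h : ¬ CycLt a b c) : CycLt a c b := by
  unfold CycLt at *; omega

/-- A pair at minimal counterclockwise distance works, as a point of either set in between would
give a closer pair. -/
lemma exists_no_cycLt {N : ℕ} {A B : Set (Fin N)} (hA : A.Nonempty) (hB : B.Nonempty) :
    ∃ a ∈ A, ∃ b ∈ B, ∀ z ∈ A ∪ B, ¬ CycLt a z b := by
  obtain ⟨⟨a, b⟩, ⟨ha, hb⟩, hmin⟩ := (Set.toFinite (A ×ˢ B)).exists_minimalFor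
    (fun q : Fin N × Fin N => cycDist q.1 q.2) _ (hA.prod hB)
  refine ⟨a, ha, b, hb, fun z hz h => ?_⟩
  rcases hz with hz | hz
  · have h1 := hmin (j := (z, b)) ⟨hz, hb⟩
    unfold CycLt at h
    simp only [cycDist] at h1
    split_ifs at h1 <;> omega
  · have h1 := hmin (j := (a, z)) ⟨ha, hz⟩
    unfold CycLt at h
    simp only [cycDist] at h1
    split_ifs at h1 <;> omega

lemma even_ncard_cycLt_iff {N : ℕ} (hN : Even N) {x y : Fin N} (hxy : x ≠ y) :
    Even {z | CycLt x z y}.ncard ↔ (x : ℕ) % 2 ≠ (y : ℕ) % 2 := by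
  rcases lt_or_gt_of_ne hxy with h | h
  · have : {z | CycLt x z y} = ((Finset.Ioo x y : Finset (Fin N)) : Set (Fin N)) := by
      ext z; simp only [CycLt, mem_ofPred_eq, Finset.coe_Ioo, mem_Ioo]; omega
    rw [this, Set.ncard_coe_finset, Fin.card_Ioo, Nat.even_iff]
    omega
  · have : {z | CycLt x z y} = ((Finset.univ \ Finset.Icc y x : Finset (Fin N)) : Set (Fin N)) := by
      ext z
      simp only [CycLt, mem_ofPred_eq, Finset.coe_sdiff, Finset.coe_univ, Finset.coe_Icc, mem_sdiff,
        mem_univ, mem_Icc, true_and]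
      omega
    rw [this, Set.ncard_coe_finset, Finset.card_sdiff_of_subset (Finset.subset_univ _),
      Fin.card_Icc, Finset.card_univ, Fintype.card_fin, Nat.even_iff]
    obtain ⟨m, rfl⟩ := hN
    omega

/-- A combinatorial chord diagram on `2 n` numbered leaves with inner nodes in `C`. -/
structure ChordDiagram {n : ℕ} {C : Type*} (G : SimpleGraph (Fin (2 * n) ⊕ C)) : Prop where
  acyclic : G.IsAcyclic
  leaf : ∀ k, ∃! y, G.Adj (Sum.inl k) y
  even : ∀ p, Even (G.neighborSet (Sum.inr p)).ncard
  four_le : ∀ p, 4 ≤ (G.neighborSet (Sum.inr p)).ncard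
  noncrossing : ∀ {a b c d : Fin (2 * n)} (w : G.Walk (Sum.inl a) (Sum.inl c))
    (w' : G.Walk (Sum.inl b) (Sum.inl d)), List.Disjoint w.support w'.support →
    ¬ (CycLt a b c ∧ CycLt c d a)

/-- The leaf to which the letter `i` belongs. -/
def outLeaf {n : ℕ} (i : Fin n) : Fin (2 * n) := ⟨2 * (i : ℕ), by have := i.isLt; omega⟩

/-- The `i`-th of the other leaves. -/
def inLeaf {n : ℕ} (i : Fin n) : Fin (2 * n) := ⟨2 * (i : ℕ) + 1, by have := i.isLt; omega⟩

lemma outLeaf_injective {n : ℕ} : Function.Injective (outLeaf (n := n)) := by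
  intro i j h
  simp only [outLeaf, Fin.mk.injEq] at h
  omega

lemma inLeaf_injective {n : ℕ} : Function.Injective (inLeaf (n := n)) := by
  intro i j h
  simp only [inLeaf, Fin.mk.injEq] at h
  omega

lemma outLeaf_ne_inLeaf {n : ℕ} (i j : Fin n) : outLeaf i ≠ inLeaf j := by
  intro h
  simp only [outLeaf, inLeaf, Fin.mk.injEq] at h
  omega

lemma exists_outLeaf {n : ℕ} {k : Fin (2 * n)} (h : (k : ℕ) % 2 = 0) : ∃ i, outLeaf i = k :=
  ⟨⟨k / 2, by omega⟩, by simp only [outLeaf]; ext; simp only; omega⟩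

lemma exists_inLeaf {n : ℕ} {k : Fin (2 * n)} (h : (k : ℕ) % 2 = 1) : ∃ i, inLeaf i = k :=
  ⟨⟨k / 2, by omega⟩, by simp only [inLeaf]; ext; simp only; omega⟩

/-- Counterclockwise from `x`, the leaf `y` is the next one in the same tree. -/
structure IsNext {n : ℕ} {C : Type*} (G : SimpleGraph (Fin (2 * n) ⊕ C)) (x y : Fin (2 * n)) :
    Prop where
  ne : x ≠ y
  reachable : G.Reachable (Sum.inl x) (Sum.inl y)
  not_cycLt : ∀ z, G.Reachable (Sum.inl x) (Sum.inl z) → ¬ CycLt x z y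

section Next

variable {n : ℕ} {C : Type*} {G : SimpleGraph (Fin (2 * n) ⊕ C)}

lemma IsNext.right_unique {x y y' : Fin (2 * n)} (h : IsNext G x y) (h' : IsNext G x y') :
    y = y' := by
  by_contra hne
  exact h.not_cycLt _ h'.reachable
    (cycLt_of_not h.ne h'.ne hne (h'.not_cycLt _ h.reachable))

lemma IsNext.left_unique {x x' y : Fin (2 * n)} (h : IsNext G x y) (h' : IsNext G x' y) :
    x = x' := by
  by_contra hne
  have h1 := h.not_cycLt _ (h.reachable.trans h'.reachable.symm)
  have h2 := h'.not_cycLt _ (h'.reachable.trans h.reachable.symm)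
  have h3 := cycLt_of_not hne h.ne h'.ne h1
  exact h2 h3.rotate.rotate

namespace ChordDiagram

lemma not_cross (hd : ChordDiagram G) {G' : SimpleGraph (Fin (2 * n) ⊕ C)} (hle : G' ≤ G)
    {a b c d : Fin (2 * n)} (h1 : G'.Reachable (Sum.inl a) (Sum.inl c))
    (h2 : G'.Reachable (Sum.inl b) (Sum.inl d)) (h3 : ¬ G'.Reachable (Sum.inl a) (Sum.inl b)) :
    ¬ (CycLt a b c ∧ CycLt c d a) := by
  obtain ⟨p⟩ := h1
  obtain ⟨q⟩ := h2
  refine hd.noncrossing (p.mapLe hle) (q.mapLe hle) ?_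
  rw [SimpleGraph.Walk.support_mapLe_eq_support, SimpleGraph.Walk.support_mapLe_eq_support]
  intro v hv hv'
  classical
  exact h3 ((p.takeUntil v hv).reachable.trans (q.takeUntil v hv').reachable.symm)

lemma ncard_neighborSet_leaf (hd : ChordDiagram G) (k : Fin (2 * n)) :
    (G.neighborSet (Sum.inl k)).ncard = 1 := by
  obtain ⟨y, hy, hy'⟩ := hd.leaf k
  rw [Set.ncard_eq_one]
  exact ⟨y, Set.ext fun v => ⟨hy' v, fun h => by rw [mem_singleton_iff.1 h]; exact hy⟩⟩

lemma ncard_odd_inter (hd : ChordDiagram G) (S : Set (Fin (2 * n) ⊕ C)) :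
    {v | v ∈ S ∧ Odd (G.neighborSet v).ncard}.ncard = {k | Sum.inl k ∈ S}.ncard := by
  rw [← Set.ncard_image_of_injective {k | Sum.inl k ∈ S} Sum.inl_injective]
  congr 1
  ext v
  rcases v with k | p
  · simp [hd.ncard_neighborSet_leaf]
  · simp [hd.even p]

variable [Finite C]

lemma even_leaves (hd : ChordDiagram G) {S : Set (Fin (2 * n) ⊕ C)}
    (hS : ∀ v ∈ S, ∀ w, G.Adj v w → w ∈ S) : Even {k | Sum.inl k ∈ S}.ncard := by
  rw [← hd.ncard_odd_inter]
  exact G.even_ncard_odd_of_closed hS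

/-- The leaves are exactly the vertices of odd degree, and only one edge leaves this side. -/
lemma odd_leaves_side (hd : ChordDiagram G) {x y : Fin (2 * n) ⊕ C} (h : G.Adj x y) :
    Odd {k | (G.deleteEdges {s(x, y)}).Reachable x (Sum.inl k)}.ncard := by
  have h1 := hd.ncard_odd_inter {v | (G.deleteEdges {s(x, y)}).Reachable x v}
  rw [show {k | (G.deleteEdges {s(x, y)}).Reachable x (Sum.inl k)} =
    {k | Sum.inl k ∈ {v | (G.deleteEdges {s(x, y)}).Reachable x v}} from rfl, ← h1]
  have hxy := hd.acyclic.not_reachable_deleteEdges h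
  refine G.odd_ncard_odd_of_one_edge h (SimpleGraph.Reachable.refl _) hxy ?_
  intro v hv w hw hvw
  by_cases he : s(v, w) = s(x, y)
  · rcases Sym2.eq_iff.1 he with h2 | ⟨rfl, rfl⟩
    · exact h2
    · exact absurd hv hxy
  · exfalso
    apply hw
    have : (G.deleteEdges {s(x, y)}).Adj v w := by
      rw [SimpleGraph.deleteEdges_adj]; exact ⟨hvw, he⟩
    exact SimpleGraph.Reachable.trans hv this.reachable

lemma exists_isNext (hd : ChordDiagram G) (x : Fin (2 * n)) : ∃ y, IsNext G x y := by
  have h1 : Even {k | Sum.inl k ∈ {v | G.Reachable (Sum.inl x) v}}.ncard :=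
    hd.even_leaves fun v hv w hvw => SimpleGraph.Reachable.trans hv hvw.reachable
  set T : Set (Fin (2 * n)) := {k | G.Reachable (Sum.inl x) (Sum.inl k)} with hT
  have hxT : x ∈ T := SimpleGraph.Reachable.refl _
  have h2 : (T \ {x}).Nonempty := by
    by_contra hcon
    have h3 : T = {x} := by
      ext k
      constructor
      · intro hk
        by_contra hkx
        exact hcon ⟨k, hk, hkx⟩
      · intro hk; rw [mem_singleton_iff.1 hk]; exact hxT
    have h4 : Even T.ncard := h1
    rw [h3, ncard_singleton] at h4
    exact absurd h4 (by decide)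
  obtain ⟨a, ha, b, hb, hab⟩ := exists_no_cycLt (singleton_nonempty x) h2
  rw [mem_singleton_iff] at ha
  subst ha
  refine ⟨b, fun h => hb.2 h.symm, hb.1, fun z hz h => ?_⟩
  by_cases hza : z = a
  · subst hza; unfold CycLt at h; omega
  · exact hab z (Or.inr ⟨hz, hza⟩) h

/-- A tree with a leaf strictly between `x` and `y` cannot leave this arc without crossing the tree
of `x`. So the leaves in the arc make up whole trees, each with an even number of leaves. -/
lemma parity_of_isNext (hd : ChordDiagram G) {x y : Fin (2 * n)} (h : IsNext G x y) :
    (x : ℕ) % 2 ≠ (y : ℕ) % 2 := by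
  rw [← even_ncard_cycLt_iff (even_two_mul n) h.ne]
  have h1 := hd.even_leaves (S := {v | ∃ z, CycLt x z y ∧ G.Reachable (Sum.inl z) v})
    (fun v ⟨z, hz, hzv⟩ w hvw => ⟨z, hz, hzv.trans hvw.reachable⟩)
  convert h1 using 3
  ext k
  refine ⟨fun hk => ⟨k, hk, SimpleGraph.Reachable.refl _⟩, ?_⟩
  rintro ⟨z, hz, hzk⟩
  by_contra hk
  have hxz : ¬ G.Reachable (Sum.inl x) (Sum.inl z) := fun h' => h.not_cycLt z h' hz
  have hkx : k ≠ x := by rintro rfl; exact hxz hzk.symm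
  have hky : k ≠ y := by rintro rfl; exact hxz (h.reachable.trans hzk.symm)
  refine hd.not_cross le_rfl h.reachable hzk hxz ⟨hz, ?_⟩
  exact (cycLt_of_not hkx.symm h.ne hky hk).rotate

lemma exists_perm (hd : ChordDiagram G) :
    ∃ σ : Equiv.Perm (Fin n), ∀ i, IsNext G (outLeaf i) (inLeaf (σ i)) := by
  have h1 : ∀ i : Fin n, ∃ k : Fin n, IsNext G (outLeaf i) (inLeaf k) := by
    intro i
    obtain ⟨y, hy⟩ := hd.exists_isNext (outLeaf i)
    have h2 := hd.parity_of_isNext hy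
    have h3 : ((outLeaf i : Fin (2 * n)) : ℕ) % 2 = 0 := by simp [outLeaf]
    obtain ⟨k, rfl⟩ := exists_inLeaf (k := y) (by omega)
    exact ⟨k, hy⟩
  choose f hf using h1
  have hinj : Function.Injective f := by
    intro i j hij
    have h2 := hf j
    rw [← hij] at h2
    exact outLeaf_injective ((hf i).left_unique h2)
  exact ⟨Equiv.ofBijective f (Finite.injective_iff_bijective.1 hinj), hf⟩

/-- The next leaf after the leaf of the letter `i` in its tree has the number `hd.perm i`. -/
noncomputable def perm (hd : ChordDiagram G) : Equiv.Perm (Fin n) := hd.exists_perm.choose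

lemma isNext (hd : ChordDiagram G) (i : Fin n) : IsNext G (outLeaf i) (inLeaf (hd.perm i)) :=
  hd.exists_perm.choose_spec i

/-- The path from the leaf of the letter `i` to the next leaf of the same tree. -/
noncomputable def path (hd : ChordDiagram G) (i : Fin n) :
    G.Walk (Sum.inl (outLeaf i)) (Sum.inl (inLeaf (hd.perm i))) :=
  (hd.isNext i).reachable.exists_isPath.choose

lemma isPath_path (hd : ChordDiagram G) (i : Fin n) : (hd.path i).IsPath :=
  (hd.isNext i).reachable.exists_isPath.choose_spec

lemma mem_edges_path (hd : ChordDiagram G) {i : Fin n} {e : Sym2 (Fin (2 * n) ⊕ C)} :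
    e ∈ (hd.path i).edges ↔ ¬ (G.deleteEdges {e}).Reachable (Sum.inl (outLeaf i))
      (Sum.inl (inLeaf (hd.perm i))) :=
  hd.acyclic.mem_edges_iff (hd.isPath_path i)

/-- A closest pair of leaves on the two sides of the cut edge is a pair of consecutive leaves. A
second such pair in the same direction would make the two sides, each connected without the cut
edge, interlace. -/
lemma exists_isNext_across (hd : ChordDiagram G) {x y : Fin (2 * n) ⊕ C} (h : G.Adj x y) :
    ∃ a b, (G.deleteEdges {s(x, y)}).Reachable x (Sum.inl a) ∧
      (G.deleteEdges {s(x, y)}).Reachable y (Sum.inl b) ∧ IsNext G a b ∧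
      ∀ c d, (G.deleteEdges {s(x, y)}).Reachable x (Sum.inl c) →
        (G.deleteEdges {s(x, y)}).Reachable y (Sum.inl d) → IsNext G c d → c = a := by
  have hxy := hd.acyclic.not_reachable_deleteEdges h
  have hA : {k | (G.deleteEdges {s(x, y)}).Reachable x (Sum.inl k)}.Nonempty :=
    Set.nonempty_of_ncard_ne_zero (hd.odd_leaves_side h).pos.ne'
  have hB : {k | (G.deleteEdges {s(x, y)}).Reachable y (Sum.inl k)}.Nonempty := by
    have := (hd.odd_leaves_side h.symm).pos.ne'
    rw [Sym2.eq_swap] at this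
    exact Set.nonempty_of_ncard_ne_zero this
  obtain ⟨a, ha, b, hb, hab⟩ := exists_no_cycLt hA hB
  have hx : ∀ {k}, (G.deleteEdges {s(x, y)}).Reachable x (Sum.inl k) → G.Reachable x (Sum.inl k) :=
    SimpleGraph.deleteEdges_reachable
  have hnext : IsNext G a b := by
    refine ⟨?_, ?_, ?_⟩
    · rintro rfl
      exact hxy (SimpleGraph.Reachable.trans ha (SimpleGraph.Reachable.symm hb))
    · exact (SimpleGraph.deleteEdges_reachable ha).symm.trans
        (h.reachable.trans (SimpleGraph.deleteEdges_reachable hb))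
    · intro z hz
      refine hab z ?_
      have h1 : G.Reachable (Sum.inl z) x := ((hx ha).trans hz).symm
      exact (h1.deleteEdges_or (y := y)).imp SimpleGraph.Reachable.symm SimpleGraph.Reachable.symm
  refine ⟨a, b, ha, hb, hnext, ?_⟩
  intro c d hc hd' hcd
  by_contra hne
  have hnot : ∀ {k l}, (G.deleteEdges {s(x, y)}).Reachable x (Sum.inl k) →
      (G.deleteEdges {s(x, y)}).Reachable y (Sum.inl l) → k ≠ l := by
    rintro k l hk hl rfl
    exact hxy (hk.trans hl.symm)
  refine hd.not_cross (SimpleGraph.deleteEdges_le {s(x, y)}) (a := a) (b := b) (c := c) (d := d)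
    (ha.symm.trans hc) (SimpleGraph.Reachable.trans (SimpleGraph.Reachable.symm hb) hd') ?_ ⟨?_, ?_⟩
  · intro h1
    exact hxy (ha.trans (h1.trans (SimpleGraph.Reachable.symm hb)))
  · exact cycLt_of_not (Ne.symm hne) hnext.ne (hnot hc hb)
      (hnext.not_cycLt c ((hx ha).symm.trans (hx hc)))
  · exact cycLt_of_not hne hcd.ne (hnot ha hd') (hcd.not_cycLt a ((hx hc).symm.trans (hx ha)))

/-- Passing to the next leaf switches parity and maps A \ {a} onto A \ {a'}, where A is the side of
`x`. If `a` and `b'` had equal parity, `a'` would have the other one; the two parity classes of A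
would then be equally large, but A has an odd number of leaves. -/
lemma parity_across (hd : ChordDiagram G) {x y : Fin (2 * n) ⊕ C} (h : G.Adj x y)
    {a b a' b' : Fin (2 * n)} (ha : (G.deleteEdges {s(x, y)}).Reachable x (Sum.inl a))
    (hb : (G.deleteEdges {s(x, y)}).Reachable y (Sum.inl b)) (hab : IsNext G a b)
    (ha' : (G.deleteEdges {s(x, y)}).Reachable x (Sum.inl a'))
    (hb' : (G.deleteEdges {s(x, y)}).Reachable y (Sum.inl b')) (hba : IsNext G b' a') :
    (a : ℕ) % 2 ≠ (b' : ℕ) % 2 := by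
  intro hpar
  have hxy := hd.acyclic.not_reachable_deleteEdges h
  set A : Set (Fin (2 * n)) := {k | (G.deleteEdges {s(x, y)}).Reachable x (Sum.inl k)} with hA
  set B : Set (Fin (2 * n)) := {k | (G.deleteEdges {s(x, y)}).Reachable y (Sum.inl k)} with hB
  have hAB : ∀ k ∈ A, k ∉ B := fun k hk hk' =>
    hxy (SimpleGraph.Reachable.trans hk (SimpleGraph.Reachable.symm hk'))
  have hodd : Odd A.ncard := hd.odd_leaves_side h
  have huA : ∀ c ∈ A, ∀ d ∈ B, IsNext G c d → c = a := by
    obtain ⟨a₀, b₀, -, -, -, hu⟩ := hd.exists_isNext_across h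
    intro c hc d hd' hcd
    rw [hu c d hc hd' hcd, hu a b ha hb hab]
  have huB : ∀ c ∈ B, ∀ d ∈ A, IsNext G c d → c = b' := by
    obtain ⟨a₀, b₀, -, -, -, hu⟩ := hd.exists_isNext_across h.symm
    rw [Sym2.eq_swap] at hu
    intro c hc d hd' hcd
    rw [hu c d hc hd' hcd, hu b' a' hb' ha' hba]
  have hmem : ∀ {k l}, IsNext G k l → (k ∈ A ∪ B ↔ l ∈ A ∪ B) := by
    intro k l hkl
    have h1 : ∀ j, j ∈ A ∪ B ↔ G.Reachable (Sum.inl j) x := fun j => by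
      constructor
      · rintro (hj | hj)
        · exact (SimpleGraph.deleteEdges_reachable hj).symm
        · exact (SimpleGraph.deleteEdges_reachable hj).symm.trans h.symm.reachable
      · intro hj
        exact (hj.deleteEdges_or (y := y)).imp SimpleGraph.Reachable.symm
          SimpleGraph.Reachable.symm
    rw [h1, h1]
    exact ⟨fun h2 => hkl.reachable.symm.trans h2, fun h2 => hkl.reachable.trans h2⟩
  choose N hN using hd.exists_isNext
  have hNinj : Function.Injective N := fun i j hij =>
    (hN i).left_unique (hij ▸ hN j : IsNext G j (N i))
  have hNsurj : Function.Surjective N := Finite.injective_iff_surjective.1 hNinj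
  set A₀ : Set (Fin (2 * n)) := {k | k ∈ A ∧ (k : ℕ) % 2 = (a : ℕ) % 2} with hA₀
  set A₁ : Set (Fin (2 * n)) := {k | k ∈ A ∧ (k : ℕ) % 2 ≠ (a : ℕ) % 2} with hA₁
  have haA₀ : a ∈ A₀ := ⟨ha, rfl⟩
  have haA₁ : a' ∈ A₁ := ⟨ha', by have := hd.parity_of_isNext hba; omega⟩
  have hbij : N '' (A₀ \ {a}) = A₁ \ {a'} := by
    ext l
    constructor
    · rintro ⟨k, ⟨⟨hk, hk'⟩, hka⟩, rfl⟩
      have h1 := hd.parity_of_isNext (hN k)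
      refine ⟨⟨?_, by omega⟩, ?_⟩
      · rcases (hmem (hN k)).1 (Or.inl hk) with h2 | h2
        · exact h2
        · exact absurd (huA k hk _ h2 (hN k)) hka
      · intro h2
        rw [mem_singleton_iff] at h2
        have h3 : k = b' := (hN k).left_unique (h2 ▸ hba)
        exact hAB k hk (h3 ▸ hb')
    · rintro ⟨⟨hl, hl'⟩, hla⟩
      obtain ⟨k, rfl⟩ := hNsurj l
      have h1 := hd.parity_of_isNext (hN k)
      have hkA : k ∈ A := by
        rcases (hmem (hN k)).2 (Or.inl hl) with h2 | h2
        · exact h2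
        · exfalso
          have h3 := huB k h2 _ hl (hN k)
          exact hla ((hN k).right_unique (h3 ▸ hba))
      refine ⟨k, ⟨⟨hkA, by omega⟩, ?_⟩, rfl⟩
      intro h2
      rw [mem_singleton_iff] at h2
      have h3 : N k = b := (hN k).right_unique (h2 ▸ hab)
      exact hAB _ hl (h3 ▸ hb)
  have hcard : (A₀ \ {a}).ncard = (A₁ \ {a'}).ncard := by
    rw [← hbij, Set.ncard_image_of_injective _ hNinj]
  have h0 := Set.ncard_sdiff_singleton_add_one haA₀
  have h1 := Set.ncard_sdiff_singleton_add_one haA₁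
  have hsum : A.ncard = A₀.ncard + A₁.ncard := by
    rw [← Set.ncard_union_eq]
    · congr 1
      ext k
      simp only [hA₀, hA₁, mem_union, mem_ofPred_eq, ← and_or_left]
      simp [em]
    · rw [Set.disjoint_left]
      exact fun k hk hk' => hk'.2 hk.2
  rw [hsum, ← h0, ← h1, hcard] at hodd
  exact (Nat.not_odd_iff_even.2 (Even.add_self _)) hodd

/-- A path contains `e` exactly if its end leaves lie on different sides of the cut. One pair of
consecutive leaves crosses `e` in each direction, and by `parity_across` exactly one of the two
pairs starts at a leaf of the form `outLeaf i`. -/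
theorem existsUnique_mem_edges (hd : ChordDiagram G) {e : Sym2 (Fin (2 * n) ⊕ C)}
    (he : e ∈ G.edgeSet) : ∃! i, e ∈ (hd.path i).edges := by
  have key : ∀ {x y : Fin (2 * n) ⊕ C}, G.Adj x y → ∀ {a b : Fin (2 * n)},
      (G.deleteEdges {s(x, y)}).Reachable x (Sum.inl a) →
      (G.deleteEdges {s(x, y)}).Reachable y (Sum.inl b) → IsNext G a b → (a : ℕ) % 2 = 0 →
      ∃! i, s(x, y) ∈ (hd.path i).edges := by
    intro x y h a b ha hb hab hpar
    have hxy := hd.acyclic.not_reachable_deleteEdges h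
    obtain ⟨b', a', hb', ha', hba, hu'⟩ := hd.exists_isNext_across h.symm
    rw [Sym2.eq_swap] at hb' ha' hu'
    obtain ⟨a₀, b₀, -, -, -, hu⟩ := hd.exists_isNext_across h
    have hne := hd.parity_across h ha hb hab ha' hb' hba
    obtain ⟨i, rfl⟩ := exists_outLeaf hpar
    obtain rfl := hab.right_unique (hd.isNext i)
    refine ⟨i, hd.mem_edges_path.2 fun h1 => hxy (ha.trans (h1.trans hb.symm)), ?_⟩
    intro j hj
    have h1 := hd.mem_edges_path.1 hj
    classical
    have h2 : G.Reachable (Sum.inl (outLeaf j)) x :=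
      ((hd.path j).takeUntil x ((hd.path j).fst_mem_support_of_mem_edges hj)).reachable
    have h3 : G.Reachable (Sum.inl (inLeaf (hd.perm j))) x :=
      (hd.isNext j).reachable.symm.trans h2
    rcases h2.deleteEdges_or (y := y) with h4 | h4 <;>
      rcases h3.deleteEdges_or (y := y) with h5 | h5
    · exact absurd (h4.trans h5.symm) h1
    · exact outLeaf_injective ((hu _ _ h4.symm h5.symm (hd.isNext j)).trans
        (hu _ _ ha hb hab).symm)
    · exfalso
      have h6 := hu' _ _ h4.symm h5.symm (hd.isNext j)
      apply hne
      rw [← h6]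
      simp [outLeaf]
    · exact absurd (h4.trans h5.symm) h1
  induction e with | _ x y
  have h : G.Adj x y := he
  obtain ⟨a, b, ha, hb, hab, -⟩ := hd.exists_isNext_across h
  obtain ⟨b', a', hb', ha', hba, -⟩ := hd.exists_isNext_across h.symm
  by_cases hpar : (a : ℕ) % 2 = 0
  · exact key h ha hb hab hpar
  · have h1 := key h.symm hb' ha' hba
    rw [Sym2.eq_swap] at hb' ha' h1
    have hne := hd.parity_across h ha hb hab ha' hb' hba
    exact h1 (by omega)

end ChordDiagram

end Next

end

/-! ### Blocks: the letters at a node, and reconstruction of the diagram -/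

section

open Set

namespace SimpleGraph

variable {V : Type*} {G : SimpleGraph V}

/-- The edge of the path by which it leaves the earlier vertex is the witness. -/
lemma Walk.IsPath.pairwise_separated {v w : V} {p : G.Walk v w} (hp : p.IsPath) :
    p.support.Pairwise fun a b => ∃ e ∈ p.edges, (G.deleteEdges {e}).Reachable v a ∧
      (G.deleteEdges {e}).Reachable b w := by
  induction p with
  | nil => simp
  | @cons v v' w h p ih =>
    rw [Walk.cons_isPath_iff] at hp
    have hnot : ∀ {e a b}, e ∈ p.edges → e = s(a, b) → v ≠ a := by
      rintro e a b he rfl rfl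
      exact hp.2 (p.fst_mem_support_of_mem_edges he)
    have he : s(v, v') ∉ p.edges := fun he => hnot he rfl rfl
    rw [Walk.support_cons, List.pairwise_cons]
    constructor
    · intro b hb
      refine ⟨s(v, v'), by simp, Reachable.refl _, ?_⟩
      exact (p.reachable_deleteEdges_of_mem_support he hb).symm.trans (p.reachable_deleteEdges he)
    · refine (ih hp.1).imp ?_
      rintro a b ⟨e, he', ha, hb⟩
      refine ⟨e, by simp [he'], ?_, hb⟩
      have : (G.deleteEdges {e}).Adj v v' := by
        rw [deleteEdges_adj]
        exact ⟨h, fun h1 => hnot he' (mem_singleton_iff.1 h1).symm rfl⟩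
      exact this.reachable.trans ha

lemma Walk.rel_or_rel_of_isChain {v w : V} (p : G.Walk v w) {R : V → V → Prop}
    (h : p.support.IsChain R) {x y : V} (he : s(x, y) ∈ p.edges) : R x y ∨ R y x := by
  induction p with
  | nil => simp at he
  | @cons v v' w hadj p ih =>
    rw [Walk.support_cons, ← Walk.cons_tail_support] at h
    rw [List.isChain_cons_cons] at h
    rw [Walk.edges_cons, List.mem_cons] at he
    rcases he with he | he
    · rcases Sym2.eq_iff.1 he with ⟨rfl, rfl⟩ | ⟨rfl, rfl⟩
      · exact Or.inl h.1
      · exact Or.inr h.1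
    · refine ih ?_ he
      rw [← Walk.cons_tail_support]
      exact h.2

end SimpleGraph

/-- The letters of two overlapping blocks are linked. -/
def Linked {n : ℕ} {C : Type*} (H : C → Finset (Fin n)) : Fin n → Fin n → Prop :=
  Relation.ReflTransGen fun i j => ∃ p, i ∈ H p ∧ j ∈ H p

lemma Linked.symm {n : ℕ} {C : Type*} {H : C → Finset (Fin n)} {i j : Fin n} (h : Linked H i j) :
    Linked H j i := by
  induction h with
  | refl => exact Relation.ReflTransGen.refl
  | tail _ h ih =>
    obtain ⟨p, h1, h2⟩ := h
    exact Relation.ReflTransGen.head ⟨p, h2, h1⟩ ih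

lemma linked_of_mem {n : ℕ} {C : Type*} {H : C → Finset (Fin n)} {i j : Fin n} {p : C}
    (hi : i ∈ H p) (hj : j ∈ H p) : Linked H i j := Relation.ReflTransGen.single ⟨p, hi, hj⟩

open Classical in
lemma exists_rep {n : ℕ} {C : Type*} (H : C → Finset (Fin n)) (i : Fin n) :
    ∃ j, Linked H i j ∧ ∀ k, Linked H i k → j ≤ k := by
  have h : (Finset.univ.filter fun j => Linked H i j).Nonempty :=
    ⟨i, Finset.mem_filter.2 ⟨Finset.mem_univ _, Relation.ReflTransGen.refl⟩⟩
  exact ⟨_, (Finset.mem_filter.1 (Finset.min'_mem _ h)).2, fun k hk =>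
    Finset.min'_le _ _ (Finset.mem_filter.2 ⟨Finset.mem_univ _, hk⟩)⟩

/-- The least letter linked to the given one. -/
noncomputable def blockRep {n : ℕ} {C : Type*} (H : C → Finset (Fin n)) (i : Fin n) : Fin n :=
  (exists_rep H i).choose

section Rep

variable {n : ℕ} {C : Type*} {H : C → Finset (Fin n)}

lemma linked_blockRep (H : C → Finset (Fin n)) (i : Fin n) : Linked H i (blockRep H i) :=
  (exists_rep H i).choose_spec.1

lemma blockRep_le {i j : Fin n} (h : Linked H i j) : blockRep H i ≤ j :=
  (exists_rep H i).choose_spec.2 j h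

lemma blockRep_eq_iff {i j : Fin n} : blockRep H i = blockRep H j ↔ Linked H i j := by
  constructor
  · intro h
    have h1 := linked_blockRep H i
    rw [h] at h1
    exact h1.trans (linked_blockRep H j).symm
  · intro h
    exact le_antisymm (blockRep_le (h.trans (linked_blockRep H j)))
      (blockRep_le (h.symm.trans (linked_blockRep H i)))

lemma blockRep_blockRep (i : Fin n) : blockRep H (blockRep H i) = blockRep H i :=
  blockRep_eq_iff.2 (linked_blockRep H i).symm

/-- The least letters of the classes of linked letters. -/
noncomputable def blockReps (H : C → Finset (Fin n)) : Finset (Fin n) :=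
  Finset.univ.filter fun i => blockRep H i = i

lemma mem_blockReps {i : Fin n} : i ∈ blockReps H ↔ blockRep H i = i := by simp [blockReps]

lemma blockRep_mem (i : Fin n) : blockRep H i ∈ blockReps H := mem_blockReps.2 (blockRep_blockRep i)

end Rep

namespace ChordDiagram

variable {n : ℕ} {C : Type*} {G : SimpleGraph (Fin (2 * n) ⊕ C)} [Finite C]

open Classical in
/-- The letters whose paths go through the inner node `p`. -/
noncomputable def block (hd : ChordDiagram G) (p : C) : Finset (Fin n) :=
  Finset.univ.filter fun i => Sum.inr p ∈ (hd.path i).support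

lemma mem_block (hd : ChordDiagram G) {p : C} {i : Fin n} :
    i ∈ hd.block p ↔ Sum.inr p ∈ (hd.path i).support := by simp [block]

lemma inl_mem_support (hd : ChordDiagram G) {i : Fin n} {k : Fin (2 * n)} :
    Sum.inl k ∈ (hd.path i).support ↔ k = outLeaf i ∨ k = inLeaf (hd.perm i) := by
  constructor
  · intro h
    obtain ⟨j, hj, hjl⟩ := SimpleGraph.Walk.mem_support_iff_exists_getVert.1 h
    by_cases h0 : j = 0
    · subst h0; left; simpa [eq_comm] using hj
    by_cases h1 : j = (hd.path i).length
    · subst h1; right; simpa [eq_comm] using hj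
    exfalso
    have h2 := (hd.isPath_path i).ncard_neighborSet_toSubgraph_internal_eq_two h0
      (lt_of_le_of_ne hjl h1)
    rw [hj] at h2
    have h3 := Set.ncard_le_ncard ((hd.path i).toSubgraph.neighborSet_subset (Sum.inl k))
      (Set.toFinite _)
    rw [h2, hd.ncard_neighborSet_leaf] at h3
    omega
  · rintro (rfl | rfl)
    · exact (hd.path i).start_mem_support
    · exact (hd.path i).end_mem_support

/-- Each path through the node uses two of its edges, and each edge lies on exactly one path. -/
lemma ncard_neighborSet_eq (hd : ChordDiagram G) (p : C) :
    (G.neighborSet (Sum.inr p)).ncard = 2 * (hd.block p).card := by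
  classical
  have := Fintype.ofFinite C
  have hmem : ∀ {y}, G.Adj (Sum.inr p) y → s(Sum.inr p, y) ∈ G.edgeSet := id
  have hex : ∀ y, G.Adj (Sum.inr p) y → ∃ i, s(Sum.inr p, y) ∈ (hd.path i).edges := fun y hy =>
    (hd.existsUnique_mem_edges (hmem hy)).exists
  have hunion : G.neighborSet (Sum.inr p) = ⋃ i ∈ (hd.block p : Set (Fin n)),
      (hd.path i).toSubgraph.neighborSet (Sum.inr p) := by
    ext y
    simp only [mem_iUnion, SimpleGraph.mem_neighborSet, SimpleGraph.Subgraph.mem_neighborSet]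
    constructor
    · intro hy
      obtain ⟨i, hi⟩ := hex y hy
      exact ⟨i, hd.mem_block.2 ((hd.path i).fst_mem_support_of_mem_edges hi),
        (hd.path i).mem_edges_toSubgraph.2 hi⟩
    · rintro ⟨i, -, hi⟩
      exact hi.adj_sub
  rw [hunion, Set.ncard_eq_toFinset_card', show (⋃ i ∈ (hd.block p : Set (Fin n)),
      (hd.path i).toSubgraph.neighborSet (Sum.inr p)).toFinset = (hd.block p).biUnion fun i =>
      ((hd.path i).toSubgraph.neighborSet (Sum.inr p)).toFinset by ext y; simp,
    Finset.card_biUnion, Finset.sum_const_nat (m := 2), mul_comm]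
  · intro i hi
    rw [← Set.ncard_eq_toFinset_card']
    obtain ⟨j, hj, hjl⟩ := SimpleGraph.Walk.mem_support_iff_exists_getVert.1 (hd.mem_block.1 hi)
    rw [← hj]
    refine (hd.isPath_path i).ncard_neighborSet_toSubgraph_internal_eq_two ?_
      (lt_of_le_of_ne hjl ?_)
    · rintro rfl; simp at hj
    · rintro rfl; simp at hj
  · intro i _ j _ hij
    rw [Function.onFun, Finset.disjoint_left]
    intro y hyi hyj
    apply hij
    rw [Set.mem_toFinset, SimpleGraph.Subgraph.mem_neighborSet] at hyi hyj
    exact (hd.existsUnique_mem_edges (hmem hyi.adj_sub)).unique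
      ((hd.path i).mem_edges_toSubgraph.1 hyi) ((hd.path j).mem_edges_toSubgraph.1 hyj)

lemma two_le_card_block (hd : ChordDiagram G) (p : C) : 2 ≤ (hd.block p).card := by
  have h1 := hd.ncard_neighborSet_eq p
  have h2 := hd.four_le p
  omega

lemma mem_edges_path_of_separates (hd : ChordDiagram G) {i : Fin n}
    {a b : Fin (2 * n) ⊕ C} {e : Sym2 (Fin (2 * n) ⊕ C)} (ha : a ∈ (hd.path i).support)
    (hb : b ∈ (hd.path i).support) (h : ¬ (G.deleteEdges {e}).Reachable a b) :
    e ∈ (hd.path i).edges := by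
  by_contra he
  exact h (((hd.path i).reachable_deleteEdges_of_mem_support he ha).symm.trans
    ((hd.path i).reachable_deleteEdges_of_mem_support he hb))

/-- The first edge on the path from `p` to `q` separates them, hence lies on the path of every
letter in both blocks; but it lies on the path of only one letter. -/
lemma eq_of_mem_block (hd : ChordDiagram G) {p q : C} (hpq : p ≠ q) {i j : Fin n}
    (hip : i ∈ hd.block p) (hiq : i ∈ hd.block q) (hjp : j ∈ hd.block p) (hjq : j ∈ hd.block q) :
    i = j := by
  classical
  rw [mem_block] at *
  have hr : G.Reachable (Sum.inr p) (Sum.inr q) :=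
    ((hd.path i).takeUntil _ hip).reachable.symm.trans ((hd.path i).takeUntil _ hiq).reachable
  obtain ⟨P, hP⟩ := hr.exists_isPath
  have hnil : ¬ P.Nil := SimpleGraph.Walk.not_nil_of_ne fun h => hpq (Sum.inr_injective h)
  have he := P.mk_start_snd_mem_edges hnil
  have hsep := (hd.acyclic.mem_edges_iff hP).1 he
  exact (hd.existsUnique_mem_edges (P.edges_subset_edgeSet he)).unique
    (hd.mem_edges_path_of_separates hip hiq hsep) (hd.mem_edges_path_of_separates hjp hjq hsep)

lemma block_injective (hd : ChordDiagram G) : Function.Injective hd.block := by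
  intro p q h
  by_contra hpq
  obtain ⟨i, hi, j, hj, hij⟩ := Finset.one_lt_card.1 (hd.two_le_card_block p)
  exact hij (hd.eq_of_mem_block hpq hi (h ▸ hi) hj (h ▸ hj))

/-- The order in which the path of the letter `i` visits its vertices. -/
def PathRel (H : C → Finset (Fin n)) (i k : Fin n) (a b : Fin (2 * n) ⊕ C) : Prop :=
  a = Sum.inl (outLeaf i) ∨ b = Sum.inl (inLeaf k) ∨ ∃ p q, a = Sum.inr p ∧ b = Sum.inr q ∧
    ∀ x ∈ H p, ∀ y ∈ H q, x ≠ i → y ≠ i → CycLt (outLeaf i) (outLeaf y) (outLeaf x)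

/-- An edge of path `i` between `p` and `q` keeps the other letters of `p` with `outLeaf i` and
those of `q` with its next leaf. No leaf of the tree lies between these two leaves and the sides do
not interlace, so the letters of later nodes come earlier in the counterclockwise order. -/
lemma pairwise_pathRel (hd : ChordDiagram G) (i : Fin n) :
    (hd.path i).support.Pairwise (PathRel hd.block i (hd.perm i)) := by
  refine List.Pairwise.imp_of_mem ?_ (hd.isPath_path i).pairwise_separated
  rintro a b ha hb ⟨e, he, hea, heb⟩
  have hsep := hd.mem_edges_path.1 he
  rcases a with k | p
  · rcases hd.inl_mem_support.1 ha with rfl | rfl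
    · exact Or.inl rfl
    · exact absurd hea hsep
  rcases b with k | q
  · rcases hd.inl_mem_support.1 hb with rfl | rfl
    · exact absurd heb hsep
    · exact Or.inr (Or.inl rfl)
  refine Or.inr (Or.inr ⟨p, q, rfl, rfl, ?_⟩)
  intro x hx y hy hxi hyi
  have hedge := (hd.path i).edges_subset_edgeSet he
  have hnot : ∀ {z}, z ≠ i → e ∉ (hd.path z).edges := fun hz h =>
    hz ((hd.existsUnique_mem_edges hedge).unique h he)
  have h1 : (G.deleteEdges {e}).Reachable (Sum.inl (outLeaf i)) (Sum.inl (outLeaf x)) :=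
    hea.trans ((hd.path x).reachable_deleteEdges_of_mem_support (hnot hxi)
      (hd.mem_block.1 hx)).symm
  have h2 : (G.deleteEdges {e}).Reachable (Sum.inl (inLeaf (hd.perm i))) (Sum.inl (outLeaf y)) :=
    ((hd.path y).reachable_deleteEdges_of_mem_support (hnot hyi)
      (hd.mem_block.1 hy)).trans heb |>.symm
  have hxy : outLeaf x ≠ outLeaf y := by
    intro h
    rw [h] at h1
    exact hsep (h1.trans h2.symm)
  have hix : outLeaf i ≠ outLeaf x := fun h => hxi (outLeaf_injective h).symm
  have hiy : outLeaf i ≠ outLeaf y := fun h => hyi (outLeaf_injective h).symm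
  have h3 := hd.not_cross (SimpleGraph.deleteEdges_le {e}) h1 h2 hsep
  have h4 : CycLt (outLeaf i) (inLeaf (hd.perm i)) (outLeaf x) :=
    cycLt_of_not hix (outLeaf_ne_inLeaf _ _) (outLeaf_ne_inLeaf _ _)
      ((hd.isNext i).not_cycLt _ (SimpleGraph.deleteEdges_reachable h1))
  have h5 := cycLt_of_not hxy hix.symm hiy.symm fun h => h3 ⟨h4, h⟩
  exact h5.rotate

/-- Blocks have at least two elements, so every node offers a letter other than `i` for the
comparison. -/
lemma pathRel_antisymm (hd : ChordDiagram G) (i : Fin n) {a b : Fin (2 * n) ⊕ C}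
    (h : PathRel hd.block i (hd.perm i) a b) (h' : PathRel hd.block i (hd.perm i) b a) : a = b := by
  have hex : ∀ p, ∃ x ∈ hd.block p, x ≠ i := fun p =>
    Finset.exists_mem_ne (hd.two_le_card_block p) i
  have hne := outLeaf_ne_inLeaf i (hd.perm i)
  rcases h with rfl | rfl | ⟨p, q, rfl, rfl, h⟩
  · rcases h' with h1 | h1 | ⟨p', q', h1, h2, h'⟩
    · exact h1.symm
    · exact absurd (Sum.inl_injective h1) hne
    · cases h2
  · rcases h' with h1 | h1 | ⟨p', q', h1, h2, h'⟩
    · exact absurd (Sum.inl_injective h1).symm hne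
    · exact h1
    · cases h1
  rcases h' with h1 | h1 | ⟨p', q', h1, h2, h'⟩
  · cases h1
  · cases h1
  obtain rfl := Sum.inr_injective h1
  obtain rfl := Sum.inr_injective h2
  obtain ⟨x, hx, hxi⟩ := hex p
  obtain ⟨y, hy, hyi⟩ := hex q
  exact absurd (h' y hy x hx hyi hxi) (h x hx y hy hxi hyi).asymm

/-- Both lists consist of the same vertices and are sorted by the antisymmetric relation `PathRel`,
which depends on blocks and permutation only. -/
lemma support_map_eq {C' : Type*} [Finite C'] {G' : SimpleGraph (Fin (2 * n) ⊕ C')}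
    (hd : ChordDiagram G) (hd' : ChordDiagram G') (hperm : hd.perm = hd'.perm) (ψ : C ≃ C')
    (hψ : ∀ p, hd'.block (ψ p) = hd.block p) (i : Fin n) :
    (hd.path i).support.map (Sum.map id ψ) = (hd'.path i).support := by
  have hinj : Function.Injective (Sum.map id ψ : Fin (2 * n) ⊕ C → Fin (2 * n) ⊕ C') :=
    Function.injective_id.sumMap ψ.injective
  refine List.Perm.eq_of_pairwise (le := PathRel hd'.block i (hd'.perm i))
    (fun a b _ _ => hd'.pathRel_antisymm i) ?_ (hd'.pairwise_pathRel i) ?_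
  · rw [List.pairwise_map]
    refine (hd.pairwise_pathRel i).imp ?_
    rintro a b (rfl | rfl | ⟨p, q, rfl, rfl, h⟩)
    · exact Or.inl rfl
    · exact Or.inr (Or.inl (by rw [← hperm]; rfl))
    · refine Or.inr (Or.inr ⟨ψ p, ψ q, rfl, rfl, ?_⟩)
      rwa [hψ, hψ]
  · rw [List.perm_ext_iff_of_nodup ((hd.isPath_path i).support_nodup.map hinj)
      (hd'.isPath_path i).support_nodup]
    intro a
    rw [List.mem_map]
    rcases a with k | p
    · rw [hd'.inl_mem_support]
      constructor
      · rintro ⟨k' | p, h1, h2⟩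
        · obtain rfl : k' = k := Sum.inl_injective h2
          rwa [hd.inl_mem_support, hperm] at h1
        · cases h2
      · intro h
        exact ⟨Sum.inl k, by rwa [hd.inl_mem_support, hperm], rfl⟩
    · rw [← hd'.mem_block]
      constructor
      · rintro ⟨k' | q, h1, h2⟩
        · cases h2
        · obtain rfl : ψ q = p := Sum.inr_injective h2
          rwa [hψ, hd.mem_block]
      · intro h
        refine ⟨Sum.inr (ψ.symm p), ?_, by simp⟩
        rw [← hd.mem_block, ← hψ]
        simpa using h

lemma adj_map {C' : Type*} [Finite C'] {G' : SimpleGraph (Fin (2 * n) ⊕ C')}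
    (hd : ChordDiagram G) (hd' : ChordDiagram G') (hperm : hd.perm = hd'.perm) (ψ : C ≃ C')
    (hψ : ∀ p, hd'.block (ψ p) = hd.block p) {x y : Fin (2 * n) ⊕ C} (h : G.Adj x y) :
    G'.Adj (Sum.map id ψ x) (Sum.map id ψ y) := by
  obtain ⟨i, hi⟩ := (hd.existsUnique_mem_edges (e := s(x, y)) h).exists
  have h1 := (hd'.path i).isChain_adj_support
  rw [← hd.support_map_eq hd' hperm ψ hψ i, List.isChain_map] at h1
  exact ((hd.path i).rel_or_rel_of_isChain h1 hi).elim id SimpleGraph.Adj.symm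

/-- A chord diagram is determined by its blocks and its permutation. -/
theorem exists_iso {C' : Type*} [Finite C'] {G' : SimpleGraph (Fin (2 * n) ⊕ C')}
    (hd : ChordDiagram G) (hd' : ChordDiagram G') (hperm : hd.perm = hd'.perm)
    (hblock : Set.range hd.block = Set.range hd'.block) :
    ∃ e : G ≃g G', ∀ k, e (Sum.inl k) = Sum.inl k := by
  have hex : ∀ p, ∃ q, hd'.block q = hd.block p := fun p => by
    have : hd.block p ∈ Set.range hd'.block := hblock ▸ ⟨p, rfl⟩
    exact this
  have hex' : ∀ q, ∃ p, hd.block p = hd'.block q := fun q => by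
    have : hd'.block q ∈ Set.range hd.block := hblock ▸ ⟨q, rfl⟩
    exact this
  choose f hf using hex
  choose g hg using hex'
  let ψ : C ≃ C' := ⟨f, g, fun p => hd.block_injective ((hg _).trans (hf p)),
    fun q => hd'.block_injective ((hf _).trans (hg q))⟩
  refine ⟨⟨Equiv.sumCongr (Equiv.refl _) ψ, fun {x y} => ⟨fun h => ?_, fun h => ?_⟩⟩, fun k => rfl⟩
  · have h1 := hd'.adj_map hd hperm.symm ψ.symm (fun q => hg q) h
    rcases x with x | x <;> rcases y with y | y <;> simpa using h1
  · exact hd.adj_map hd' hperm ψ (fun p => hf p) h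

lemma linked_of_reachable (hd : ChordDiagram G) {i : Fin n} {v : Fin (2 * n) ⊕ C}
    (h : G.Reachable (Sum.inl (outLeaf i)) v) :
    ∀ j, v ∈ (hd.path j).support → Linked hd.block i j := by
  have hleaf : ∀ {k l m}, Sum.inl k ∈ (hd.path l).support → Sum.inl k ∈ (hd.path m).support →
      l = m := by
    intro k l m h1 h2
    rcases hd.inl_mem_support.1 h1 with rfl | rfl <;> rcases hd.inl_mem_support.1 h2 with h3 | h3
    · exact outLeaf_injective h3
    · exact absurd h3 (outLeaf_ne_inLeaf _ _)
    · exact absurd h3.symm (outLeaf_ne_inLeaf _ _)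
    · exact hd.perm.injective (inLeaf_injective h3)
  rw [SimpleGraph.reachable_iff_reflTransGen] at h
  induction h with
  | refl =>
    intro j hj
    rw [hleaf (hd.path i).start_mem_support hj]
    exact Relation.ReflTransGen.refl
  | @tail b c _ hbc ih =>
    intro j hj
    obtain ⟨k, hk⟩ := (hd.existsUnique_mem_edges (e := s(b, c)) hbc).exists
    have h1 := ih k ((hd.path k).fst_mem_support_of_mem_edges hk)
    have h2 := (hd.path k).snd_mem_support_of_mem_edges hk
    rcases c with l | p
    · rwa [← hleaf h2 hj]
    · exact h1.trans (linked_of_mem (hd.mem_block.2 h2) (hd.mem_block.2 hj))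

lemma reachable_of_mem_block (hd : ChordDiagram G) {i : Fin n} {p : C} (h : i ∈ hd.block p) :
    G.Reachable (Sum.inl (outLeaf i)) (Sum.inr p) := by
  classical
  exact ((hd.path i).takeUntil _ (hd.mem_block.1 h)).reachable

lemma linked_iff (hd : ChordDiagram G) {i j : Fin n} :
    Linked hd.block i j ↔ G.Reachable (Sum.inl (outLeaf i)) (Sum.inl (outLeaf j)) := by
  constructor
  · intro h
    induction h with
    | refl => exact SimpleGraph.Reachable.refl _
    | tail _ h ih =>
      obtain ⟨p, h1, h2⟩ := h
      exact ih.trans ((hd.reachable_of_mem_block h1).trans (hd.reachable_of_mem_block h2).symm)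
  · exact fun h => hd.linked_of_reachable h j (hd.path j).start_mem_support

lemma exists_reachable_outLeaf (hd : ChordDiagram G) (v : Fin (2 * n) ⊕ C) :
    ∃ i, G.Reachable (Sum.inl (outLeaf i)) v := by
  have hex : ∃ y, G.Adj v y := by
    rcases v with k | p
    · exact (hd.leaf k).exists
    · have h1 : (G.neighborSet (Sum.inr p)).ncard ≠ 0 := by have := hd.four_le p; omega
      exact Set.nonempty_of_ncard_ne_zero h1
  obtain ⟨y, hy⟩ := hex
  obtain ⟨i, hi⟩ := (hd.existsUnique_mem_edges (e := s(v, y)) hy).exists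
  classical
  exact ⟨i, ((hd.path i).takeUntil v ((hd.path i).fst_mem_support_of_mem_edges hi)).reachable⟩

lemma card_connectedComponent (hd : ChordDiagram G) :
    Nat.card G.ConnectedComponent = (blockReps hd.block).card := by
  rw [← Set.ncard_univ, ← Set.ncard_coe_finset]
  symm
  refine Set.ncard_congr (fun i _ => G.connectedComponentMk (Sum.inl (outLeaf i)))
    (fun _ _ => mem_univ _) ?_ ?_
  · intro i j hi hj h
    have h1 := blockRep_eq_iff.2 (hd.linked_iff.2 (SimpleGraph.ConnectedComponent.exact h))
    rwa [mem_blockReps.1 hi, mem_blockReps.1 hj] at h1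
  · intro c _
    induction c using SimpleGraph.ConnectedComponent.ind with | _ v
    obtain ⟨i, hi⟩ := hd.exists_reachable_outLeaf v
    refine ⟨blockRep hd.block i, blockRep_mem i, SimpleGraph.ConnectedComponent.sound ?_⟩
    exact (hd.linked_iff.1 (linked_blockRep hd.block i)).symm.trans hi

/-- Vertices = edges + trees, where leaves have degree 1 and a node has twice the size of its block
as degree. This count makes every letter occur only once in the word. -/
lemma card_blockReps_add [Fintype C] (hd : ChordDiagram G) :
    (blockReps hd.block).card + ∑ p, ((hd.block p).card - 1) = n := by
  classical
  have h1 := hd.acyclic.card_eq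
  rw [hd.card_connectedComponent, Nat.card_eq_fintype_card, Fintype.card_sum, Fintype.card_fin] at h1
  have h2 := G.sum_degrees_eq_twice_card_edges
  rw [Fintype.sum_sum_type] at h2
  have h3 : ∀ v, G.degree v = (G.neighborSet v).ncard := fun v => by
    rw [← SimpleGraph.card_neighborSet_eq_degree, Set.ncard_eq_toFinset_card', Set.toFinset_card]
  simp only [h3, hd.ncard_neighborSet_leaf, hd.ncard_neighborSet_eq, Finset.sum_const,
    Finset.card_univ, Fintype.card_fin, smul_eq_mul, mul_one, ← Finset.mul_sum] at h2
  rw [← SimpleGraph.coe_edgeFinset, Set.ncard_coe_finset] at h1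
  have h4 : ∑ p, (hd.block p).card = ∑ p, ((hd.block p).card - 1) + Fintype.card C := by
    rw [← Finset.card_univ, Finset.card_eq_sum_ones, ← Finset.sum_add_distrib]
    refine Finset.sum_congr rfl fun p _ => ?_
    have := hd.two_le_card_block p
    omega
  omega

end ChordDiagram

end

/-! ### The permutation from the nesting of the trees -/

section

open Set

namespace ChordDiagram

variable {n : ℕ} {C : Type*} {G : SimpleGraph (Fin (2 * n) ⊕ C)} [Finite C]

lemma reachable_outLeaf_iff (hd : ChordDiagram G) {i j : Fin n} :
    G.Reachable (Sum.inl (outLeaf i)) (Sum.inl (outLeaf j)) ↔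
      blockRep hd.block i = blockRep hd.block j := by
  rw [blockRep_eq_iff, hd.linked_iff]

lemma reachable_blockRep (hd : ChordDiagram G) (i : Fin n) :
    G.Reachable (Sum.inl (outLeaf (blockRep hd.block i))) (Sum.inl (outLeaf i)) :=
  hd.reachable_outLeaf_iff.2 (blockRep_blockRep i)

/-- perm i < i means that the arc to the next leaf passes the starting point of the numbering, so
`i` is the last letter of its tree. -/
lemma le_of_perm_lt (hd : ChordDiagram G) {i j : Fin n} (hi : hd.perm i < i)
    (hij : blockRep hd.block i = blockRep hd.block j) : j ≤ i := by
  by_contra hlt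
  refine (hd.isNext i).not_cycLt _ (hd.reachable_outLeaf_iff.2 hij) (Or.inr (Or.inr ?_))
  simp only [outLeaf, inLeaf, Fin.lt_def] at *
  omega

lemma perm_lt_blockRep (hd : ChordDiagram G) {i : Fin n} (hi : hd.perm i < i) :
    hd.perm i < blockRep hd.block i := by
  by_contra hlt
  refine (hd.isNext i).not_cycLt _ (hd.reachable_blockRep i).symm (Or.inr (Or.inl ?_))
  simp only [outLeaf, inLeaf, Fin.lt_def] at *
  omega

/-- Among the letters of its own tree, the letter `perm i` is the last one before the tree of `i`. A
later one would make that tree cross the tree of `i`, which owns the leaf right after `outLeaf (perm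
i)`. -/
lemma le_perm_of_blockRep_eq (hd : ChordDiagram G) {i j : Fin n} (hi : hd.perm i < i)
    (hj : j < blockRep hd.block i)
    (hij : blockRep hd.block j = blockRep hd.block (hd.perm i)) : j ≤ hd.perm i := by
  by_contra hlt
  have h1 := hd.perm_lt_blockRep hi
  have h2 : blockRep hd.block i ≤ i := blockRep_le Relation.ReflTransGen.refl
  have h3 : blockRep hd.block (hd.perm i) ≤ hd.perm i := blockRep_le Relation.ReflTransGen.refl
  refine hd.not_cross le_rfl (a := outLeaf (hd.perm i)) (b := inLeaf (hd.perm i))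
    (c := outLeaf j) (d := outLeaf i) (hd.reachable_outLeaf_iff.2 hij.symm)
    (hd.isNext i).reachable.symm ?_ ?_
  · intro h
    have h4 := hd.reachable_outLeaf_iff.1 (h.trans (hd.isNext i).reachable.symm)
    exact absurd (h4 ▸ h3) (not_le.2 h1)
  · simp only [CycLt, outLeaf, inLeaf, Fin.lt_def, Fin.le_def] at *
    omega

/-- The next leaf of `j` lies in the arc between the leaf of `i` and its next leaf, so the whole
tree of `j` is nested in that arc and starts after `i`. -/
lemma blockRep_lt_of_between (hd : ChordDiagram G) {i j : Fin n} (h1 : i ≤ hd.perm j)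
    (h2 : hd.perm j < hd.perm i) : blockRep hd.block i < blockRep hd.block j := by
  have hne : ¬ G.Reachable (Sum.inl (outLeaf i)) (Sum.inl (outLeaf j)) := by
    intro h
    refine (hd.isNext i).not_cycLt _ (h.trans (hd.isNext j).reachable) (Or.inl ?_)
    simp only [outLeaf, inLeaf, Fin.lt_def, Fin.le_def] at *
    omega
  rw [hd.reachable_outLeaf_iff] at hne
  by_contra hlt
  have h3 : blockRep hd.block i ≤ i := blockRep_le Relation.ReflTransGen.refl
  refine hd.not_cross le_rfl (a := outLeaf (blockRep hd.block j)) (b := outLeaf i)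
    (c := inLeaf (hd.perm j)) (d := inLeaf (hd.perm i))
    ((hd.reachable_blockRep j).trans (hd.isNext j).reachable) (hd.isNext i).reachable ?_ ?_
  · rw [hd.reachable_outLeaf_iff, blockRep_blockRep]
    exact Ne.symm hne
  · simp only [CycLt, outLeaf, inLeaf, Fin.lt_def, Fin.le_def, Fin.ext_iff] at *
    omega

open Classical in
/-- The position of the tree with the least letter `b`: either `b` or the least letter of the
tree below which the tree is nested. -/
noncomputable def code (hd : ChordDiagram G) (b : Fin n) : Fin n :=
  if h : ∃ i, blockRep hd.block i = b ∧ hd.perm i < i then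
    blockRep hd.block (hd.perm h.choose) else b

lemma code_blockRep (hd : ChordDiagram G) {i : Fin n} (hi : hd.perm i < i) :
    hd.code (blockRep hd.block i) = blockRep hd.block (hd.perm i) := by
  have h : ∃ j, blockRep hd.block j = blockRep hd.block i ∧ hd.perm j < j := ⟨i, rfl, hi⟩
  rw [code, dif_pos h]
  obtain ⟨h1, h2⟩ := h.choose_spec
  congr 2
  exact le_antisymm (hd.le_of_perm_lt hi h1.symm) (hd.le_of_perm_lt h2 h1)

lemma code_blockRep_lt (hd : ChordDiagram G) {i : Fin n} (hi : hd.perm i < i) :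
    hd.code (blockRep hd.block i) < blockRep hd.block i := by
  rw [hd.code_blockRep hi]
  exact (blockRep_le Relation.ReflTransGen.refl).trans_lt (hd.perm_lt_blockRep hi)

lemma exists_of_code_ne (hd : ChordDiagram G) {b : Fin n} (hb : hd.code b ≠ b) :
    ∃ i, blockRep hd.block i = b ∧ hd.perm i < i := by
  by_contra h
  exact hb (by rw [code, dif_neg h])

lemma code_le (hd : ChordDiagram G) (b : Fin n) : hd.code b ≤ b := by
  by_cases hb : hd.code b = b
  · exact hb.le
  · obtain ⟨i, rfl, hi⟩ := hd.exists_of_code_ne hb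
    exact (hd.code_blockRep_lt hi).le

lemma code_mem (hd : ChordDiagram G) {b : Fin n} (hb : b ∈ blockReps hd.block) :
    hd.code b ∈ blockReps hd.block := by
  by_cases h : hd.code b = b
  · rwa [h]
  · obtain ⟨i, rfl, hi⟩ := hd.exists_of_code_ne h
    rw [hd.code_blockRep hi]
    exact blockRep_mem _

/-- The permutation of a chord diagram is determined by the trees of the letters and the code. -/
theorem perm_eq {C' : Type*} [Finite C'] {G' : SimpleGraph (Fin (2 * n) ⊕ C')}
    (hd : ChordDiagram G) (hd' : ChordDiagram G')
    (hrep : blockRep hd.block = blockRep hd'.block)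
    (hcode : ∀ b ∈ blockReps hd.block, hd.code b = hd'.code b) : hd.perm = hd'.perm := by
  have key : ∀ b, ∀ i, blockRep hd.block i = b → hd.perm i = hd'.perm i := by
    intro b
    -- From greater least letters to smaller ones: trees nested inside a gap of a tree have greater
    -- least letters.
    induction b using WellFoundedGT.induction with | _ b ih
    rintro i rfl
    have hcode' := hcode _ (blockRep_mem i)
    have hmax : hd.perm i < i ↔ hd'.perm i < i := by
      constructor
      · intro hi
        have h1 := hd.code_blockRep_lt hi
        rw [hcode'] at h1
        obtain ⟨j, hj, hjlt⟩ := hd'.exists_of_code_ne h1.ne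
        rw [hrep] at hj
        have h2 := hd'.le_of_perm_lt hjlt hj
        have h3 := hd.le_of_perm_lt hi (j := j) (by rw [hrep, hj])
        rwa [le_antisymm h3 h2] at hjlt
      · intro hi
        have h1 := hd'.code_blockRep_lt hi
        rw [← hrep, ← hcode'] at h1
        obtain ⟨j, hj, hjlt⟩ := hd.exists_of_code_ne h1.ne
        have h2 := hd.le_of_perm_lt hjlt hj
        have h3 := hd'.le_of_perm_lt hi (j := j) (by rw [← hrep, hj])
        rwa [le_antisymm h3 h2] at hjlt
    by_cases hi : hd.perm i < i
    · have hi' := hmax.1 hi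
      -- The code names the tree of the letter `perm i`, and `perm i` is the last letter of that
      -- tree before the tree of `i`; so both permutations agree at `i`.
      have h1 := hcode'
      rw [hd.code_blockRep hi, hrep, hd'.code_blockRep hi'] at h1
      refine le_antisymm ?_ ?_
      · refine hd'.le_perm_of_blockRep_eq hi' ?_ h1
        rw [← hrep]; exact hd.perm_lt_blockRep hi
      · refine hd.le_perm_of_blockRep_eq hi ?_ (by rw [hrep, h1])
        rw [hrep]; exact hd'.perm_lt_blockRep hi'
    · have hi' : ¬ hd'.perm i < i := fun h => hi (hmax.2 h)
      rcases lt_trichotomy (hd.perm i) (hd'.perm i) with h | h | h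
      · exfalso
        -- This `j` belongs to a tree nested in the gap of `i`, where the two permutations agree by
        -- induction; then both send it to `hd.perm i`, which forces j = i.
        obtain ⟨j, hj⟩ := hd'.perm.surjective (hd.perm i)
        have h1 := hd'.blockRep_lt_of_between (i := i) (j := j) (by rw [hj]; exact not_lt.1 hi)
          (by rw [hj]; exact h)
        rw [← hrep] at h1
        have h2 := ih _ h1 j rfl
        rw [hj] at h2
        rw [hd.perm.injective h2] at h1
        exact lt_irrefl _ h1
      · exact h
      · exfalso
        obtain ⟨j, hj⟩ := hd.perm.surjective (hd'.perm i)
        have h1 := hd.blockRep_lt_of_between (i := i) (j := j) (by rw [hj]; exact not_lt.1 hi')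
          (by rw [hj]; exact h)
        have h2 := ih _ h1 j rfl
        rw [hj] at h2
        rw [hd'.perm.injective h2] at h1
        exact lt_irrefl _ h1
  exact Equiv.ext fun i => key _ i rfl

end ChordDiagram

/-- The j-th element, counted from 0, has j + 1 possible values. The result is the number of
permutations, so such functions can be encoded by arrangements. -/
lemma card_subtype_le_self {α : Type*} [Fintype α] [LinearOrder α] :
    Fintype.card {f : α → α // ∀ b, f b ≤ b} = (Fintype.card α).factorial := by
  rw [Fintype.card_congr (Equiv.subtypePiEquivPi (p := fun b c : α => c ≤ b)), Fintype.card_pi]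
  have o := Fintype.orderIsoFinOfCardEq α rfl
  rw [← Finset.prod_range_add_one_eq_factorial, ← Fin.prod_univ_eq_prod_range fun i => i + 1,
    ← o.toEquiv.prod_comp]
  refine Finset.prod_congr rfl fun j _ => ?_
  rw [Fintype.card_congr (o.symm.toEquiv.subtypeEquiv (p := fun c => c ≤ o.toEquiv j)
    (q := fun c => c ≤ j) fun c => ?_), Fintype.card_subtype]
  · rw [show (Finset.univ.filter fun c => c ≤ j) = Finset.Iic j by ext; simp, Fin.card_Iic]
  · simp [OrderIso.symm_apply_le]

/-- The functions `f` on a finite set with `f b ≤ b` can be encoded by the arrangements of the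
set, with the identity encoded by the increasing arrangement. -/
lemma exists_arrangement {n : ℕ} (R : Finset (Fin n)) :
    ∃ Φ : (Fin n → Fin n) → List (Fin n), (∀ f, (Φ f).Perm R.sort) ∧
      (∀ f g, (∀ b ∈ R, f b ∈ R ∧ f b ≤ b) → (∀ b ∈ R, g b ∈ R ∧ g b ≤ b) → Φ f = Φ g →
        ∀ b ∈ R, f b = g b) ∧ ∀ f, (∀ b ∈ R, f b = b) → Φ f = R.sort := by
  classical
  have e : {f : R → R // ∀ b, f b ≤ b} ≃ Equiv.Perm R := Fintype.equivOfCardEq (by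
    rw [Fintype.card_perm, ← card_subtype_le_self]
    exact Fintype.card_congr (Equiv.refl _))
  let i : {f : R → R // ∀ b, f b ≤ b} := ⟨id, fun b => le_rfl⟩
  let A : (Fin n → Fin n) → {f : R → R // ∀ b, f b ≤ b} := fun f =>
    if h : ∀ b ∈ R, f b ∈ R ∧ f b ≤ b then
      ⟨fun b => ⟨f b, (h b b.2).1⟩, fun b => (h b b.2).2⟩ else i
  -- The bijection `e` is arbitrary; the factor (e i)⁻¹ normalises it so that the identity function
  -- gives the increasing arrangement. Functions that do not satisfy the condition are treated as
  -- the identity.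
  let π : (Fin n → Fin n) → Equiv.Perm R := fun f => (e i)⁻¹ * e (A f)
  refine ⟨fun f => R.sort.map (Equiv.Perm.ofSubtype (π f)), ?_, ?_, ?_⟩
  · intro f
    rw [List.perm_ext_iff_of_nodup ((R.sort_nodup _).map (Equiv.injective _)) (R.sort_nodup _)]
    intro a
    rw [List.mem_map]
    constructor
    · rintro ⟨b, hb, rfl⟩
      rw [Finset.mem_sort] at hb ⊢
      rw [Equiv.Perm.ofSubtype_apply_of_mem _ hb]
      exact Subtype.coe_prop _
    · intro ha
      rw [Finset.mem_sort] at ha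
      refine ⟨((π f).symm ⟨a, ha⟩ : R), by rw [Finset.mem_sort]; exact Subtype.coe_prop _, ?_⟩
      rw [Equiv.Perm.ofSubtype_apply_coe, Equiv.apply_symm_apply]
  · intro f g hf hg hfg b hb
    have h1 : π f = π g := by
      refine Equiv.ext fun c => Subtype.ext ?_
      have h2 := List.map_inj_left.1 hfg c (by rw [Finset.mem_sort]; exact c.2)
      rwa [Equiv.Perm.ofSubtype_apply_coe, Equiv.Perm.ofSubtype_apply_coe] at h2
    have h2 : A f = A g := e.injective (mul_left_cancel h1)
    have h3 := congrFun (congrArg Subtype.val h2) ⟨b, hb⟩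
    simp only [A, dif_pos hf, dif_pos hg] at h3
    exact congrArg Subtype.val h3
  · intro f hf
    have h1 : A f = i := by
      have h : ∀ b ∈ R, f b ∈ R ∧ f b ≤ b := fun b hb => by rw [hf b hb]; exact ⟨hb, le_rfl⟩
      simp only [A, dif_pos h, i]
      congr 1
      funext b
      exact Subtype.ext (hf b b.2)
    have h2 : π f = 1 := by simp only [π, h1, inv_mul_cancel]
    simp [h2]

end

/-! ### Words with prescribed groups -/

section

open Set

namespace ParenString

variable {α : Type}

/-- The first letters of the entries of the word. -/
def firsts : ParenString α → List α
  | nil => []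
  | letter a r => a :: firsts r
  | paren i r => (firsts i).take 1 ++ firsts r

/-- The concatenation of two words. -/
def append : ParenString α → ParenString α → ParenString α
  | nil, w => w
  | letter a r, w => letter a (append r w)
  | paren i r, w => paren i (append r w)

/-- The word without parentheses that consists of the letters of a list. -/
def ofList : List α → ParenString α
  | [] => nil
  | a :: l => letter a (ofList l)

/-- No group of the word is empty, and the letters of each group have the same value under `r`. -/
def Homogeneous {β : Type} (r : α → β) : ParenString α → Prop
  | nil => True
  | letter _ w => Homogeneous r w
  | paren i w => (firsts i ≠ [] ∧ ∃ c, ∀ a ∈ letters i, r a = c) ∧ Homogeneous r w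

lemma firsts_append (v w : ParenString α) : (append v w).firsts = v.firsts ++ w.firsts := by
  induction v with
  | nil => rfl
  | letter a r ih => simp [append, firsts, ih]
  | paren i r _ ih => simp [append, firsts, ih]

lemma letters_append (v w : ParenString α) : (append v w).letters = v.letters ++ w.letters := by
  induction v with
  | nil => rfl
  | letter a r ih => simp [append, letters, ih]
  | paren i r _ ih => simp [append, letters, ih]

lemma pairs_append (v w : ParenString α) : (append v w).pairs = v.pairs ++ w.pairs := by
  induction v with
  | nil => rfl
  | letter a r ih => simp [append, pairs, ih]
  | paren i r _ ih => simp [append, pairs, ih]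

lemma homogeneous_append {β : Type} {r : α → β} (v w : ParenString α) :
    (append v w).Homogeneous r ↔ v.Homogeneous r ∧ w.Homogeneous r := by
  induction v with
  | nil => simp [append, Homogeneous]
  | letter a v ih => simp [append, Homogeneous, ih]
  | paren i v _ ih => simp [append, Homogeneous, ih, and_assoc]

lemma firsts_ofList (l : List α) : (ofList l).firsts = l := by
  induction l with
  | nil => rfl
  | cons a l ih => simp [ofList, firsts, ih]

lemma letters_ofList (l : List α) : (ofList l).letters = l := by
  induction l with
  | nil => rfl
  | cons a l ih => simp [ofList, letters, ih]

lemma pairs_ofList (l : List α) : (ofList l).pairs = [] := by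
  induction l with
  | nil => rfl
  | cons a l ih => simp [ofList, pairs, ih]

lemma homogeneous_ofList {β : Type} (r : α → β) (l : List α) : (ofList l).Homogeneous r := by
  induction l with
  | nil => trivial
  | cons a l ih => exact ih

lemma letters_eq_firsts {w : ParenString α} (h : w.pairs = []) : w.letters = w.firsts := by
  induction w with
  | nil => rfl
  | letter a r ih => simp only [letters, firsts]; rw [ih h]
  | paren i r _ _ => simp [pairs] at h

lemma firsts_subset_letters (w : ParenString α) : w.firsts ⊆ w.letters := by
  induction w with
  | nil => exact fun _ h => h
  | letter a r ih => exact List.cons_subset_cons a ih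
  | paren i r ih1 ih2 =>
    exact List.append_subset.2 ⟨fun a ha => List.mem_append_left _ (ih1 (List.mem_of_mem_take ha)),
      fun a ha => List.mem_append_right _ (ih2 ha)⟩

lemma length_take_one {l : List α} (h : l ≠ []) : (l.take 1).length = 1 := by
  cases l with
  | nil => exact absurd rfl h
  | cons a l => rfl

/-- Empty groups are excluded, so each entry contributes exactly one first letter. -/
lemma Homogeneous.entries_eq {β : Type} {r : α → β} {w : ParenString α} (h : w.Homogeneous r) :
    w.entries = w.firsts.length := by
  induction w with
  | nil => rfl
  | letter a w ih => simp only [entries, firsts, List.length_cons]; rw [ih h]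
  | paren i w _ ih =>
    simp only [entries, firsts, List.length_append]
    rw [ih h.2, length_take_one h.1.1, add_comm]

lemma Homogeneous.exists_first {β : Type} {r : α → β} {w : ParenString α} (h : w.Homogeneous r)
    {a : α} (ha : a ∈ w.letters) : ∃ b ∈ w.firsts, r a = r b := by
  induction w with
  | nil => cases ha
  | letter b w ih =>
    rcases List.mem_cons.1 ha with rfl | ha
    · exact ⟨a, List.mem_cons_self, rfl⟩
    · obtain ⟨c, hc, hac⟩ := ih h ha
      exact ⟨c, List.mem_cons_of_mem _ hc, hac⟩
  | paren i w _ ih =>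
    rcases List.mem_append.1 ha with ha | ha
    · obtain ⟨⟨hne, c, hc⟩, -⟩ := h
      obtain ⟨b, hb⟩ := List.exists_mem_of_ne_nil _
        (List.ne_nil_of_length_pos (by rw [length_take_one hne]; exact one_pos))
      refine ⟨b, List.mem_append_left _ hb, ?_⟩
      rw [hc a ha, hc b (firsts_subset_letters i (List.mem_of_mem_take hb))]
    · obtain ⟨c, hc, hac⟩ := ih h.2 ha
      exact ⟨c, List.mem_append_right _ hc, hac⟩

/-- A cut in the list of first letters lifts to a cut of the word between outermost entries. This
isolates a run of entries that can be enclosed in a new pair of parentheses. -/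
lemma exists_append_of_firsts {w : ParenString α} {a b : List α} (h : w.firsts = a ++ b) :
    ∃ v v', w = append v v' ∧ v.firsts = a ∧ v'.firsts = b := by
  induction w generalizing a with
  | nil =>
    obtain ⟨rfl, rfl⟩ := List.append_eq_nil_iff.1 h.symm
    exact ⟨nil, nil, rfl, rfl, rfl⟩
  | letter c w ih =>
    cases a with
    | nil => exact ⟨nil, _, rfl, rfl, h⟩
    | cons c' a =>
      rw [firsts, List.cons_append, List.cons_eq_cons] at h
      obtain ⟨v, v', rfl, h1, h2⟩ := ih h.2
      exact ⟨letter c v, v', rfl, by rw [firsts, h1, h.1], h2⟩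
  | paren i w _ ih =>
    cases a with
    | nil => exact ⟨nil, _, rfl, rfl, h⟩
    | cons c' a =>
      rw [firsts] at h
      cases hi : i.firsts with
      | nil =>
        rw [hi] at h
        obtain ⟨v, v', rfl, h1, h2⟩ := ih h
        exact ⟨paren i v, v', rfl, by rw [firsts, hi, h1]; rfl, h2⟩
      | cons d l =>
        rw [hi, List.take_succ_cons, List.take_zero, List.singleton_append, List.cons_append,
          List.cons_eq_cons] at h
        obtain ⟨v, v', rfl, h1, h2⟩ := ih h.2
        refine ⟨paren i v, v', rfl, ?_, h2⟩
        rw [firsts, hi, h1, h.1]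
        rfl

end ParenString

/-- A word whose groups correspond to the blocks `H p` and whose entries have the first letters
`l`. -/
structure IsBlockWord {n : ℕ} {C : Type*} (H : C → Finset (Fin n)) (s : Finset C) (l : List (Fin n))
    (w : ParenString (Fin n)) (L : List C) (g : C → ParenString (Fin n)) : Prop where
  firsts_eq : w.firsts = l
  nodup : L.Nodup
  mem_iff : ∀ p, p ∈ L ↔ p ∈ s
  pairs_eq : w.pairs = L.map g
  homogeneous : w.Homogeneous (blockRep H)
  firsts_perm : ∀ p ∈ s, (g p).firsts.Perm (H p).toList
  entries_eq : ∀ p ∈ s, (g p).entries = (H p).card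
  blockRep_eq : ∀ p ∈ s, ∀ i ∈ (g p).letters, ∀ j ∈ H p, blockRep H i = blockRep H j

/-- If the blocks form a hyperforest with one of the given first letters in each of its trees, then
there is a word with these blocks and first letters. -/
lemma exists_isBlockWord {n : ℕ} {C : Type*} (H : C → Finset (Fin n))
    (s : Finset C) (l : List (Fin n)) (h2 : ∀ p ∈ s, 2 ≤ (H p).card)
    (hcard : l.length + ∑ p ∈ s, ((H p).card - 1) = n)
    (hcov : ∀ i, ∃ x ∈ l, Relation.ReflTransGen (fun i j => ∃ p ∈ s, i ∈ H p ∧ j ∈ H p) x i) :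
    ∃ w L g, IsBlockWord H s l w L g ∧ w.letters.Perm (List.finRange n) := by
  classical
  induction hs : s.card generalizing s l with
  | zero =>
    obtain rfl := Finset.card_eq_zero.1 hs
    refine ⟨ParenString.ofList l, [], fun _ => ParenString.nil, ?_, ?_⟩
    · constructor
      · exact ParenString.firsts_ofList l
      · exact List.nodup_nil
      · simp
      · exact ParenString.pairs_ofList l
      · exact ParenString.homogeneous_ofList _ l
      all_goals simp
    · rw [ParenString.letters_ofList]
      have hmem : ∀ i, i ∈ l := by
        intro i
        obtain ⟨x, hx, hxi⟩ := hcov i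
        rcases Relation.ReflTransGen.cases_tail hxi with rfl | ⟨_, _, p, hp, -⟩
        · exact hx
        · simp at hp
      -- Without blocks, `l` contains every letter and has length n by `hcard`; hence it has no
      -- repetitions.
      have hsub : List.finRange n ⊆ l := fun i _ => hmem i
      have h3 := (List.nodup_finRange n).subperm hsub
      exact (h3.perm_of_length_le (by rw [List.length_finRange]; simp at hcard; omega)).symm
  | succ k ih =>
    obtain ⟨p, hp, x, hxl, hxp⟩ : ∃ p ∈ s, ∃ x ∈ l, x ∈ H p := by
      obtain ⟨q, hq⟩ : s.Nonempty := Finset.card_pos.1 (by omega)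
      obtain ⟨i, hi⟩ : (H q).Nonempty := Finset.card_pos.1 (by have := h2 q hq; omega)
      obtain ⟨x, hx, hxi⟩ := hcov i
      rcases Relation.ReflTransGen.cases_head hxi with rfl | ⟨y, ⟨p, hp, hxp, -⟩, -⟩
      · exact ⟨q, hq, x, hx, hi⟩
      · exact ⟨p, hp, x, hx, hxp⟩
    obtain ⟨l₁, l₂, rfl⟩ := List.append_of_mem hxl
    -- Put the letters of the block in place of `x`, beginning with `x`, and build the word for the
    -- remaining blocks. Enclosing the run of entries with first letters `m` in parentheses creates
    -- the group of `p`, an entry whose first letter is again `x`.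
    set m := x :: ((H p).erase x).toList with hm
    have hmp : m.Perm (H p).toList := by
      have h3 := Finset.toList_cons (Finset.notMem_erase x (H p))
      rw [Finset.cons_eq_insert, Finset.insert_erase hxp] at h3
      exact h3.symm
    have hmem : ∀ i, i ∈ m ↔ i ∈ H p := fun i => by rw [hmp.mem_iff, Finset.mem_toList]
    have hmlen : m.length = (H p).card := by rw [hmp.length_eq, Finset.length_toList]
    obtain ⟨w, L, g, hw, hwl⟩ := ih (s.erase p) (l₁ ++ (m ++ l₂))
      (fun q hq => h2 q (Finset.mem_of_mem_erase hq)) (by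
        rw [← Finset.add_sum_erase s _ hp] at hcard
        have := h2 p hp
        simp only [List.length_append, List.length_cons, hmlen] at hcard ⊢
        omega) (by
        intro i
        obtain ⟨y, hy, hyi⟩ := hcov i
        induction hyi with
        | refl =>
          refine ⟨y, ?_, Relation.ReflTransGen.refl⟩
          simp only [List.mem_append, List.mem_cons] at hy ⊢
          rcases hy with hy | rfl | hy
          · exact Or.inl hy
          · exact Or.inr (Or.inl ((hmem y).2 hxp))
          · exact Or.inr (Or.inr hy)
        | @tail b c _ hbc ih' =>
          obtain ⟨q, hq, hbq, hcq⟩ := hbc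
          by_cases hqp : q = p
          · subst hqp
            exact ⟨c, by simp [(hmem c).2 hcq], Relation.ReflTransGen.refl⟩
          · obtain ⟨z, hz, hzb⟩ := ih'
            exact ⟨z, hz, hzb.tail ⟨q, Finset.mem_erase.2 ⟨hqp, hq⟩, hbq, hcq⟩⟩)
      (by rw [Finset.card_erase_of_mem hp, hs]; rfl)
    obtain ⟨v₁, v', rfl, hv₁, hv'⟩ := ParenString.exists_append_of_firsts hw.firsts_eq
    obtain ⟨v, v₂, rfl, hv, hv₂⟩ := ParenString.exists_append_of_firsts hv'
    have hhom := hw.homogeneous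
    rw [ParenString.homogeneous_append, ParenString.homogeneous_append] at hhom
    obtain ⟨hhom₁, hhomv, hhom₂⟩ := hhom
    have hpairs := hw.pairs_eq
    rw [ParenString.pairs_append, ParenString.pairs_append] at hpairs
    obtain ⟨L₁, L', rfl, hL₁, hL'⟩ := List.map_eq_append_iff.1 hpairs.symm
    have hnodup := hw.nodup
    have hpL : p ∉ L₁ ++ L' := fun h => Finset.notMem_erase p s ((hw.mem_iff p).1 h)
    have hrep : ∀ i ∈ v.letters, ∀ j ∈ H p, blockRep H i = blockRep H j := by
      intro i hi j hj
      obtain ⟨b, hb, hib⟩ := hhomv.exists_first hi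
      rw [hv, hmem] at hb
      rw [hib, blockRep_eq_iff]
      exact linked_of_mem hb hj
    have hupd : ∀ q ∈ s, q ≠ p → Function.update g p v q = g q ∧ q ∈ s.erase p := fun q hq hqp =>
      ⟨Function.update_of_ne hqp _ _, Finset.mem_erase.2 ⟨hqp, hq⟩⟩
    have hmap : ∀ M : List C, p ∉ M → M.map (Function.update g p v) = M.map g := fun M hM =>
      List.map_congr_left fun q hq => Function.update_of_ne (fun h : q = p => hM (h ▸ hq)) _ _
    refine ⟨v₁.append (ParenString.paren v v₂), L₁ ++ p :: L', Function.update g p v, ?_, ?_⟩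
    · constructor
      · rw [ParenString.firsts_append, ParenString.firsts, hv₁, hv₂, hv]
        rfl
      · exact (List.nodup_middle.2 (List.nodup_cons.2 ⟨hpL, hnodup⟩))
      · intro q
        have h3 := hw.mem_iff q
        rw [List.mem_append, Finset.mem_erase] at h3
        rw [List.mem_append, List.mem_cons]
        by_cases hqp : q = p
        · simp [hqp, hp]
        · simp only [hqp, false_or, h3, ne_eq, not_false_eq_true, true_and]
      · rw [List.mem_append, not_or] at hpL
        rw [ParenString.pairs_append, ParenString.pairs, List.map_append, List.map_cons,
          Function.update_self, hmap L₁ hpL.1, hmap L' hpL.2, hL₁, hL']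
      · rw [ParenString.homogeneous_append]
        refine ⟨hhom₁, ⟨by rw [hv]; exact List.cons_ne_nil _ _, blockRep H x, fun i hi =>
          hrep i hi x hxp⟩, hhom₂⟩
      · intro q hq
        by_cases hqp : q = p
        · subst hqp
          rw [Function.update_self, hv]; exact hmp
        · rw [(hupd q hq hqp).1]; exact hw.firsts_perm q (hupd q hq hqp).2
      · intro q hq
        by_cases hqp : q = p
        · subst hqp
          rw [Function.update_self, hhomv.entries_eq, hv, hmlen]
        · rw [(hupd q hq hqp).1]; exact hw.entries_eq q (hupd q hq hqp).2
      · intro q hq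
        by_cases hqp : q = p
        · subst hqp
          rw [Function.update_self]; exact hrep
        · rw [(hupd q hq hqp).1]; exact hw.blockRep_eq q (hupd q hq hqp).2
    · rw [ParenString.letters_append, ParenString.letters]
      rwa [ParenString.letters_append, ParenString.letters_append] at hwl

end

/-! ### The encoding and its inverse -/

section

open Set

/-- An arrangement of a set of letters that encodes a function. -/
noncomputable def arrangement {n : ℕ} (R : Finset (Fin n)) : (Fin n → Fin n) → List (Fin n) :=
  (exists_arrangement R).choose

section Range

variable {n : ℕ}

lemma linked_of_range_eq {C C' : Type*} {H : C → Finset (Fin n)} {H' : C' → Finset (Fin n)}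
    (h : Set.range H = Set.range H') {i j : Fin n} (hij : Linked H i j) : Linked H' i j := by
  refine Relation.ReflTransGen.mono ?_ _ _ hij
  rintro a b ⟨p, ha, hb⟩
  obtain ⟨q, hq⟩ : H p ∈ Set.range H' := h ▸ ⟨p, rfl⟩
  exact ⟨q, hq ▸ ha, hq ▸ hb⟩

lemma blockRep_of_range_eq {C C' : Type*} {H : C → Finset (Fin n)} {H' : C' → Finset (Fin n)}
    (h : Set.range H = Set.range H') : blockRep H = blockRep H' :=
  funext fun i => le_antisymm
    (blockRep_le (linked_of_range_eq h.symm (linked_blockRep H' i)))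
    (blockRep_le (linked_of_range_eq h (linked_blockRep H i)))

end Range

namespace ChordDiagram

variable {n : ℕ} {C : Type*} {G : SimpleGraph (Fin (2 * n) ⊕ C)} [Finite C]

/-- The word encodes the chord diagram. -/
def Encodes (hd : ChordDiagram G) (w : ParenString (Fin n)) : Prop :=
  ∃ s L g, (∀ p, p ∈ s) ∧
    IsBlockWord hd.block s (arrangement (blockReps hd.block) hd.code) w L g

lemma exists_encodes (hd : ChordDiagram G) :
    ∃ w : ParenString (Fin n), w.letters.Perm (List.finRange n) ∧ hd.Encodes w := by
  have := Fintype.ofFinite C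
  have hperm := (exists_arrangement (blockReps hd.block)).choose_spec.1 hd.code
  obtain ⟨w, L, g, h1, h2⟩ := exists_isBlockWord hd.block Finset.univ
    (arrangement (blockReps hd.block) hd.code) (fun p _ => hd.two_le_card_block p)
    (by rw [arrangement, hperm.length_eq, Finset.length_sort]; exact hd.card_blockReps_add)
    (fun i => ⟨blockRep hd.block i, by
      rw [arrangement, hperm.mem_iff, Finset.mem_sort]; exact blockRep_mem i,
      Relation.ReflTransGen.mono (fun _ _ ⟨p, hp⟩ => ⟨p, Finset.mem_univ p, hp⟩) _ _
        (linked_blockRep hd.block i).symm⟩)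
  exact ⟨w, h2, Finset.univ, L, g, Finset.mem_univ, h1⟩

/-- The first letters of the entries of a group form the block of its node, so the word alone gives
back the blocks and with them the trees. -/
lemma Encodes.range_block {hd : ChordDiagram G} {w : ParenString (Fin n)} (h : hd.Encodes w) :
    Set.range hd.block = {F | ∃ v ∈ w.pairs, v.firsts.toFinset = F} := by
  obtain ⟨s, L, g, hs, h⟩ := h
  have h1 : ∀ p, (g p).firsts.toFinset = hd.block p := fun p => by
    rw [List.toFinset_eq_of_perm _ _ (h.firsts_perm p (hs p)), Finset.toList_toFinset]
  ext F
  simp only [mem_range, mem_ofPred_eq, h.pairs_eq, List.mem_map, h.mem_iff, hs, true_and]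
  constructor
  · rintro ⟨p, rfl⟩; exact ⟨g p, ⟨p, rfl⟩, h1 p⟩
  · rintro ⟨_, ⟨p, rfl⟩, rfl⟩; exact ⟨p, (h1 p).symm⟩

/-- Chord diagrams with the same word are isomorphic. -/
theorem Encodes.exists_iso {C' : Type*} [Finite C'] {G' : SimpleGraph (Fin (2 * n) ⊕ C')}
    {hd : ChordDiagram G} {hd' : ChordDiagram G'} {w : ParenString (Fin n)} (h : hd.Encodes w)
    (h' : hd'.Encodes w) : ∃ e : G ≃g G', ∀ k, e (Sum.inl k) = Sum.inl k := by
  have hrange : Set.range hd.block = Set.range hd'.block := h.range_block.trans h'.range_block.symm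
  have hrep := blockRep_of_range_eq hrange
  have hreps : blockReps hd.block = blockReps hd'.block := by simp only [blockReps, hrep]
  refine hd.exists_iso hd' (hd.perm_eq hd' hrep ?_) hrange
  obtain ⟨_, _, _, _, h1⟩ := h
  obtain ⟨_, _, _, _, h2⟩ := h'
  -- The first letters of the outermost entries are the arrangement that encodes the code, so equal
  -- words have equal codes.
  have h3 := h1.firsts_eq.symm.trans h2.firsts_eq
  rw [← hreps] at h3
  refine (exists_arrangement (blockReps hd.block)).choose_spec.2.1 _ _
    (fun b hb => ⟨hd.code_mem hb, hd.code_le b⟩) (fun b hb => ⟨?_, hd'.code_le b⟩) h3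
  rw [hreps] at hb ⊢
  exact hd'.code_mem hb

/-- The word of the diagram without inner nodes in which the leaves of the same letter are joined
has no parentheses and its letters are in increasing order. -/
lemma Encodes.letters_eq_finRange [IsEmpty C] {hd : ChordDiagram G} {w : ParenString (Fin n)}
    (h : hd.Encodes w) (hadj : ∀ i, G.Adj (Sum.inl (outLeaf i)) (Sum.inl (inLeaf i))) :
    w.letters = List.finRange n := by
  obtain ⟨s, L, g, hs, h⟩ := h
  have hL : L = [] := List.eq_nil_iff_forall_not_mem.2 fun p => isEmptyElim p
  have hrep : ∀ i, blockRep hd.block i = i := by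
    intro i
    rcases Relation.ReflTransGen.cases_head (linked_blockRep hd.block i) with h1 | ⟨_, ⟨p, -⟩, -⟩
    · exact h1.symm
    · exact isEmptyElim p
  have hR : blockReps hd.block = Finset.univ := by ext i; simp [mem_blockReps, hrep]
  have hcode : ∀ b ∈ blockReps hd.block, hd.code b = b := by
    intro b _
    by_contra hb
    obtain ⟨i, -, hi⟩ := hd.exists_of_code_ne hb
    have h1 := hd.reachable_outLeaf_iff.1
      ((hd.isNext i).reachable.trans (hadj (hd.perm i)).symm.reachable)
    rw [hrep, hrep] at h1
    exact hi.ne h1.symm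
  rw [ParenString.letters_eq_firsts (by rw [h.pairs_eq, hL]; rfl), h.firsts_eq, arrangement,
    (exists_arrangement (blockReps hd.block)).choose_spec.2.2 _ hcode, hR]
  exact Fin.sort_univ n

/-- The pairs of parentheses of the word correspond to the inner nodes. -/
lemma Encodes.exists_equiv {hd : ChordDiagram G} {w : ParenString (Fin n)} (h : hd.Encodes w) :
    ∃ φ : Fin w.pairs.length ≃ C, ∀ q, (w.pairs.get q).entries = (hd.block (φ q)).card ∧
      ∀ i ∈ (w.pairs.get q).letters, G.Reachable (Sum.inl (outLeaf i)) (Sum.inr (φ q)) := by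
  classical
  obtain ⟨s, L, g, hs, h⟩ := h
  have hlen : w.pairs.length = L.length := by rw [h.pairs_eq, List.length_map]
  let φ := (finCongr hlen).trans
    (h.nodup.getEquivOfForallMemList L fun p => (h.mem_iff p).2 (hs p))
  have hφ : ∀ q, w.pairs.get q = g (φ q) := by
    intro q
    rw [List.get_eq_getElem]
    simp only [h.pairs_eq, List.getElem_map]
    rfl
  refine ⟨φ, fun q => ?_⟩
  rw [hφ]
  refine ⟨h.entries_eq _ (hs _), fun i hi => ?_⟩
  obtain ⟨j, hj⟩ : (hd.block (φ q)).Nonempty :=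
    Finset.card_pos.1 (by have := hd.two_le_card_block (φ q); omega)
  exact (hd.reachable_outLeaf_iff.2 (h.blockRep_eq _ (hs _) i hi j hj)).trans
    (hd.reachable_of_mem_block hj)

end ChordDiagram

namespace HarmonicPoly

variable {n : ℕ}

lemma chordDiagram (hn : 1 ≤ n) (u : HarmonicPoly n) : ChordDiagram u.forestGraph where
  acyclic := u.isAcyclic_forestGraph hn
  leaf := u.existsUnique_adj_leaf hn
  even p := by rw [u.ncard_neighborSet_node hn]; exact even_two_mul _
  four_le p := by
    rw [u.ncard_neighborSet_node hn]
    have := u.one_le_multiplicity hn p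
    omega
  noncrossing := u.not_cycLt_of_disjoint_walks hn

/-- An isomorphism of forests that fixes the leaves is a bijection between the inner nodes. -/
lemma SameForest.exists_equiv {u v : HarmonicPoly n} {e : u.forestGraph ≃g v.forestGraph}
    (he : ∀ k, e (Sum.inl k) = Sum.inl k) :
    ∃ ε : u.criticalSet ≃ v.criticalSet, ∀ p, e (Sum.inr p) = Sum.inr (ε p) := by
  have h1 : ∀ p : u.criticalSet, ∃ q, e (Sum.inr p) = Sum.inr q := by
    intro p
    cases h : e (Sum.inr p) with
    | inl k => cases e.injective (h.trans (he k).symm)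
    | inr q => exact ⟨q, rfl⟩
  have h2 : ∀ q : v.criticalSet, ∃ p, e (Sum.inr p) = Sum.inr q := by
    intro q
    cases h : e.symm (Sum.inr q) with
    | inl k =>
      have := congrArg e h
      rw [e.apply_symm_apply, he] at this
      cases this
    | inr p => exact ⟨p, by rw [← h, e.apply_symm_apply]⟩
  choose f hf using h1
  choose g hg using h2
  exact ⟨⟨f, g, fun p => Sum.inr_injective (e.injective ((hg _).trans (hf p).symm)),
    fun q => Sum.inr_injective ((hf _).symm.trans (hg q))⟩, hf⟩

end HarmonicPoly

end

theorem mainTheorem9 (n : ℕ) (hn : 1 ≤ n) :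
    ∃ enc : Forest n → ParenWord n,
      Function.Injective enc ∧
      (∀ u : HarmonicPoly n, u.IsInitial → (enc u.forest).1.letters = List.finRange n) ∧
      ∀ u : HarmonicPoly n,
        u.criticalSet.Finite ∧
        (enc u.forest).1.pairs.length = u.criticalSet.ncard ∧
        ∃ φ : Fin (enc u.forest).1.pairs.length ≃ u.criticalSet,
          ∀ q : Fin (enc u.forest).1.pairs.length,
            ((enc u.forest).1.pairs.get q).entries = u.multiplicity (φ q) + 1 ∧
            ∀ i ∈ ((enc u.forest).1.pairs.get q).letters,
              u.forestGraph.Reachable (u.oddLeaf i) (Sum.inr (φ q)) := by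
  have hfin : ∀ u : HarmonicPoly n, Finite u.criticalSet := fun u =>
    (u.finite_criticalSet hn).to_subtype
  have hW : ∀ u : HarmonicPoly n, ∃ w : ParenWord n, (u.chordDiagram hn).Encodes w.1 := fun u =>
    let ⟨w, h1, h2⟩ := (u.chordDiagram hn).exists_encodes
    ⟨⟨w, h1⟩, h2⟩
  choose W hW using hW
  have hsame : ∀ u : HarmonicPoly n, HarmonicPoly.SameForest (Quotient.out u.forest) u := fun u =>
    Quotient.exact (Quotient.out_eq u.forest)
  -- The word of a forest is that of a chosen representative. Nodes, degrees and trees pass to any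
  -- other `u` along an isomorphism that fixes the leaves.
  refine ⟨fun F => W F.out, ?_, ?_, ?_⟩
  · intro F F' h
    have h1 := hW F.out
    rw [show W F.out = W F'.out from h] at h1
    rw [← Quotient.out_eq F, ← Quotient.out_eq F']
    exact Quotient.sound (h1.exists_iso (hW F'.out))
  · rintro u ⟨hu, hadj⟩
    obtain ⟨e, he⟩ := hsame u
    obtain ⟨ε, -⟩ := HarmonicPoly.SameForest.exists_equiv he
    have : IsEmpty u.criticalSet := Set.isEmpty_coe_sort.2 hu
    have := ε.isEmpty
    refine (hW u.forest.out).letters_eq_finRange fun i => ?_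
    rw [← e.map_adj_iff, he, he]
    exact hadj i
  · intro u
    obtain ⟨e, he⟩ := hsame u
    obtain ⟨ε, hε⟩ := HarmonicPoly.SameForest.exists_equiv he
    obtain ⟨φ, hφ⟩ := (hW u.forest.out).exists_equiv
    refine ⟨u.finite_criticalSet hn, ?_, φ.trans ε, fun q => ⟨?_, fun i hi => ?_⟩⟩
    · rw [← Nat.card_coe_set_eq, ← Nat.card_congr (φ.trans ε), Nat.card_fin]
    · refine (hφ q).1.trans ?_
      -- Multiplicities are invariants of the graph: the degree of the node is 2 |block| for the
      -- representative and 2 (multiplicity + 1) for `u`.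
      have h1 := (u.forest.out.chordDiagram hn).ncard_neighborSet_eq (φ q)
      have h2 := u.ncard_neighborSet_node hn (ε (φ q))
      rw [← hε, ← Nat.card_coe_set_eq, ← Nat.card_congr (e.mapNeighborSet (Sum.inr (φ q))),
        Nat.card_coe_set_eq, h1] at h2
      exact Nat.eq_of_mul_eq_mul_left two_pos h2
    · have h1 := ((hφ q).2 i hi).map e.toHom
      change u.forestGraph.Reachable (e (Sum.inl (outLeaf i))) (e (Sum.inr (φ q))) at h1
      rw [he, hε] at h1
      exact h1
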